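/- All graphs are finite and simple. Two vertices $u,v$ of a graph $G$ are twins if $N_G(u)\setminus\{v\}=N_G(v)\setminus\{u\}$. A set $S\subseteq V(G)$ is a twin cover of $G$ if every edge of $G$ whose endpoints are not twins has at least one endpoint in $S$, and the twin cover number $\mathrm{tc}(G)$ is the minimum size of a twin cover of $G$. The problem Maximum Common Induced Subgraph asks, given graphs $G_1,G_2$ and an integer $h\ge 0$, whether there is a graph $H$ with at least $h$ vertices such that both $G_1$ and $G_2$ contain an induced subgraph isomorphic to $H$. Theorem. Maximum Common Induced Subgraph is fixed-parameter tractable parameterized by $\mathrm{tc}(G_1)+\mathrm{tc}(G_2)$. That is, there are a deterministic algorithm (a program for a unit-cost random access machine with addition and truncated subtraction), a computable function $f\colon\mathbb{N}\to\mathbb{N}$ and a constant $c$ such that, on every instance $(G_1,G_2,h)$, given by $|V(G_1)|$, $|V(G_2)|$, $h$ and the two adjacency matrices, the algorithm decides the instance correctly within $f(\mathrm{tc}(G_1)+\mathrm{tc}(G_2))\cdot N^{c}$ steps, where $N=3+|V(G_1)|^2+|V(G_2)|^2$ is the length of the input. -/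

import Mathlib

/-! ### Twin covers -/

namespace SimpleGraph

/-- Two vertices are twins if they have the same neighborhood when the adjacency between them
is ignored: `N(u) \ {v} = N(v) \ {u}`. -/
def Twins {V : Type*} (G : SimpleGraph V) (u v : V) : Prop :=
  G.neighborSet u \ {v} = G.neighborSet v \ {u}

/-- A set of vertices is a twin cover if every edge whose endpoints are not twins has at least
one endpoint in the set. -/
def IsTwinCover {V : Type*} (G : SimpleGraph V) (S : Finset V) : Prop :=
  ∀ u v : V, G.Adj u v → ¬ G.Twins u v → u ∈ S ∨ v ∈ S

/-- The twin cover number: the minimum size of a twin cover. On a finite graph the set below is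
nonempty, as the set of all vertices is a twin cover. -/
noncomputable def twinCoverNumber {V : Type*} [Fintype V] (G : SimpleGraph V) : ℕ :=
  sInf {k : ℕ | ∃ S : Finset V, G.IsTwinCover S ∧ S.card = k}

end SimpleGraph

/-! ### A random access machine with unit cost

A program has finitely many registers and finitely many arrays of unbounded length, all of them
holding natural numbers. The arithmetic is addition and truncated subtraction only (no
multiplication), so that unit cost is polynomially related to the time of a Turing machine. -/

namespace RAM

/-- The contents of the registers, and of the cells of the arrays (array name, then index). -/
structure State where
  reg : ℕ → ℕ
  arr : ℕ → ℕ → ℕ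

/-- `s.setReg x v` is `s` with the value `v` written to register `x`. -/
def State.setReg (s : State) (x v : ℕ) : State :=
  { s with reg := Function.update s.reg x v }

/-- `s.setArr a i v` is `s` with the value `v` written to the cell `i` of the array `a`. -/
def State.setArr (s : State) (a i v : ℕ) : State :=
  { s with arr := Function.update s.arr a (Function.update (s.arr a) i v) }

/-- Programs. Registers are called `x`, `y`, `z` and arrays `a`; these names and the number `c`
are constants in the program text. -/
inductive Prog : Type
  /-- do nothing -/
  | skip : Prog
  /-- `x := c` -/
  | const (x c : ℕ) : Prog
  /-- `x := y` -/
  | copy (x y : ℕ) : Prog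
  /-- `x := y + z` -/
  | plus (x y z : ℕ) : Prog
  /-- `x := max (y - z) 0` -/
  | monus (x y z : ℕ) : Prog
  /-- `x := a[y]` -/
  | load (x a y : ℕ) : Prog
  /-- `a[x] := y` -/
  | store (a x y : ℕ) : Prog
  /-- first `p`, then `q` -/
  | seq (p q : Prog) : Prog
  /-- `if x ≠ 0 then p else q` -/
  | ite (x : ℕ) (p q : Prog) : Prog
  /-- `while x ≠ 0 do p` -/
  | loop (x : ℕ) (p : Prog) : Prog

/-- `Exec p s t s'`: the program `p`, started in the state `s`, halts after exactly `t` steps in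
the state `s'`. Every elementary instruction and every test of a conditional or a loop is one
step. -/
inductive Exec : Prog → State → ℕ → State → Prop
  | skip (s : State) : Exec .skip s 1 s
  | const (x c : ℕ) (s : State) : Exec (.const x c) s 1 (s.setReg x c)
  | copy (x y : ℕ) (s : State) : Exec (.copy x y) s 1 (s.setReg x (s.reg y))
  | plus (x y z : ℕ) (s : State) : Exec (.plus x y z) s 1 (s.setReg x (s.reg y + s.reg z))
  | monus (x y z : ℕ) (s : State) : Exec (.monus x y z) s 1 (s.setReg x (s.reg y - s.reg z))
  | load (x a y : ℕ) (s : State) : Exec (.load x a y) s 1 (s.setReg x (s.arr a (s.reg y)))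
  | store (a x y : ℕ) (s : State) : Exec (.store a x y) s 1 (s.setArr a (s.reg x) (s.reg y))
  | seq {p q : Prog} {s₀ s₁ s₂ : State} {t₁ t₂ : ℕ} :
      Exec p s₀ t₁ s₁ → Exec q s₁ t₂ s₂ → Exec (.seq p q) s₀ (t₁ + t₂) s₂
  | ite_true {x : ℕ} {p q : Prog} {s s' : State} {t : ℕ} :
      s.reg x ≠ 0 → Exec p s t s' → Exec (.ite x p q) s (1 + t) s'
  | ite_false {x : ℕ} {p q : Prog} {s s' : State} {t : ℕ} :
      s.reg x = 0 → Exec q s t s' → Exec (.ite x p q) s (1 + t) s'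
  | loop_true {x : ℕ} {p : Prog} {s₀ s₁ s₂ : State} {t₁ t₂ : ℕ} :
      s₀.reg x ≠ 0 → Exec p s₀ t₁ s₁ → Exec (.loop x p) s₁ t₂ s₂ →
        Exec (.loop x p) s₀ (1 + t₁ + t₂) s₂
  | loop_false {x : ℕ} {p : Prog} {s : State} :
      s.reg x = 0 → Exec (.loop x p) s 1 s

/-- Programs are deterministic: the running time and the final state are determined by the
program and the initial state. -/
theorem Exec.deterministic {p : Prog} {s s' : State} {t : ℕ} (h : Exec p s t s') :
    ∀ {t₁ : ℕ} {s₁ : State}, Exec p s t₁ s₁ → t = t₁ ∧ s' = s₁ := by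
  induction h with
  | seq _ _ ih₁ ih₂ =>
    intro _ _ h
    cases h with
    | seq a b =>
      obtain ⟨rfl, rfl⟩ := ih₁ a
      obtain ⟨rfl, rfl⟩ := ih₂ b
      exact ⟨rfl, rfl⟩
  | ite_true hx _ ih =>
    intro _ _ h
    cases h with
    | ite_true _ a => obtain ⟨rfl, rfl⟩ := ih a; exact ⟨rfl, rfl⟩
    | ite_false hx' _ => exact absurd hx' hx
  | ite_false hx _ ih =>
    intro _ _ h
    cases h with
    | ite_true hx' _ => exact absurd hx hx'
    | ite_false _ a => obtain ⟨rfl, rfl⟩ := ih a; exact ⟨rfl, rfl⟩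
  | loop_true hx _ _ ih₁ ih₂ =>
    intro _ _ h
    cases h with
    | loop_true _ a b =>
      obtain ⟨rfl, rfl⟩ := ih₁ a
      obtain ⟨rfl, rfl⟩ := ih₂ b
      exact ⟨rfl, rfl⟩
    | loop_false hx' => exact absurd hx' hx
  | loop_false hx =>
    intro _ _ h
    cases h with
    | loop_true hx' _ _ => exact absurd hx hx'
    | loop_false _ => exact ⟨rfl, rfl⟩
  | _ =>
    intro _ _ h
    cases h
    exact ⟨rfl, rfl⟩

/-- The initial state on a given input: the input is in array `0`, and all other array cells and
all registers are `0`. -/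
def initState (w : List ℕ) : State where
  reg := fun _ => 0
  arr := fun a i => if a = 0 then w.getD i 0 else 0

end RAM

/-- The decision problem `L` on the instances `I`, which are given to the machine through the
encoding `enc`, is fixed-parameter tractable with respect to the parameter `κ`: one program
halts on every instance `x` within `f (κ x) * |x| ^ c` steps, where `f` is a computable function,
`c` is a constant and `|x|` is the length of the encoding of `x`; its answer in register `0` is
`1` on the yes-instances and `0` on the no-instances. -/
def IsFPT {I : Type} (enc : I → List ℕ) (κ : I → ℕ) (L : I → Prop) : Prop :=
  ∃ (p : RAM.Prog) (f : ℕ → ℕ) (c : ℕ), Computable f ∧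
    ∀ x : I, ∃ (t : ℕ) (s : RAM.State),
      RAM.Exec p (RAM.initState (enc x)) t s ∧
      t ≤ f (κ x) * (enc x).length ^ c ∧
      (L x → s.reg 0 = 1) ∧ (¬ L x → s.reg 0 = 0)

/-! ### Maximum Common Induced Subgraph -/

/-- An instance of Maximum Common Induced Subgraph: two finite graphs and a number `h`. -/
structure MCISInstance where
  n₁ : ℕ
  n₂ : ℕ
  G₁ : SimpleGraph (Fin n₁)
  G₂ : SimpleGraph (Fin n₂)
  h : ℕ

namespace MCISInstance

/-- The question: is there a graph `H` with at least `h` vertices such that both graphs contain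
an induced subgraph isomorphic to `H`? -/
def IsYes (x : MCISInstance) : Prop :=
  ∃ (m : ℕ) (H : SimpleGraph (Fin m)),
    x.h ≤ m ∧ H.IsIndContained x.G₁ ∧ H.IsIndContained x.G₂

/-- The adjacency matrix of a graph, written row by row. -/
noncomputable def adjList {n : ℕ} (G : SimpleGraph (Fin n)) : List ℕ :=
  open Classical in
  (List.finRange n).flatMap fun i => (List.finRange n).map fun j => if G.Adj i j then 1 else 0

/-- An instance is given by the numbers of vertices, the number `h`, and the two adjacency
matrices. -/
noncomputable def encode (x : MCISInstance) : List ℕ :=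
  [x.n₁, x.n₂, x.h] ++ adjList x.G₁ ++ adjList x.G₂

/-- The sum of the twin cover numbers of the two graphs. -/
noncomputable def tcSum (x : MCISInstance) : ℕ :=
  x.G₁.twinCoverNumber + x.G₂.twinCoverNumber

end MCISInstance

/-! Outside a twin cover `S` a graph is a disjoint union of cliques. The vertices of one clique are
twins, so they have the same neighbors in `S`; this common neighborhood is the type of the clique. A
greedy maximal matching of the edges between non-twins yields a twin cover of at most twice the
minimum size (`Greedy.cnt_le`, `natGr_valid`), which is good enough for the parameter.

A common induced subgraph is a partial isomorphism, a set of pairs of vertices. Call a pair special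
if one of its vertices lies in a twin cover; with `K - 1` cover vertices in total there are fewer
than `K` special pairs. Once the special part is fixed, as a function `f` on a set `I`, the best
extension by other pairs is explicit. Each remaining vertex has a profile (its adjacencies to the
vertices taken out), constant on cliques. Cliques with equal profiles may be matched freely, and the
best way is to sort them by size and match the largest with the largest. Counted by positions inside
the cliques, the gain is the sum over all labels (profile, position) of the smaller of the two
numbers of vertices with that label. This is `extVal`; `exists_ext` attains it and `card_ext_le`
shows that nothing does better.

It remains to restrict the special parts to a number bounded in `K`. Suppose images of cover
vertices of `G` lie in a clique `c` of `H`, and move all `a` of them to an untouched clique `c'` of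
the same type. Let `p` be the profile that `c` would have without them and `p ∪ A` the one it has
with them. Only these two profiles are affected, and in `H` only the clique holding the images has
profile `p ∪ A`. If `d` is the largest remaining part of a clique of `G` with profile `p ∪ A`, the
move loses nothing when the size of `c'` lies between that of `c` and the threshold `d + a`
(`move_sum_le`, `Move.extVal_le`). Hence `c'` can be taken among the `K` cliques of its type closest
to the threshold on one side, because fewer than `K` are touched. There are few thresholds: either
`d = 0`, or `d` is the size of a clique of `G` that is among the largest of its type (`exists_top`),
or no vertex of `G` has profile `p` and every larger clique is acceptable, with threshold `N`. The
resulting pools have size at most `poolBound K` (`cnt_pool_le`), and applying the exchange on both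
sides gives `exists_pool_map`.

The algorithm computes the matchings, the pools and a table of powers, and then tries every partial
map between the pools, written as a number in base one plus the size of the second pool. Every test
is a formula made of bounded quantifiers and bounded counting. Such formulas are compiled to
programs by the closure properties of `Cp`, all loops running up to one bound kept in memory. The
running time is therefore polynomial in this bound, which is at most a function of the parameter
times the input length (`bound_le`). -/

namespace RAM

/-! ### Running programs within a time bound -/

/-- The program `p` takes the state `s` to `s'` within `T` steps. -/
def Runs (p : Prog) (s : State) (T : ℕ) (s' : State) : Prop :=
  ∃ t ≤ T, Exec p s t s'

theorem Runs.mono {p : Prog} {s s' : State} {T T' : ℕ} (h : Runs p s T s') (hT : T ≤ T') :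
    Runs p s T' s' := by
  obtain ⟨t, ht, e⟩ := h
  exact ⟨t, ht.trans hT, e⟩

theorem Runs.seq {p q : Prog} {s₀ s₁ s₂ : State} {T₁ T₂ : ℕ} (h₁ : Runs p s₀ T₁ s₁)
    (h₂ : Runs q s₁ T₂ s₂) : Runs (.seq p q) s₀ (T₁ + T₂) s₂ := by
  obtain ⟨t₁, ht₁, e₁⟩ := h₁
  obtain ⟨t₂, ht₂, e₂⟩ := h₂
  exact ⟨t₁ + t₂, add_le_add ht₁ ht₂, .seq e₁ e₂⟩

theorem Runs.const (x c : ℕ) (s : State) : Runs (.const x c) s 1 (s.setReg x c) :=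
  ⟨1, le_rfl, .const x c s⟩

theorem Runs.copy (x y : ℕ) (s : State) : Runs (.copy x y) s 1 (s.setReg x (s.reg y)) :=
  ⟨1, le_rfl, .copy x y s⟩

theorem Runs.plus (x y z : ℕ) (s : State) :
    Runs (.plus x y z) s 1 (s.setReg x (s.reg y + s.reg z)) :=
  ⟨1, le_rfl, .plus x y z s⟩

theorem Runs.monus (x y z : ℕ) (s : State) :
    Runs (.monus x y z) s 1 (s.setReg x (s.reg y - s.reg z)) :=
  ⟨1, le_rfl, .monus x y z s⟩

theorem Runs.load (x a y : ℕ) (s : State) :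
    Runs (.load x a y) s 1 (s.setReg x (s.arr a (s.reg y))) :=
  ⟨1, le_rfl, .load x a y s⟩

theorem Runs.store (a x y : ℕ) (s : State) :
    Runs (.store a x y) s 1 (s.setArr a (s.reg x) (s.reg y)) :=
  ⟨1, le_rfl, .store a x y s⟩

theorem State.setReg_reg_self (s : State) (x v : ℕ) : (s.setReg x v).reg x = v := by
  simp [State.setReg]

theorem State.setReg_reg_of_ne (s : State) {x y : ℕ} (v : ℕ) (h : y ≠ x) :
    (s.setReg x v).reg y = s.reg y := by
  simp [State.setReg, h]

@[simp] theorem State.setReg_arr (s : State) (x v : ℕ) : (s.setReg x v).arr = s.arr := rfl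

@[simp] theorem State.setReg_reg (s : State) (x v y : ℕ) :
    (s.setReg x v).reg y = if y = x then v else s.reg y := by
  simp [State.setReg, Function.update_apply]

@[simp] theorem State.setArr_reg (s : State) (a i v : ℕ) : (s.setArr a i v).reg = s.reg := rfl

/-- A loop whose counter `x` goes down from `n` to `0` keeps an invariant. -/
theorem Runs.countdown {x n T : ℕ} {p : Prog} (Inv : ℕ → State → Prop)
    (hx : ∀ j s, Inv j s → s.reg x = n - j)
    (hp : ∀ j s, j < n → Inv j s → ∃ s', Runs p s T s' ∧ Inv (j + 1) s')
    {s : State} (hs : Inv 0 s) :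
    ∃ s', Runs (.loop x p) s (n * (T + 1) + 1) s' ∧ Inv n s' := by
  suffices H : ∀ m j s, j + m = n → Inv j s →
      ∃ s', Runs (.loop x p) s (m * (T + 1) + 1) s' ∧ Inv n s' from H n 0 s (by omega) hs
  intro m
  induction m with
  | zero =>
    intro j s hj hI
    obtain rfl : j = n := by omega
    exact ⟨s, ⟨1, by simp, .loop_false (by rw [hx _ _ hI]; omega)⟩, hI⟩
  | succ m ih =>
    intro j s hj hI
    obtain ⟨s₁, ⟨t₁, ht₁, e₁⟩, hI₁⟩ := hp j s (by omega) hI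
    obtain ⟨s₂, ⟨t₂, ht₂, e₂⟩, hI₂⟩ := ih (j + 1) s₁ (by omega) hI₁
    refine ⟨s₂, ⟨1 + t₁ + t₂, ?_, .loop_true (by rw [hx _ _ hI]; omega) e₁ e₂⟩, hI₂⟩
    have : (m + 1) * (T + 1) = m * (T + 1) + (T + 1) := by ring
    omega

/-! ### Functions computed in polynomial time relative to a bound stored in memory -/

/-- The contents of the arrays. -/
structure Mem where
  cell : ℕ → ℕ → ℕ

/-- The bound for all loops is kept in cell `0` of array `1`. -/
def Mem.bd (A : Mem) : ℕ := A.cell 1 0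

/-- Data that the machine can hold: finitely many numbers, and possibly a reference to the
current contents of the arrays. -/
class Ctx (Γ : Type) where
  /-- the number of registers used -/
  dim : ℕ
  /-- the contents of the registers -/
  val : Γ → ℕ → ℕ
  /-- the arrays of the machine are those referred to -/
  Rep : Γ → (ℕ → ℕ → ℕ) → Prop

open Classical in
noncomputable instance : Ctx Prop := ⟨1, fun P _ => if P then 1 else 0, fun _ _ => True⟩

instance : Ctx ℕ := ⟨1, fun n _ => n, fun _ _ => True⟩

/-- A memory occupies no register: it is never copied, and is represented by the arrays of the
machine themselves. -/
instance : Ctx Mem := ⟨0, fun _ _ => 0, fun A a => A.cell = a⟩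

/-- The registers are concatenated. Both components must be represented by the same arrays, so two
memories in one context are equal. -/
instance {Γ Δ : Type} [Ctx Γ] [Ctx Δ] : Ctx (Γ × Δ) :=
  ⟨Ctx.dim Γ + Ctx.dim Δ,
    fun p i => if i < Ctx.dim Γ then Ctx.val p.1 i else Ctx.val p.2 (i - Ctx.dim Γ),
    fun p a => Ctx.Rep p.1 a ∧ Ctx.Rep p.2 a⟩

/-- The number `F γ` is computed by a program from `γ`, held in arbitrary registers `loc i`. The
result is written to the register `out`, and no register below it is changed. The time is
polynomial in the bound stored in memory. -/
def CpN {Γ : Type} [Ctx Γ] (F : Γ → ℕ) : Prop :=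
  ∃ C k : ℕ, ∀ (loc : ℕ → ℕ) (out : ℕ), (∀ i < Ctx.dim Γ, loc i < out) → ∃ p : Prog,
    ∀ (γ : Γ) (s : State), Ctx.Rep γ s.arr → (∀ i < Ctx.dim Γ, s.reg (loc i) = Ctx.val γ i) →
      ∃ s', Runs p s (C * (s.arr 1 0 + 1) ^ k) s' ∧ s'.arr = s.arr ∧ s'.reg out = F γ ∧
        ∀ x < out, s'.reg x = s.reg x

/-- All parts of `f γ` are computed by programs from `γ`. -/
@[fun_prop]
def Cp {Γ Δ : Type} [Ctx Γ] [Ctx Δ] (f : Γ → Δ) : Prop :=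
  (∀ γ a, Ctx.Rep γ a → Ctx.Rep (f γ) a) ∧ ∀ i < Ctx.dim Δ, CpN fun γ => Ctx.val (f γ) i

section closure

variable {Γ Δ Θ : Type} [Ctx Γ] [Ctx Δ] [Ctx Θ]

theorem cp_nat {f : Γ → ℕ} : Cp f ↔ CpN f :=
  ⟨fun h => h.2 0 Nat.zero_lt_one, fun h => ⟨fun _ _ _ => trivial, fun _ _ => h⟩⟩

open Classical in
theorem cp_prop {f : Γ → Prop} : Cp f ↔ CpN fun γ => if f γ then 1 else 0 :=
  ⟨fun h => h.2 0 Nat.zero_lt_one, fun h => ⟨fun _ _ _ => trivial, fun _ _ => h⟩⟩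

theorem poly_add_le (b C₁ C₂ k₁ k₂ c : ℕ) :
    C₁ * (b + 1) ^ k₁ + C₂ * (b + 1) ^ k₂ + c ≤ (C₁ + C₂ + c) * (b + 1) ^ (k₁ + k₂) := by
  have h₁ : (b + 1) ^ k₁ ≤ (b + 1) ^ (k₁ + k₂) := Nat.pow_le_pow_right (by omega) (by omega)
  have h₂ : (b + 1) ^ k₂ ≤ (b + 1) ^ (k₁ + k₂) := Nat.pow_le_pow_right (by omega) (by omega)
  have h₃ : 1 ≤ (b + 1) ^ (k₁ + k₂) := Nat.one_le_pow _ _ (by omega)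
  have := Nat.mul_le_mul_left C₁ h₁
  have := Nat.mul_le_mul_left C₂ h₂
  have := Nat.mul_le_mul_left c h₃
  rw [add_mul, add_mul]
  omega

theorem CpN.const (c : ℕ) : CpN fun _ : Γ => c := by
  refine ⟨1, 0, fun loc out _ => ⟨.const out c, fun γ s _ _ => ?_⟩⟩
  refine ⟨_, Runs.const _ _ _, rfl, State.setReg_reg_self _ _ _, fun x hx => ?_⟩
  exact State.setReg_reg_of_ne _ _ hx.ne

theorem CpN.val {i : ℕ} (hi : i < Ctx.dim Γ) : CpN fun γ : Γ => Ctx.val γ i := by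
  refine ⟨1, 0, fun loc out _ => ⟨.copy out (loc i), fun γ s _ h => ?_⟩⟩
  refine ⟨_, Runs.copy _ _ _, rfl, ?_, fun x hx => State.setReg_reg_of_ne _ _ hx.ne⟩
  rw [State.setReg_reg_self, h i hi]

theorem CpN.binop {F G : Γ → ℕ} (op : ℕ → ℕ → ℕ) (ins : ℕ → ℕ → ℕ → Prog)
    (hop : ∀ x y z s, Runs (ins x y z) s 1 (s.setReg x (op (s.reg y) (s.reg z))))
    (hF : CpN F) (hG : CpN G) : CpN fun γ => op (F γ) (G γ) := by
  obtain ⟨C₁, k₁, hF⟩ := hF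
  obtain ⟨C₂, k₂, hG⟩ := hG
  refine ⟨C₁ + C₂ + 1, k₁ + k₂, fun loc out hloc => ?_⟩
  obtain ⟨p, hp⟩ := hF loc out hloc
  obtain ⟨q, hq⟩ := hG loc (out + 1) fun i hi => (hloc i hi).trans (Nat.lt_succ_self _)
  refine ⟨.seq (.seq p q) (ins out out (out + 1)), fun γ s hr hs => ?_⟩
  obtain ⟨s₁, r₁, a₁, v₁, u₁⟩ := hp γ s hr hs
  obtain ⟨s₂, r₂, a₂, v₂, u₂⟩ := hq γ s₁ (by rwa [a₁]) fun i hi => by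
    rw [u₁ _ (hloc i hi), hs i hi]
  refine ⟨_, ((r₁.seq r₂).seq (hop _ _ _ _)).mono ?_, by simp [a₂, a₁], ?_, fun x hx => ?_⟩
  · rw [a₁]; exact poly_add_le _ _ _ _ _ _
  · rw [State.setReg_reg_self, u₂ out (Nat.lt_succ_self _), v₁, v₂]
  · rw [State.setReg_reg_of_ne _ _ hx.ne, u₂ x (hx.trans (Nat.lt_succ_self _)), u₁ x hx]

theorem CpN.add {F G : Γ → ℕ} (hF : CpN F) (hG : CpN G) : CpN fun γ => F γ + G γ :=
  CpN.binop (· + ·) .plus (fun _ _ _ _ => Runs.plus _ _ _ _) hF hG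

theorem CpN.sub {F G : Γ → ℕ} (hF : CpN F) (hG : CpN G) : CpN fun γ => F γ - G γ :=
  CpN.binop (· - ·) .monus (fun _ _ _ _ => Runs.monus _ _ _ _) hF hG

theorem CpN.ite {F G H : Γ → ℕ} (hF : CpN F) (hG : CpN G) (hH : CpN H) :
    CpN fun γ => if F γ = 0 then H γ else G γ := by
  obtain ⟨C₁, k₁, hF⟩ := hF
  obtain ⟨C₂, k₂, hG⟩ := hG
  obtain ⟨C₃, k₃, hH⟩ := hH
  refine ⟨C₁ + (C₂ + C₃ + 1) + 0, k₁ + (k₂ + k₃), fun loc out hloc => ?_⟩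
  obtain ⟨p, hp⟩ := hF loc out hloc
  obtain ⟨q, hq⟩ := hG loc out hloc
  obtain ⟨r, hr⟩ := hH loc out hloc
  refine ⟨.seq p (.ite out q r), fun γ s hrep hs => ?_⟩
  obtain ⟨s₁, r₁, a₁, v₁, u₁⟩ := hp γ s hrep hs
  have hs₁ : ∀ i < Ctx.dim Γ, s₁.reg (loc i) = Ctx.val γ i := fun i hi => by
    rw [u₁ _ (hloc i hi), hs i hi]
  have hb := poly_add_le (s.arr 1 0) C₁ (C₂ + C₃ + 1) k₁ (k₂ + k₃) 0
  have hb' := poly_add_le (s.arr 1 0) C₂ C₃ k₂ k₃ 1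
  by_cases h0 : F γ = 0
  · obtain ⟨s₂, ⟨t₂, ht₂, e₂⟩, a₂, v₂, u₂⟩ := hr γ s₁ (by rwa [a₁]) hs₁
    have : Runs (.ite out q r) s₁ (1 + t₂) s₂ := ⟨_, le_rfl, .ite_false (v₁.trans h0) e₂⟩
    refine ⟨s₂, (r₁.seq this).mono ?_, a₂.trans a₁, by simp [h0, v₂],
      fun x hx => (u₂ x hx).trans (u₁ x hx)⟩
    rw [a₁] at ht₂
    omega
  · obtain ⟨s₂, ⟨t₂, ht₂, e₂⟩, a₂, v₂, u₂⟩ := hq γ s₁ (by rwa [a₁]) hs₁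
    have : Runs (.ite out q r) s₁ (1 + t₂) s₂ :=
      ⟨_, le_rfl, .ite_true (by rwa [v₁]) e₂⟩
    refine ⟨s₂, (r₁.seq this).mono ?_, a₂.trans a₁, by simp [h0, v₂],
      fun x hx => (u₂ x hx).trans (u₁ x hx)⟩
    rw [a₁] at ht₂
    omega

theorem CpN.load (a : ℕ) {A : Γ → Mem} {F : Γ → ℕ} (hA : Cp A) (hF : CpN F) :
    CpN fun γ => (A γ).cell a (F γ) := by
  obtain ⟨C₁, k₁, hF⟩ := hF
  refine ⟨C₁ + 0 + 1, k₁ + 0, fun loc out hloc => ?_⟩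
  obtain ⟨p, hp⟩ := hF loc out hloc
  refine ⟨.seq p (.load out a out), fun γ s hr hs => ?_⟩
  obtain ⟨s₁, r₁, a₁, v₁, u₁⟩ := hp γ s hr hs
  refine ⟨_, (r₁.seq (Runs.load _ _ _ _)).mono ?_, by simp [a₁], ?_, fun x hx => ?_⟩
  · have := poly_add_le (s.arr 1 0) C₁ 0 k₁ 0 1
    omega
  · rw [State.setReg_reg_self, v₁, a₁]
    have : (A γ).cell = s.arr := hA.1 γ _ hr
    simp only [this]
  · rw [State.setReg_reg_of_ne _ _ hx.ne, u₁ x hx]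

/-- The initialization of a loop over all `i < bd`: the index is in register `i`, the number of
remaining rounds in `r`, the number `1` in `o`, and `z` is set to `0`. -/
def loopInit (z i r o : ℕ) : Prog :=
  .seq (.seq (.seq (.seq (.const o 0) (.load r 1 o)) (.const z 0)) (.const i 0)) (.const o 1)

theorem runs_loopInit {z i r o : ℕ} (hi : i = z + 1) (hr : r = z + 2) (ho : o = z + 3)
    (s : State) : ∃ s', Runs (loopInit z i r o) s 5 s' ∧ s'.arr = s.arr ∧ s'.reg z = 0 ∧
      s'.reg i = 0 ∧ s'.reg r = s.arr 1 0 ∧ s'.reg o = 1 ∧ ∀ x < z, s'.reg x = s.reg x := by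
  subst hi hr ho
  refine ⟨_, ((((Runs.const _ _ _).seq (Runs.load _ _ _ _)).seq (Runs.const _ _ _)).seq
    (Runs.const _ _ _)).seq (Runs.const _ _ _), rfl, by simp, by simp, by simp, by simp, ?_⟩
  intro x hx
  have h₁ : x ≠ z := by omega
  have h₂ : x ≠ z + 1 := by omega
  have h₃ : x ≠ z + 2 := by omega
  have h₄ : x ≠ z + 3 := by omega
  simp [h₁, h₂, h₃, h₄]

theorem poly_loop_le (b C k c : ℕ) :
    b * (C * (b + 1) ^ k + c) + c ≤ (C + c) * (b + 1) ^ (k + 1) := by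
  have h₁ : 1 ≤ (b + 1) ^ k := Nat.one_le_pow _ _ (by omega)
  have h₂ : c ≤ c * (b + 1) ^ k := Nat.le_mul_of_pos_right _ h₁
  calc b * (C * (b + 1) ^ k + c) + c ≤ b * (C * (b + 1) ^ k + c * (b + 1) ^ k)
        + (C * (b + 1) ^ k + c * (b + 1) ^ k) :=
        add_le_add (Nat.mul_le_mul_left _ (by omega)) (by omega)
    _ = (C + c) * (b + 1) ^ (k + 1) := by ring

/-- This is the only source of iteration in computed expressions. Each nesting of a sum multiplies
the time by about the bound, so the exponent grows by one. -/
theorem CpN.sum {A : Γ → Mem} {F : Γ → ℕ → ℕ} (hA : Cp A)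
    (hF : CpN fun p : Γ × ℕ => F p.1 p.2) :
    CpN fun γ => ∑ i ∈ Finset.range (A γ).bd, F γ i := by
  obtain ⟨C, k, hF⟩ := hF
  refine ⟨C + 6, k + 1, fun loc out hloc => ?_⟩
  -- The body has one more input, the index, which is held in register `out + 1`. Its output goes
  -- above the four registers `out, ..., out + 3` of the loop, which it therefore preserves.
  obtain ⟨p, hp⟩ := hF (fun i => if i < Ctx.dim Γ then loc i else out + 1) (out + 4) (by
    intro i hi
    split_ifs with h
    · exact (hloc i h).trans (by omega)
    · omega)
  refine ⟨.seq (loopInit out (out + 1) (out + 2) (out + 3)) (.loop (out + 2)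
    (.seq (.seq (.seq p (.plus out out (out + 4))) (.plus (out + 1) (out + 1) (out + 3)))
      (.monus (out + 2) (out + 2) (out + 3)))), fun γ s hr hs => ?_⟩
  obtain ⟨s₁, r₁, a₁, z₁, i₁, n₁, o₁, u₁⟩ := runs_loopInit (z := out) rfl rfl rfl s
  have hbd : (A γ).bd = s.arr 1 0 := by
    have : (A γ).cell = s.arr := hA.1 γ _ hr
    rw [Mem.bd, this]
  let Inv : ℕ → State → Prop := fun j σ => σ.arr = s.arr ∧
    σ.reg out = ∑ i ∈ Finset.range j, F γ i ∧ σ.reg (out + 1) = j ∧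
    σ.reg (out + 2) = s.arr 1 0 - j ∧ σ.reg (out + 3) = 1 ∧ ∀ x < out, σ.reg x = s.reg x
  obtain ⟨s₂, r₂, a₂, v₂, -, -, -, u₂⟩ := Runs.countdown (n := s.arr 1 0)
    (x := out + 2) (T := C * (s.arr 1 0 + 1) ^ k + 1 + 1 + 1) Inv (fun j σ h => h.2.2.2.1)
    (p := .seq (.seq (.seq p (.plus out out (out + 4))) (.plus (out + 1) (out + 1) (out + 3)))
      (.monus (out + 2) (out + 2) (out + 3)))
    (by
      rintro j σ hj ⟨ha, hv, hi, hn, ho, hu⟩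
      obtain ⟨σ', r', a', v', u'⟩ := hp (γ, j) σ ⟨by rwa [ha], trivial⟩ (by
        intro i hi'
        dsimp only [Ctx.val]
        split_ifs with h
        · rw [hu _ (hloc i h), hs i h]
        · exact hi)
      refine ⟨_, (((ha ▸ r').seq (Runs.plus _ _ _ _)).seq (Runs.plus _ _ _ _)).seq
        (Runs.monus _ _ _ _), ?_⟩
      refine ⟨by simp [a', ha], ?_, ?_, ?_, ?_, fun x hx => ?_⟩
      · simp only [State.setReg_reg]
        simp [Finset.sum_range_succ, v', u' out (by omega), hv]
      · simp [u' (out + 1) (by omega), u' (out + 3) (by omega), hi, ho]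
      · simp [u' (out + 2) (by omega), u' (out + 3) (by omega), hn, ho]
        omega
      · simp [u' (out + 3) (by omega), ho]
      · have h₁ : x ≠ out := by omega
        have h₂ : x ≠ out + 1 := by omega
        have h₃ : x ≠ out + 2 := by omega
        simp [h₁, h₂, h₃, u' x (by omega), hu x hx])
    (s := s₁) ⟨a₁, by simp [z₁], i₁, by simp [n₁], o₁, u₁⟩
  refine ⟨s₂, (r₁.seq r₂).mono ?_, a₂, by simp only [v₂, hbd], u₂⟩
  have := poly_loop_le (s.arr 1 0) C k 6
  nlinarith

/-- The components of `σ γ` are computed one after another into the registers from `out` on, and the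
program for `F` is instantiated with these locations. This is why `CpN` allows arbitrary input
locations and protects everything below the output. -/
theorem CpN.comp {F : Δ → ℕ} {σ : Γ → Δ} (hF : CpN F) (hσ : Cp σ) : CpN fun γ => F (σ γ) := by
  obtain ⟨hrep, hval⟩ := hσ
  have key : ∀ j ≤ Ctx.dim Δ, ∃ C k : ℕ, ∀ (loc : ℕ → ℕ) (out : ℕ),
      (∀ i < Ctx.dim Γ, loc i < out) → ∃ p : Prog, ∀ (γ : Γ) (s : State), Ctx.Rep γ s.arr →
      (∀ i < Ctx.dim Γ, s.reg (loc i) = Ctx.val γ i) →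
      ∃ s', Runs p s (C * (s.arr 1 0 + 1) ^ k) s' ∧ s'.arr = s.arr ∧
        (∀ i < j, s'.reg (out + i) = Ctx.val (σ γ) i) ∧ ∀ x < out, s'.reg x = s.reg x := by
    intro j
    induction j with
    | zero =>
      intro _
      refine ⟨1, 0, fun loc out _ => ⟨.skip, fun γ s _ _ => ?_⟩⟩
      exact ⟨s, ⟨1, by simp, .skip s⟩, rfl, fun i hi => absurd hi (by omega), fun _ _ => rfl⟩
    | succ j ih =>
      intro hj
      obtain ⟨C₁, k₁, h₁⟩ := ih (by omega)
      obtain ⟨C₂, k₂, h₂⟩ := hval j (by omega)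
      refine ⟨C₁ + C₂ + 0, k₁ + k₂, fun loc out hloc => ?_⟩
      obtain ⟨p, hp⟩ := h₁ loc out hloc
      obtain ⟨q, hq⟩ := h₂ loc (out + j) fun i hi => (hloc i hi).trans_le (by omega)
      refine ⟨.seq p q, fun γ s hr hs => ?_⟩
      obtain ⟨s₁, r₁, a₁, v₁, u₁⟩ := hp γ s hr hs
      obtain ⟨s₂, r₂, a₂, v₂, u₂⟩ := hq γ s₁ (by rwa [a₁]) fun i hi => by
        rw [u₁ _ (hloc i hi), hs i hi]
      refine ⟨s₂, (r₁.seq r₂).mono ?_, a₂.trans a₁, fun i hi => ?_, fun x hx => ?_⟩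
      · rw [a₁]; exact poly_add_le _ _ _ _ _ 0
      · rcases Nat.lt_succ_iff_lt_or_eq.1 hi with h | rfl
        · rw [u₂ _ (by omega), v₁ i h]
        · exact v₂
      · rw [u₂ x (by omega), u₁ x hx]
  obtain ⟨C₁, k₁, h₁⟩ := key _ le_rfl
  obtain ⟨C₂, k₂, h₂⟩ := hF
  refine ⟨C₁ + C₂ + 1, k₁ + k₂, fun loc out hloc => ?_⟩
  obtain ⟨p, hp⟩ := h₁ loc out hloc
  obtain ⟨q, hq⟩ := h₂ (fun i => out + i) (out + Ctx.dim Δ) fun i hi => by omega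
  refine ⟨.seq (.seq p q) (.copy out (out + Ctx.dim Δ)), fun γ s hr hs => ?_⟩
  obtain ⟨s₁, r₁, a₁, v₁, u₁⟩ := hp γ s hr hs
  obtain ⟨s₂, r₂, a₂, v₂, u₂⟩ := hq (σ γ) s₁ (by rw [a₁]; exact hrep _ _ hr) v₁
  refine ⟨_, ((r₁.seq r₂).seq (Runs.copy _ _ _)).mono ?_, by simp [a₂, a₁], ?_, fun x hx => ?_⟩
  · rw [a₁]; exact poly_add_le _ _ _ _ _ _
  · rw [State.setReg_reg_self, v₂]
  · rw [State.setReg_reg_of_ne _ _ hx.ne, u₂ x (by omega), u₁ x hx]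

/-! ### Closure properties -/

@[fun_prop]
theorem Cp.id : Cp fun x : Γ => x := ⟨fun _ _ h => h, fun _ hi => CpN.val hi⟩

@[fun_prop]
theorem Cp.const (c : ℕ) : Cp fun _ : Γ => c := cp_nat.2 (CpN.const c)

@[fun_prop]
theorem Cp.comp {f : Δ → Θ} {σ : Γ → Δ} (hf : Cp f) (hσ : Cp σ) : Cp fun x => f (σ x) :=
  ⟨fun _ _ h => hf.1 _ _ (hσ.1 _ _ h), fun i hi => CpN.comp (hf.2 i hi) hσ⟩

@[fun_prop]
theorem Cp.fst {f : Γ → Δ × Θ} (hf : Cp f) : Cp fun x => (f x).1 := by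
  refine ⟨fun γ a h => (hf.1 _ _ h).1, fun i hi => ?_⟩
  have := hf.2 i (Nat.lt_add_right _ hi)
  dsimp only [Ctx.val] at this
  simpa only [hi, if_true] using this

@[fun_prop]
theorem Cp.snd {f : Γ → Δ × Θ} (hf : Cp f) : Cp fun x => (f x).2 := by
  refine ⟨fun γ a h => (hf.1 _ _ h).2, fun i hi => ?_⟩
  have := hf.2 (Ctx.dim Δ + i) (Nat.add_lt_add_left hi _)
  dsimp only [Ctx.val] at this
  simpa using this

@[fun_prop]
theorem Cp.add {f g : Γ → ℕ} (hf : Cp f) (hg : Cp g) : Cp fun x => f x + g x :=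
  cp_nat.2 ((cp_nat.1 hf).add (cp_nat.1 hg))

@[fun_prop]
theorem Cp.sub {f g : Γ → ℕ} (hf : Cp f) (hg : Cp g) : Cp fun x => f x - g x :=
  cp_nat.2 ((cp_nat.1 hf).sub (cp_nat.1 hg))

@[fun_prop]
theorem Cp.cell (a : ℕ) {A : Γ → Mem} {f : Γ → ℕ} (hA : Cp A) (hf : Cp f) :
    Cp fun x => (A x).cell a (f x) :=
  cp_nat.2 (CpN.load a hA (cp_nat.1 hf))

@[fun_prop]
theorem Cp.bd {A : Γ → Mem} (hA : Cp A) : Cp fun x => (A x).bd :=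
  hA.cell 1 (Cp.const 0)

-- The Boolean connectives and comparisons are obtained from this: write a number by addition and
-- truncated subtraction that vanishes exactly when the property fails.
open Classical in
theorem Cp.of_iff_zero {P : Γ → Prop} {F : Γ → ℕ} (hF : Cp F) (h : ∀ γ, F γ = 0 ↔ ¬ P γ) :
    Cp P := by
  refine cp_prop.2 ?_
  have := CpN.ite (cp_nat.1 hF) (CpN.const 1) (CpN.const 0)
  convert this using 2 with γ
  by_cases hP : P γ
  · rw [if_pos hP, if_neg (by rw [h]; exact not_not.2 hP)]
  · rw [if_neg hP, if_pos ((h γ).2 hP)]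

@[fun_prop]
theorem Cp.lt {f g : Γ → ℕ} (hf : Cp f) (hg : Cp g) : Cp fun x => f x < g x :=
  (hg.sub hf).of_iff_zero fun γ => by omega

open Classical in
theorem Cp.indicator {P : Γ → Prop} (hP : Cp P) : Cp fun x => if P x then 1 else 0 :=
  cp_nat.2 (cp_prop.1 hP)

open Classical in
@[fun_prop]
theorem Cp.not {P : Γ → Prop} (hP : Cp P) : Cp fun x => ¬ P x :=
  ((Cp.const 1).sub hP.indicator).of_iff_zero fun γ => by by_cases h : P γ <;> simp [h]

open Classical in
@[fun_prop]
theorem Cp.or {P Q : Γ → Prop} (hP : Cp P) (hQ : Cp Q) : Cp fun x => P x ∨ Q x :=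
  (hP.indicator.add hQ.indicator).of_iff_zero fun γ => by
    by_cases h : P γ <;> by_cases h' : Q γ <;> simp [h, h']

theorem Cp.congr {f g : Γ → Δ} (hf : Cp f) (h : ∀ γ, g γ = f γ) : Cp g := by
  rwa [show g = f from funext h]

theorem Cp.congr_iff {P Q : Γ → Prop} (hP : Cp P) (h : ∀ γ, Q γ ↔ P γ) : Cp Q :=
  hP.congr fun γ => propext (h γ)

@[fun_prop]
theorem Cp.and {P Q : Γ → Prop} (hP : Cp P) (hQ : Cp Q) : Cp fun x => P x ∧ Q x :=
  (hP.not.or hQ.not).not.congr_iff fun γ => by tauto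

theorem Cp.imp {P Q : Γ → Prop} (hP : Cp P) (hQ : Cp Q) : Cp fun x => P x → Q x :=
  (hP.not.or hQ).congr_iff fun γ => by tauto

@[fun_prop]
theorem Cp.iff {P Q : Γ → Prop} (hP : Cp P) (hQ : Cp Q) : Cp fun x => P x ↔ Q x :=
  ((hP.imp hQ).and (hQ.imp hP)).congr_iff fun γ => by tauto

@[fun_prop]
theorem Cp.le {f g : Γ → ℕ} (hf : Cp f) (hg : Cp g) : Cp fun x => f x ≤ g x :=
  (hg.lt hf).not.congr_iff fun γ => by simp

@[fun_prop]
theorem Cp.eq {f g : Γ → ℕ} (hf : Cp f) (hg : Cp g) : Cp fun x => f x = g x :=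
  ((hf.le hg).and (hg.le hf)).congr_iff fun γ => by omega

@[fun_prop]
theorem Cp.ite {P : Γ → Prop} [∀ x, Decidable (P x)] {f g : Γ → ℕ} (hP : Cp P) (hf : Cp f)
    (hg : Cp g) :
    Cp fun x => if P x then f x else g x := by
  refine cp_nat.2 ?_
  have := CpN.ite (cp_prop.1 hP) (cp_nat.1 hf) (cp_nat.1 hg)
  convert this using 2 with γ
  by_cases h : P γ <;> simp [h]

theorem Cp.sum {A : Γ → Mem} {f : Γ → ℕ → ℕ} (hA : Cp A) (hf : Cp fun p : Γ × ℕ => f p.1 p.2) :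
    Cp fun x => ∑ i ∈ Finset.range (A x).bd, f x i :=
  cp_nat.2 (CpN.sum hA (cp_nat.1 hf))

/-- All numbers below `N` have the property `P`. -/
def Ball (N : ℕ) (P : ℕ → Prop) : Prop := ∀ i < N, P i

/-- Some number below `N` has the property `P`. -/
def Bex (N : ℕ) (P : ℕ → Prop) : Prop := ∃ i < N, P i

open Classical in
/-- The number of `i < N` with the property `P`. -/
noncomputable def cnt (N : ℕ) (P : ℕ → Prop) : ℕ := ((Finset.range N).filter P).card

-- Counting is summing an indicator; the bounded quantifiers below are in turn tests of a count
-- against zero.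
open Classical in
@[fun_prop]
theorem Cp.cnt {A : Γ → Mem} {P : Γ → ℕ → Prop} (hA : Cp A)
    (hP : Cp fun p : Γ × ℕ => P p.1 p.2) : Cp fun x => cnt (A x).bd (P x) :=
  (Cp.sum (f := fun x i => if P x i then 1 else 0) hA hP.indicator).congr fun γ => by
    rw [RAM.cnt, Finset.card_filter]

@[fun_prop]
theorem Cp.bex {A : Γ → Mem} {P : Γ → ℕ → Prop} (hA : Cp A)
    (hP : Cp fun p : Γ × ℕ => P p.1 p.2) : Cp fun x => Bex (A x).bd (P x) :=
  (Cp.cnt hA hP).of_iff_zero fun γ => by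
    simp [RAM.cnt, Bex, Finset.filter_eq_empty_iff]

@[fun_prop]
theorem Cp.ball {A : Γ → Mem} {P : Γ → ℕ → Prop} (hA : Cp A)
    (hP : Cp fun p : Γ × ℕ => P p.1 p.2) : Cp fun x => Ball (A x).bd (P x) :=
  (Cp.bex (P := fun x i => ¬ P x i) hA hP.not).not.congr_iff fun γ => by simp [Bex, Ball]

end closure

end RAM

namespace RAM

/-! ### Transformations of the memory -/

/-- The memory `A` with the value `v` written to the cell `i` of the array `a`. -/
def Mem.set (A : Mem) (a i v : ℕ) : Mem :=
  ⟨Function.update A.cell a (Function.update (A.cell a) i v)⟩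

theorem Mem.set_cell (A : Mem) (a i v b j : ℕ) :
    (A.set a i v).cell b j = if b = a ∧ j = i then v else A.cell b j := by
  by_cases h : b = a
  · subst h
    simp [Mem.set, Function.update_apply]
  · simp [Mem.set, h]

/-- A transformation of the memory that does not lower the loop bound and is carried out by a
program in time polynomial in the final bound. -/
def Tr (T : Mem → Mem) : Prop :=
  (∀ A, A.bd ≤ (T A).bd) ∧ ∃ (C k : ℕ) (p : Prog), ∀ s : State, ∃ s',
    Runs p s (C * ((T ⟨s.arr⟩).bd + 1) ^ k) s' ∧ s'.arr = (T ⟨s.arr⟩).cell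

/-- Costs are measured in the bound after the transformation. As `U` does not lower the bound, the
cost of `T` is also polynomial in the final one. -/
theorem Tr.comp {T U : Mem → Mem} (hU : Tr U) (hT : Tr T) : Tr fun A => U (T A) := by
  obtain ⟨bT, C₁, k₁, p, hp⟩ := hT
  obtain ⟨bU, C₂, k₂, q, hq⟩ := hU
  refine ⟨fun A => (bT A).trans (bU _), C₁ + C₂ + 0, k₁ + k₂, .seq p q, fun s => ?_⟩
  obtain ⟨s₁, r₁, a₁⟩ := hp s
  obtain ⟨s₂, r₂, a₂⟩ := hq s₁
  have e : (⟨s₁.arr⟩ : Mem) = T ⟨s.arr⟩ := by rw [a₁]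
  rw [e] at r₂ a₂
  refine ⟨s₂, (r₁.seq r₂).mono ?_, a₂⟩
  refine le_trans ?_ (poly_add_le _ _ _ _ _ 0)
  have := Nat.pow_le_pow_left (Nat.add_le_add_right (bU (T ⟨s.arr⟩)) 1) k₁
  have := Nat.mul_le_mul_left C₁ this
  dsimp only
  omega

theorem Tr.assign (a i : ℕ) {F : Mem → ℕ} (hF : Cp F)
    (hb : ∀ A : Mem, A.bd ≤ (A.set a i (F A)).bd) : Tr fun A => A.set a i (F A) := by
  obtain ⟨C, k, h⟩ := cp_nat.1 hF
  obtain ⟨p, hp⟩ := h (fun _ => 0) 0 fun i hi => absurd hi (Nat.not_lt_zero i)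
  refine ⟨hb, C + 0 + 2, k + 0, .seq p (.seq (.const 1 i) (.store a 1 0)), fun s => ?_⟩
  obtain ⟨s₁, r₁, a₁, v₁, -⟩ := hp ⟨s.arr⟩ s rfl fun i hi => absurd hi (Nat.not_lt_zero i)
  refine ⟨_, (r₁.seq ((Runs.const _ _ _).seq (Runs.store _ _ _ _))).mono ?_, ?_⟩
  · have h₁ := poly_add_le (Mem.bd ((Mem.mk s.arr).set a i (F ⟨s.arr⟩))) C 0 k 0 2
    have h₂ := Nat.mul_le_mul_left C (Nat.pow_le_pow_left (Nat.add_le_add_right (hb ⟨s.arr⟩) 1) k)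
    have h₃ : (Mem.mk s.arr).bd = s.arr 1 0 := rfl
    rw [h₃] at h₂
    dsimp only
    omega
  · simp [State.setArr, Mem.set, v₁, a₁]

/-- Write `F (A, i)` to the cell `i` of the array `a`, for `i = 0, ..., n - 1` in this order,
where `A` is the current memory. -/
def fillTo (a : ℕ) (F : Mem × ℕ → ℕ) (A : Mem) : ℕ → Mem
  | 0 => A
  | i + 1 => (fillTo a F A i).set a i (F (fillTo a F A i, i))

/-- Fill the array `a` up to the loop bound. -/
def fill (a : ℕ) (F : Mem × ℕ → ℕ) (A : Mem) : Mem := fillTo a F A A.bd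

theorem fillTo_cell_of_ne {a b : ℕ} (h : b ≠ a) (F : Mem × ℕ → ℕ) (A : Mem) (n j : ℕ) :
    (fillTo a F A n).cell b j = A.cell b j := by
  induction n with
  | zero => rfl
  | succ n ih => rw [fillTo, Mem.set_cell, if_neg (fun h' => h h'.1), ih]

theorem fillTo_cell_of_le (a : ℕ) (F : Mem × ℕ → ℕ) (A : Mem) {n j : ℕ} (h : n ≤ j) :
    (fillTo a F A n).cell a j = A.cell a j := by
  induction n with
  | zero => rfl
  | succ n ih => rw [fillTo, Mem.set_cell, if_neg (fun h' => by omega), ih (by omega)]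

theorem fillTo_cell_stable (a : ℕ) (F : Mem × ℕ → ℕ) (A : Mem) {n m j : ℕ} (hj : j < n)
    (h : n ≤ m) : (fillTo a F A m).cell a j = (fillTo a F A n).cell a j := by
  induction m, h using Nat.le_induction with
  | base => rfl
  | succ m h ih => rw [fillTo, Mem.set_cell, if_neg (fun h' => by omega), ih]

/-- Cell `j` is written only in round `j`, from a memory whose cells below `j` are already final.
This makes `fill` a course-of-values recursion, as needed for the greedy matching and the powers. -/
theorem fillTo_cell (a : ℕ) (F : Mem × ℕ → ℕ) (A : Mem) {n j : ℕ} (hj : j < n) :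
    (fillTo a F A n).cell a j = F (fillTo a F A j, j) := by
  rw [fillTo_cell_stable a F A (Nat.lt_succ_self j) hj, fillTo, Mem.set_cell, if_pos ⟨rfl, rfl⟩]

theorem fillTo_bd {a : ℕ} (ha : a ≠ 1) (F : Mem × ℕ → ℕ) (A : Mem) (n : ℕ) :
    (fillTo a F A n).bd = A.bd :=
  fillTo_cell_of_ne (fun h => ha h.symm) F A n 0

/-- Array `1` is excluded so that the loop bound stays constant during the loop. -/
theorem Tr.fill {a : ℕ} (ha : a ≠ 1) {F : Mem × ℕ → ℕ} (hF : Cp F) : Tr (fill a F) := by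
  obtain ⟨C, k, h⟩ := cp_nat.1 hF
  -- The context has a single register, the loop index in register `1`; register `4` is the first
  -- one not used by the loop.
  obtain ⟨p, hp⟩ := h (fun _ => 1) 4 fun i _ => by omega
  refine ⟨fun A => (fillTo_bd ha F A _).ge, C + 6, k + 1, .seq (loopInit 0 1 2 3) (.loop 2
    (.seq (.seq (.seq p (.store a 1 4)) (.plus 1 1 3)) (.monus 2 2 3))), fun s => ?_⟩
  obtain ⟨s₁, r₁, a₁, -, i₁, n₁, o₁, -⟩ := runs_loopInit (z := 0) rfl rfl rfl s
  let Inv : ℕ → State → Prop := fun j σ => σ.arr = (fillTo a F ⟨s.arr⟩ j).cell ∧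
    σ.reg 1 = j ∧ σ.reg 2 = s.arr 1 0 - j ∧ σ.reg 3 = 1
  obtain ⟨s₂, r₂, a₂, -, -, -⟩ := Runs.countdown (n := s.arr 1 0)
    (x := 2) (T := C * (s.arr 1 0 + 1) ^ k + 1 + 1 + 1) Inv (fun j σ h => h.2.2.1)
    (p := .seq (.seq (.seq p (.store a 1 4)) (.plus 1 1 3)) (.monus 2 2 3))
    (by
      rintro j σ hj ⟨hm, hi, hn, ho⟩
      obtain ⟨σ', r', a', v', u'⟩ := hp (fillTo a F ⟨s.arr⟩ j, j) σ ⟨hm.symm, trivial⟩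
        (fun i _ => by simpa [Ctx.val, Ctx.dim] using hi)
      have hb : σ.arr 1 0 = s.arr 1 0 := by
        rw [hm]
        exact fillTo_bd ha F _ j
      rw [hb] at r'
      refine ⟨_, ((r'.seq (Runs.store _ _ _ _)).seq (Runs.plus _ _ _ _)).seq
        (Runs.monus _ _ _ _), ?_, ?_, ?_, ?_⟩
      · simp [State.setArr, a', hm, fillTo, Mem.set, v', u' 1, hi]
      · simp [u' 1, u' 3, hi, ho]
      · simp [u' 2, u' 3, hn, ho]
        omega
      · simp [u' 3, ho])
    (s := s₁) ⟨a₁, i₁, by simp [n₁], o₁⟩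
  refine ⟨s₂, (r₁.seq r₂).mono ?_, a₂⟩
  have h₁ := poly_loop_le (s.arr 1 0) C k 6
  have h₂ : (RAM.fill a F ⟨s.arr⟩).bd = s.arr 1 0 := fillTo_bd ha F _ _
  rw [h₂]
  nlinarith

/-- A property that is decided after a transformation of the memory is decided by a program. -/
theorem Tr.decide {T : Mem → Mem} {P : Mem → Prop} (hT : Tr T) (hP : Cp P) :
    ∃ (C k : ℕ) (p : Prog), ∀ s : State, ∃ s',
      Runs p s (C * ((T ⟨s.arr⟩).bd + 1) ^ k) s' ∧ (P (T ⟨s.arr⟩) → s'.reg 0 = 1) ∧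
        (¬ P (T ⟨s.arr⟩) → s'.reg 0 = 0) := by
  obtain ⟨-, C₁, k₁, q, hq⟩ := hT
  obtain ⟨C, k, h⟩ := cp_prop.1 hP
  obtain ⟨p, hp⟩ := h (fun _ => 0) 0 fun i hi => absurd hi (Nat.not_lt_zero i)
  refine ⟨C₁ + C + 0, k₁ + k, .seq q p, fun s => ?_⟩
  obtain ⟨s₁, r₁, a₁⟩ := hq s
  obtain ⟨s₂, r₂, -, v₂, -⟩ := hp (T ⟨s.arr⟩) s₁ a₁.symm
    fun i hi => absurd hi (Nat.not_lt_zero i)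
  rw [a₁] at r₂
  exact ⟨s₂, (r₁.seq r₂).mono (poly_add_le _ _ _ _ _ 0), fun h => by simp [v₂, h],
    fun h => by simp [v₂, h]⟩

end RAM

open RAM Finset

/-! ### Positions in a finite linear order -/

section position

variable {α β : Type*} [LinearOrder β]

open Classical in
/-- The number of elements of `X` with a smaller key. -/
noncomputable def keyPos (X : Finset α) (key : α → β) (x : α) : ℕ :=
  #{w ∈ X | key w < key x}

theorem keyPos_lt_keyPos {X : Finset α} {key : α → β} {x y : α} (hx : x ∈ X)
    (h : key x < key y) : keyPos X key x < keyPos X key y := by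
  classical
  refine card_lt_card ⟨fun w hw => ?_, fun hsub => ?_⟩
  · simp only [mem_filter] at hw ⊢
    exact ⟨hw.1, hw.2.trans h⟩
  · have := hsub (mem_filter.2 ⟨hx, h⟩)
    simp at this

theorem keyPos_injOn {X : Finset α} {key : α → β} (hk : Set.InjOn key X) :
    Set.InjOn (keyPos X key) X := by
  intro x hx y hy h
  rcases lt_trichotomy (key x) (key y) with h' | h' | h'
  · exact absurd h (keyPos_lt_keyPos hx h').ne
  · exact hk hx hy h'
  · exact absurd h (keyPos_lt_keyPos hy h').ne'

theorem keyPos_lt_card {X : Finset α} {key : α → β} {x : α} (hx : x ∈ X) :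
    keyPos X key x < #X := by
  classical
  refine card_lt_card ⟨filter_subset _ _, fun hsub => ?_⟩
  have := hsub hx
  simp at this

/-- The positions are distinct and below `#X`, so by counting they exhaust the range. -/
theorem exists_keyPos_eq {X : Finset α} {key : α → β} (hk : Set.InjOn key X) {t : ℕ}
    (ht : t < #X) : ∃ x ∈ X, keyPos X key x = t := by
  classical
  have h : X.image (keyPos X key) = range #X := by
    refine eq_of_subset_of_card_le (fun i hi => ?_) ?_
    · obtain ⟨x, hx, rfl⟩ := mem_image.1 hi
      exact mem_range.2 (keyPos_lt_card hx)
    · rw [card_image_of_injOn (keyPos_injOn hk), card_range]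
  have := h ▸ mem_range.2 ht
  simpa using this

open Classical in
theorem card_keyPos_lt {X : Finset α} {key : α → β} (hk : Set.InjOn key X) (k : ℕ) :
    #{x ∈ X | keyPos X key x < k} = min #X k := by
  have h : ({x ∈ X | keyPos X key x < k}).image (keyPos X key) = range (min #X k) := by
    ext i
    simp only [mem_image, mem_filter, mem_range, lt_min_iff]
    constructor
    · rintro ⟨x, ⟨hx, hk'⟩, rfl⟩
      exact ⟨keyPos_lt_card hx, hk'⟩
    · rintro ⟨hi, hk'⟩
      obtain ⟨x, hx, rfl⟩ := exists_keyPos_eq hk hi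
      exact ⟨x, ⟨hx, hk'⟩, rfl⟩
  rw [← card_range (min #X k), ← h, card_image_of_injOn]
  exact (keyPos_injOn hk).mono fun x hx => (mem_filter.1 hx).1

end position

/-! ### Graphs on initial segments of the natural numbers with a twin cover -/

/-- A graph on the vertices `0, ..., n - 1` together with a set of vertices. -/
structure Gr where
  n : ℕ
  E : ℕ → ℕ → Prop
  S : ℕ → Prop

namespace Gr

/-- `S` is a twin cover of the graph. -/
structure Valid (G : Gr) : Prop where
  symm : ∀ {u v}, G.E u v → G.E v u
  irrefl : ∀ u, ¬ G.E u u
  lt : ∀ {u v}, G.E u v → u < G.n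
  S_lt : ∀ {u}, G.S u → u < G.n
  twin : ∀ {u v w}, ¬ G.S u → ¬ G.S v → G.E u v → w ≠ u → w ≠ v → (G.E u w ↔ G.E v w)

/-- `u` and `v` are in the same clique outside the twin cover. -/
def same (G : Gr) (u v : ℕ) : Prop :=
  u < G.n ∧ v < G.n ∧ ¬ G.S u ∧ ¬ G.S v ∧ (u = v ∨ G.E u v)

variable {G : Gr}

theorem same_refl {u : ℕ} (h : u < G.n) (hS : ¬ G.S u) : G.same u u := ⟨h, h, hS, hS, .inl rfl⟩

theorem same.symm (hG : G.Valid) {u v : ℕ} (h : G.same u v) : G.same v u :=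
  ⟨h.2.1, h.1, h.2.2.2.1, h.2.2.1, h.2.2.2.2.imp Eq.symm hG.symm⟩

/-- Here the twin condition enters: adjacent `u`, `v` outside the cover are twins, so the edge from
`v` to `w` carries over to `u`. Being in the same clique is thus an equivalence relation outside the
cover. -/
theorem same.trans (hG : G.Valid) {u v w : ℕ} (h : G.same u v) (h' : G.same v w) :
    G.same u w := by
  obtain ⟨hu, hv, su, sv, rfl | huv⟩ := h
  · exact h'
  obtain ⟨-, hw, -, sw, rfl | hvw⟩ := h'
  · exact ⟨hu, hv, su, sv, .inr huv⟩
  refine ⟨hu, hw, su, sw, ?_⟩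
  by_cases e : u = w
  · exact .inl e
  refine .inr ((hG.twin su sv huv (Ne.symm e) ?_).2 hvw)
  rintro rfl
  exact hG.irrefl _ hvw

theorem same.adj_iff (hG : G.Valid) {u v w : ℕ} (h : G.same u v) (hu : w ≠ u) (hv : w ≠ v) :
    G.E u w ↔ G.E v w := by
  obtain ⟨-, -, su, sv, rfl | huv⟩ := h
  · rfl
  · exact hG.twin su sv huv hu hv

theorem adj_of_same {u v : ℕ} (h : G.same u v) (hne : u ≠ v) : G.E u v :=
  h.2.2.2.2.resolve_left hne

theorem same_of_adj (hG : G.Valid) {u v : ℕ} (h : G.E u v) (hu : ¬ G.S u) (hv : ¬ G.S v) :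
    G.same u v := ⟨hG.lt h, hG.lt (hG.symm h), hu, hv, .inr h⟩

/-! ### One side of a partial isomorphism

The vertices `e x`, for `x` in the finite set `I`, are taken out of the graph. -/

section side

variable (G : Gr) (I : Finset ℕ) (e : ℕ → ℕ)

open Classical in
/-- The remaining vertices outside the twin cover. -/
noncomputable def rem : Finset ℕ := {u ∈ range G.n | ¬ G.S u ∧ u ∉ I.image e}

open Classical in
/-- The adjacencies to the vertices taken out. -/
noncomputable def prof (u : ℕ) : Finset ℕ := {x ∈ I | G.E u (e x)}

open Classical in
/-- The remaining part of the clique of `u`. -/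
noncomputable def cl (u : ℕ) : Finset ℕ := {v ∈ G.rem I e | G.same u v}

open Classical in
/-- The position in the remaining part of the clique. -/
noncomputable def rrk (u : ℕ) : ℕ := keyPos (G.cl I e u) id u

/-- Profile and position. -/
noncomputable def lab (u : ℕ) : Finset ℕ × ℕ := (G.prof I e u, G.rrk I e u)

open Classical in
/-- The remaining vertices with the label `l`. -/
noncomputable def labClass (l : Finset ℕ × ℕ) : Finset ℕ := {u ∈ G.rem I e | G.lab I e u = l}

variable {G I e}

theorem mem_rem {u : ℕ} : u ∈ G.rem I e ↔ u < G.n ∧ ¬ G.S u ∧ ∀ x ∈ I, e x ≠ u := by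
  simp [rem]

theorem mem_prof {u x : ℕ} : x ∈ G.prof I e u ↔ x ∈ I ∧ G.E u (e x) := by
  simp [prof]

theorem mem_cl {u v : ℕ} : v ∈ G.cl I e u ↔ v ∈ G.rem I e ∧ G.same u v := by
  simp [cl]

theorem mem_labClass {u : ℕ} {l : Finset ℕ × ℕ} :
    u ∈ G.labClass I e l ↔ u ∈ G.rem I e ∧ G.lab I e u = l := by
  simp [labClass]

theorem same_self_of_mem_rem {u : ℕ} (h : u ∈ G.rem I e) : G.same u u :=
  same_refl (mem_rem.1 h).1 (mem_rem.1 h).2.1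

theorem mem_cl_self {u : ℕ} (h : u ∈ G.rem I e) : u ∈ G.cl I e u :=
  mem_cl.2 ⟨h, same_self_of_mem_rem h⟩

theorem prof_eq_of_same (hG : G.Valid) {u v : ℕ} (hu : u ∈ G.rem I e) (hv : v ∈ G.rem I e)
    (h : G.same u v) : G.prof I e u = G.prof I e v := by
  ext x
  simp only [mem_prof]
  refine and_congr_right fun hx => ?_
  exact h.adj_iff hG ((mem_rem.1 hu).2.2 x hx) ((mem_rem.1 hv).2.2 x hx)

theorem cl_eq_of_same (hG : G.Valid) {u v : ℕ} (h : G.same u v) : G.cl I e u = G.cl I e v := by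
  ext x
  simp only [mem_cl]
  exact and_congr_right fun _ => ⟨fun h' => (h.symm hG).trans hG h', fun h' => h.trans hG h'⟩

theorem rrk_lt {u : ℕ} (h : u ∈ G.rem I e) : G.rrk I e u < #(G.cl I e u) :=
  keyPos_lt_card (mem_cl_self h)

theorem rrk_lt_n {u : ℕ} (h : u ∈ G.rem I e) : G.rrk I e u < G.n := by
  refine (rrk_lt h).trans_le ?_
  conv_rhs => rw [← card_range G.n]
  exact card_le_card fun v hv => mem_range.2 (mem_rem.1 (mem_cl.1 hv).1).1

theorem rrk_inj (hG : G.Valid) {u v : ℕ} (hu : u ∈ G.rem I e) (hv : v ∈ G.rem I e)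
    (h : G.same u v) (hr : G.rrk I e u = G.rrk I e v) : u = v := by
  refine keyPos_injOn (X := G.cl I e u) (key := id) Function.injective_id.injOn
    (mem_cl_self hu) (mem_cl.2 ⟨hv, h⟩) ?_
  rw [rrk, rrk, ← cl_eq_of_same hG h] at hr
  exact hr

theorem exists_rrk_eq (hG : G.Valid) {u t : ℕ} (ht : t < #(G.cl I e u)) :
    ∃ v ∈ G.rem I e, G.same u v ∧ G.rrk I e v = t := by
  obtain ⟨v, hv, h⟩ := exists_keyPos_eq (X := G.cl I e u) (key := id)
    Function.injective_id.injOn ht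
  obtain ⟨hr, hs⟩ := mem_cl.1 hv
  exact ⟨v, hr, hs, by rw [rrk, ← cl_eq_of_same hG hs, h]⟩

/-- The cliques are ordered by decreasing size, with ties broken by the least vertex. -/
noncomputable def clKey (G : Gr) (I : Finset ℕ) (e : ℕ → ℕ) (u : ℕ) : ℕ ×ₗ ℕ :=
  toLex (G.n - #(G.cl I e u), sInf {v | v ∈ G.cl I e u})

theorem clKey_eq_of_same (hG : G.Valid) {u v : ℕ} (h : G.same u v) :
    G.clKey I e u = G.clKey I e v := by
  rw [clKey, clKey, cl_eq_of_same hG h]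

theorem same_of_clKey_eq (hG : G.Valid) {u v : ℕ} (hu : u ∈ G.rem I e) (hv : v ∈ G.rem I e)
    (h : G.clKey I e u = G.clKey I e v) : G.same u v := by
  have h₂ : sInf {w | w ∈ G.cl I e u} = sInf {w | w ∈ G.cl I e v} := by
    have := congrArg (fun x => (ofLex x).2) h
    exact this
  have hu' := Nat.sInf_mem (s := {w | w ∈ G.cl I e u}) ⟨u, mem_cl_self hu⟩
  have hv' := Nat.sInf_mem (s := {w | w ∈ G.cl I e v}) ⟨v, mem_cl_self hv⟩
  rw [← h₂] at hv'
  exact (mem_cl.1 hu').2.trans hG ((mem_cl.1 hv').2.symm hG)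

theorem card_cl_le (u : ℕ) : #(G.cl I e u) ≤ G.n := by
  conv_rhs => rw [← card_range G.n]
  exact card_le_card fun v hv => mem_range.2 (mem_rem.1 (mem_cl.1 hv).1).1

theorem card_cl_le_of_clKey_lt {u v : ℕ} (h : G.clKey I e u < G.clKey I e v) :
    #(G.cl I e v) ≤ #(G.cl I e u) := by
  have h₁ := card_cl_le (G := G) (I := I) (e := e) u
  have h₂ := card_cl_le (G := G) (I := I) (e := e) v
  rcases Prod.Lex.toLex_lt_toLex.1 h with h | h
  · simp only at h; omega
  · simp only at h; omega

theorem clKey_injOn (hG : G.Valid) (l : Finset ℕ × ℕ) :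
    Set.InjOn (G.clKey I e) (G.labClass I e l) := by
  intro u hu v hv h
  obtain ⟨hu, hl⟩ := mem_labClass.1 (mem_coe.1 hu)
  obtain ⟨hv, hl'⟩ := mem_labClass.1 (mem_coe.1 hv)
  exact rrk_inj hG hu hv (same_of_clKey_eq hG hu hv h) (congrArg Prod.snd (hl.trans hl'.symm))

/-- The position of `u` among the vertices with the same label. -/
noncomputable def labPos (G : Gr) (I : Finset ℕ) (e : ℕ → ℕ) (u : ℕ) : ℕ :=
  keyPos (G.labClass I e (G.lab I e u)) (G.clKey I e) u

/-- A vertex `w` counted before `u` lies in a clique at least as large as that of `u`, so this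
clique has a vertex at the position of `v`; sending `w` to it is injective and lands among the
vertices counted before `v`. Hence `labPos` depends on the clique only: it is the place of the
clique among those with its profile, by decreasing size. -/
theorem labPos_le_of_same (hG : G.Valid) {u v : ℕ} (hu : u ∈ G.rem I e) (hv : v ∈ G.rem I e)
    (h : G.same u v) : G.labPos I e u ≤ G.labPos I e v := by
  classical
  have key : ∀ w ∈ ({w ∈ G.labClass I e (G.lab I e u) | G.clKey I e w < G.clKey I e u}),
      ∃ w' ∈ G.rem I e, G.same w w' ∧ G.rrk I e w' = G.rrk I e v := by
    intro w hw
    obtain ⟨-, hk⟩ := mem_filter.1 hw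
    refine exists_rrk_eq hG ((rrk_lt hv).trans_le ?_)
    rw [← cl_eq_of_same hG h]
    exact card_cl_le_of_clKey_lt hk
  choose! m hm hs hr using key
  rw [labPos, labPos, keyPos, keyPos]
  refine card_le_card_of_injOn m (fun w hw => ?_) fun w hw w' hw' hww => ?_
  · have hw := mem_coe.1 hw
    obtain ⟨hl, hk⟩ := mem_filter.1 hw
    obtain ⟨hwr, hl⟩ := mem_labClass.1 hl
    refine mem_coe.2 (mem_filter.2 ⟨mem_labClass.2 ⟨hm w hw, ?_⟩, ?_⟩)
    · refine Prod.ext ?_ (hr w hw)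
      change G.prof I e (m w) = G.prof I e v
      rw [← prof_eq_of_same hG hwr (hm w hw) (hs w hw), ← prof_eq_of_same hG hu hv h]
      exact congrArg Prod.fst hl
    · rwa [← clKey_eq_of_same hG (hs w hw), ← clKey_eq_of_same hG h]
  · have hw := mem_coe.1 hw
    have hw' := mem_coe.1 hw'
    have h₁ := mem_labClass.1 (mem_filter.1 hw).1
    have h₂ := mem_labClass.1 (mem_filter.1 hw').1
    refine rrk_inj hG h₁.1 h₂.1 ?_ (congrArg Prod.snd (h₁.2.trans h₂.2.symm))
    exact (hs w hw).trans hG (hww ▸ (hs w' hw').symm hG)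

theorem labPos_eq_of_same (hG : G.Valid) {u v : ℕ} (hu : u ∈ G.rem I e) (hv : v ∈ G.rem I e)
    (h : G.same u v) : G.labPos I e u = G.labPos I e v :=
  (labPos_le_of_same hG hu hv h).antisymm (labPos_le_of_same hG hv hu (h.symm hG))

theorem labPos_inj (hG : G.Valid) {u v : ℕ} (hu : u ∈ G.rem I e) (hv : v ∈ G.rem I e)
    (hl : G.lab I e u = G.lab I e v) (h : G.labPos I e u = G.labPos I e v) : u = v := by
  rw [labPos, labPos, ← hl] at h
  exact keyPos_injOn (clKey_injOn hG _) (mem_labClass.2 ⟨hu, rfl⟩)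
    (mem_labClass.2 ⟨hv, hl.symm⟩) h

/-- If `u` has the smaller position in its clique, then the clique of `v` has a vertex `w` at that
position. It shares label and `labPos` with `u`, and these determine a vertex, so `w = u`. -/
theorem same_of_prof_labPos (hG : G.Valid) {u v : ℕ} (hu : u ∈ G.rem I e) (hv : v ∈ G.rem I e)
    (hp : G.prof I e u = G.prof I e v) (h : G.labPos I e u = G.labPos I e v) : G.same u v := by
  suffices H : ∀ {u v : ℕ}, u ∈ G.rem I e → v ∈ G.rem I e → G.prof I e u = G.prof I e v →
      G.labPos I e u = G.labPos I e v → G.rrk I e u ≤ G.rrk I e v → G.same u v by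
    rcases le_total (G.rrk I e u) (G.rrk I e v) with h' | h'
    · exact H hu hv hp h h'
    · exact (H hv hu hp.symm h.symm h').symm hG
  intro u v hu hv hp h hle
  obtain ⟨w, hw, hs, hr⟩ := exists_rrk_eq hG (hle.trans_lt (rrk_lt hv))
  obtain rfl : u = w := by
    refine labPos_inj hG hu hw (Prod.ext ?_ hr.symm) ?_
    · exact hp.trans (prof_eq_of_same hG hv hw hs)
    · exact h.trans (labPos_eq_of_same hG hv hw hs)
  exact hs.symm hG

end side

end Gr

namespace Gr

/-! ### Partial isomorphisms -/

/-- A partial isomorphism between the two graphs: a common induced subgraph. -/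
def IsPI (G H : Gr) (φ : Finset (ℕ × ℕ)) : Prop :=
  (∀ p ∈ φ, p.1 < G.n ∧ p.2 < H.n) ∧
    ∀ p ∈ φ, ∀ q ∈ φ, (p.1 = q.1 ↔ p.2 = q.2) ∧ (G.E p.1 q.1 ↔ H.E p.2 q.2)

/-- The partial function `f` on `I` as a set of pairs. -/
def gph (I : Finset ℕ) (f : ℕ → ℕ) : Finset (ℕ × ℕ) := I.image fun x => (x, f x)

theorem mem_gph {I : Finset ℕ} {f : ℕ → ℕ} {p : ℕ × ℕ} :
    p ∈ gph I f ↔ p.1 ∈ I ∧ p.2 = f p.1 := by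
  simp only [gph, mem_image]
  constructor
  · rintro ⟨x, hx, rfl⟩
    exact ⟨hx, rfl⟩
  · rintro ⟨hx, h⟩
    exact ⟨p.1, hx, Prod.ext rfl h.symm⟩

theorem card_gph (I : Finset ℕ) (f : ℕ → ℕ) : #(gph I f) = #I :=
  card_image_of_injective _ fun _ _ h => congrArg Prod.fst h

/-- The maximum size of an extension by vertices outside the twin covers. -/
noncomputable def extVal (G H : Gr) (I : Finset ℕ) (f : ℕ → ℕ) : ℕ :=
  ∑ l ∈ I.powerset ×ˢ range G.n, min #(G.labClass I id l) #(H.labClass I f l)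

variable {G H : Gr} {I : Finset ℕ} {f : ℕ → ℕ}

theorem lab_mem {u : ℕ} (hu : u ∈ G.rem I f) : G.lab I f u ∈ I.powerset ×ˢ range G.n := by
  simp only [mem_product, mem_powerset, mem_range, lab]
  exact ⟨fun x hx => (mem_prof.1 hx).1, rrk_lt_n hu⟩

/-- Every partial isomorphism on the vertices taken out extends by `extVal` pairs. -/
theorem exists_ext (hG : G.Valid) (hH : H.Valid) (hI : IsPI G H (gph I f)) :
    ∃ ψ : Finset (ℕ × ℕ), (∀ p ∈ ψ, p.1 ∈ G.rem I id ∧ p.2 ∈ H.rem I f) ∧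
      IsPI G H (gph I f ∪ ψ) ∧ #I + extVal G H I f ≤ #(gph I f ∪ ψ) := by
  classical
  -- For each profile, the cliques of equal place by decreasing size are matched, vertex by vertex
  -- in order of position.
  let ψ : Finset (ℕ × ℕ) := {p ∈ G.rem I id ×ˢ H.rem I f |
    G.lab I id p.1 = H.lab I f p.2 ∧ G.labPos I id p.1 = H.labPos I f p.2}
  have hψ : ∀ p ∈ ψ, p.1 ∈ G.rem I id ∧ p.2 ∈ H.rem I f ∧
      G.lab I id p.1 = H.lab I f p.2 ∧ G.labPos I id p.1 = H.labPos I f p.2 := by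
    intro p hp
    simpa [ψ, and_assoc] using hp
  have hcross : ∀ p ∈ gph I f, ∀ q ∈ ψ, p.1 ≠ q.1 ∧ p.2 ≠ q.2 ∧
      (G.E p.1 q.1 ↔ H.E p.2 q.2) := by
    intro p hp q hq
    obtain ⟨hx, hy⟩ := mem_gph.1 hp
    obtain ⟨h₁, h₂, h₃, h₄⟩ := hψ q hq
    refine ⟨(mem_rem.1 h₁).2.2 _ hx, hy ▸ (mem_rem.1 h₂).2.2 _ hx, ?_⟩
    have : p.1 ∈ G.prof I id q.1 ↔ p.1 ∈ H.prof I f q.2 := by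
      rw [show G.prof I id q.1 = H.prof I f q.2 from congrArg Prod.fst h₃]
    simp only [mem_prof, hx, true_and, id] at this
    rw [hy]
    exact ⟨fun h => hH.symm (this.1 (hG.symm h)), fun h => hG.symm (this.2 (hH.symm h))⟩
  have hinner : ∀ p ∈ ψ, ∀ q ∈ ψ, (p.1 = q.1 ↔ p.2 = q.2) ∧ (G.E p.1 q.1 ↔ H.E p.2 q.2) := by
    intro p hp q hq
    obtain ⟨p₁, p₂, pl, pp⟩ := hψ p hp
    obtain ⟨q₁, q₂, ql, qp⟩ := hψ q hq
    have heq : p.1 = q.1 ↔ p.2 = q.2 := by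
      constructor
      · intro h
        refine labPos_inj hH p₂ q₂ ?_ ?_
        · rw [← pl, ← ql, h]
        · rw [← pp, ← qp, h]
      · intro h
        refine labPos_inj hG p₁ q₁ ?_ ?_
        · rw [pl, ql, h]
        · rw [pp, qp, h]
    have plf : G.prof I id p.1 = H.prof I f p.2 := congrArg Prod.fst pl
    have qlf : G.prof I id q.1 = H.prof I f q.2 := congrArg Prod.fst ql
    refine ⟨heq, fun h => ?_, fun h => ?_⟩
    · have hs := same_of_adj hG h (mem_rem.1 p₁).2.1 (mem_rem.1 q₁).2.1
      refine adj_of_same (same_of_prof_labPos hH p₂ q₂ ?_ ?_) ?_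
      · rw [← plf, ← qlf, prof_eq_of_same hG p₁ q₁ hs]
      · rw [← pp, ← qp, labPos_eq_of_same hG p₁ q₁ hs]
      · intro h'
        rw [heq.2 h'] at h
        exact hG.irrefl _ h
    · have hs := same_of_adj hH h (mem_rem.1 p₂).2.1 (mem_rem.1 q₂).2.1
      refine adj_of_same (same_of_prof_labPos hG p₁ q₁ ?_ ?_) ?_
      · rw [plf, qlf, prof_eq_of_same hH p₂ q₂ hs]
      · rw [pp, qp, labPos_eq_of_same hH p₂ q₂ hs]
      · intro h'
        rw [heq.1 h'] at h
        exact hH.irrefl _ h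
  refine ⟨ψ, fun p hp => ⟨(hψ p hp).1, (hψ p hp).2.1⟩, ⟨?_, ?_⟩, ?_⟩
  · intro p hp
    rcases mem_union.1 hp with hp | hp
    · exact hI.1 p hp
    · exact ⟨(mem_rem.1 (hψ p hp).1).1, (mem_rem.1 (hψ p hp).2.1).1⟩
  · intro p hp q hq
    rcases mem_union.1 hp with hp | hp <;> rcases mem_union.1 hq with hq | hq
    · exact hI.2 p hp q hq
    · obtain ⟨h₁, h₂, h₃⟩ := hcross p hp q hq
      exact ⟨iff_of_false h₁ h₂, h₃⟩
    · obtain ⟨h₁, h₂, h₃⟩ := hcross q hq p hp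
      refine ⟨iff_of_false h₁.symm h₂.symm, ?_⟩
      exact ⟨fun h => hH.symm (h₃.1 (hG.symm h)), fun h => hG.symm (h₃.2 (hH.symm h))⟩
    · exact hinner p hp q hq
  · rw [card_union_of_disjoint, card_gph]
    · refine Nat.add_le_add_left ?_ _
      rw [card_eq_sum_card_fiberwise (f := fun p => G.lab I id p.1)
        (t := I.powerset ×ˢ range G.n) fun p hp => mem_coe.2 (lab_mem (hψ p hp).1)]
      refine sum_le_sum fun l _ => ?_
      -- Every place `t` below both class sizes is occupied on both sides and gives one pair with
      -- label `l`.
      have h₁ : ∀ t ∈ range (min #(G.labClass I id l) #(H.labClass I f l)),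
          ∃ u ∈ G.labClass I id l, keyPos (G.labClass I id l) (G.clKey I id) u = t :=
        fun t ht => exists_keyPos_eq (clKey_injOn hG l)
          ((mem_range.1 ht).trans_le (min_le_left _ _))
      have h₂ : ∀ t ∈ range (min #(G.labClass I id l) #(H.labClass I f l)),
          ∃ u ∈ H.labClass I f l, keyPos (H.labClass I f l) (H.clKey I f) u = t :=
        fun t ht => exists_keyPos_eq (clKey_injOn hH l)
          ((mem_range.1 ht).trans_le (min_le_right _ _))
      choose! a ha ha' using h₁
      choose! b hb hb' using h₂
      rw [← card_range (min #(G.labClass I id l) #(H.labClass I f l))]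
      refine card_le_card_of_injOn (fun t => (a t, b t)) (fun t ht => ?_) fun t ht t' ht' h => ?_
      · have ht := mem_coe.1 ht
        obtain ⟨a₁, a₂⟩ := mem_labClass.1 (ha t ht)
        obtain ⟨b₁, b₂⟩ := mem_labClass.1 (hb t ht)
        simp only [ψ, coe_filter, mem_filter, mem_product, Set.mem_ofPred_eq]
        refine ⟨⟨⟨a₁, b₁⟩, a₂.trans b₂.symm, ?_⟩, a₂⟩
        rw [labPos, labPos, a₂, b₂, ha' t ht, hb' t ht]
      · rw [← ha' t (mem_coe.1 ht), ← ha' t' (mem_coe.1 ht'),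
          show a t = a t' from congrArg Prod.fst h]
    · refine disjoint_left.2 fun p hp hp' => ?_
      exact (hcross p hp p hp').1 rfl

/-- No extension by vertices outside the twin covers has more than `extVal` pairs. -/
theorem card_ext_le (hG : G.Valid) (hH : H.Valid) {ψ : Finset (ℕ × ℕ)}
    (hψ : ∀ p ∈ ψ, p.1 ∈ G.rem I id ∧ p.2 ∈ H.rem I f)
    (hpi : IsPI G H (gph I f ∪ ψ)) : #ψ ≤ extVal G H I f := by
  classical
  -- The position of the pair among the pairs of `ψ` in the same clique. As `ψ` preserves cliques,
  -- this position is valid in the clique of either vertex.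
  let r : ℕ × ℕ → ℕ := fun p => #{q ∈ ψ | G.same p.1 q.1 ∧ q.1 < p.1}
  have hin : ∀ p ∈ ψ, p ∈ gph I f ∪ ψ := fun p hp => mem_union_right _ hp
  have hsame : ∀ p ∈ ψ, ∀ q ∈ ψ, G.same p.1 q.1 ↔ H.same p.2 q.2 := by
    intro p hp q hq
    obtain ⟨p₁, p₂⟩ := hψ p hp
    obtain ⟨q₁, q₂⟩ := hψ q hq
    obtain ⟨h₁, h₂⟩ := hpi.2 p (hin p hp) q (hin q hq)
    rw [mem_rem] at p₁ p₂ q₁ q₂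
    simp only [same, h₁, h₂, p₁, p₂, q₁, q₂, true_and, not_false_eq_true]
  have hprof : ∀ p ∈ ψ, G.prof I id p.1 = H.prof I f p.2 := by
    intro p hp
    ext x
    simp only [mem_prof, id]
    refine and_congr_right fun hx => ?_
    exact (hpi.2 p (hin p hp) (x, f x) (mem_union_left _ (mem_gph.2 ⟨hx, rfl⟩))).2
  have hrlt : ∀ p ∈ ψ, ∀ q ∈ ψ, G.same p.1 q.1 → r p = r q → p = q := by
    have : ∀ p ∈ ψ, ∀ q ∈ ψ, G.same p.1 q.1 → p.1 < q.1 → r p < r q := by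
      intro p hp q hq hs hlt
      refine card_lt_card ⟨fun w hw => ?_, fun hsub => ?_⟩
      · simp only [mem_filter] at hw ⊢
        exact ⟨hw.1, (hs.symm hG).trans hG hw.2.1, hw.2.2.trans hlt⟩
      · have := hsub (mem_filter.2 ⟨hp, hs.symm hG, hlt⟩)
        simp at this
    intro p hp q hq hs hr
    have h : p.1 = q.1 := by
      rcases lt_trichotomy p.1 q.1 with h | h | h
      · exact absurd hr (this p hp q hq hs h).ne
      · exact h
      · exact absurd hr (this q hq p hp (hs.symm hG) h).ne'
    exact Prod.ext h ((hpi.2 p (hin p hp) q (hin q hq)).1.1 h)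
  have hrG : ∀ p ∈ ψ, r p < #(G.cl I id p.1) := by
    intro p hp
    refine lt_of_lt_of_le (b := #{q ∈ ψ | G.same p.1 q.1}) ?_ ?_
    · refine card_lt_card ⟨fun w hw => ?_, fun hsub => ?_⟩
      · simp only [mem_filter] at hw ⊢
        exact ⟨hw.1, hw.2.1⟩
      · have := hsub (mem_filter.2 ⟨hp, same_self_of_mem_rem (hψ p hp).1⟩)
        simp at this
    · refine card_le_card_of_injOn Prod.fst (fun q hq => ?_) fun q hq q' hq' h => ?_
      · obtain ⟨h₁, h₂⟩ := mem_filter.1 (mem_coe.1 hq)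
        exact mem_coe.2 (mem_cl.2 ⟨(hψ q h₁).1, h₂⟩)
      · have h₁ := (mem_filter.1 (mem_coe.1 hq)).1
        have h₂ := (mem_filter.1 (mem_coe.1 hq')).1
        exact Prod.ext h ((hpi.2 _ (hin _ h₁) _ (hin _ h₂)).1.1 h)
  have hrH : ∀ p ∈ ψ, r p < #(H.cl I f p.2) := by
    intro p hp
    refine lt_of_lt_of_le (b := #{q ∈ ψ | G.same p.1 q.1}) ?_ ?_
    · refine card_lt_card ⟨fun w hw => ?_, fun hsub => ?_⟩
      · simp only [mem_filter] at hw ⊢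
        exact ⟨hw.1, hw.2.1⟩
      · have := hsub (mem_filter.2 ⟨hp, same_self_of_mem_rem (hψ p hp).1⟩)
        simp at this
    · refine card_le_card_of_injOn Prod.snd (fun q hq => ?_) fun q hq q' hq' h => ?_
      · obtain ⟨h₁, h₂⟩ := mem_filter.1 (mem_coe.1 hq)
        exact mem_coe.2 (mem_cl.2 ⟨(hψ q h₁).2, (hsame p hp q h₁).1 h₂⟩)
      · have h₁ := (mem_filter.1 (mem_coe.1 hq)).1
        have h₂ := (mem_filter.1 (mem_coe.1 hq')).1
        exact Prod.ext ((hpi.2 _ (hin _ h₁) _ (hin _ h₂)).1.2 h) h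
  have ea : ∀ p ∈ ψ, ∃ v ∈ G.rem I id, G.same p.1 v ∧ G.rrk I id v = r p :=
    fun p hp => exists_rrk_eq hG (hrG p hp)
  have eb : ∀ p ∈ ψ, ∃ v ∈ H.rem I f, H.same p.2 v ∧ H.rrk I f v = r p :=
    fun p hp => exists_rrk_eq hH (hrH p hp)
  -- Push the matched vertices of each clique to its first positions. The pairs with profile and
  -- position `l` then inject into the label class of `l` in both graphs, which bounds them by the
  -- minimum.
  choose! a a₁ a₂ a₃ using ea
  choose! b b₁ b₂ b₃ using eb
  rw [card_eq_sum_card_fiberwise (f := fun p => (G.prof I id p.1, r p))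
    (t := I.powerset ×ˢ range G.n)]
  · refine sum_le_sum fun l _ => le_min ?_ ?_
    · refine card_le_card_of_injOn a (fun p hp => ?_) fun p hp q hq h => ?_
      · obtain ⟨hp, hl⟩ := mem_filter.1 (mem_coe.1 hp)
        refine mem_coe.2 (mem_labClass.2 ⟨a₁ p hp, ?_⟩)
        rw [lab, a₃ p hp, ← prof_eq_of_same hG (hψ p hp).1 (a₁ p hp) (a₂ p hp), hl]
      · obtain ⟨hp, hl⟩ := mem_filter.1 (mem_coe.1 hp)
        obtain ⟨hq, hl'⟩ := mem_filter.1 (mem_coe.1 hq)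
        refine hrlt p hp q hq ((a₂ p hp).trans hG (h ▸ (a₂ q hq).symm hG)) ?_
        exact congrArg Prod.snd (hl.trans hl'.symm)
    · refine card_le_card_of_injOn b (fun p hp => ?_) fun p hp q hq h => ?_
      · obtain ⟨hp, hl⟩ := mem_filter.1 (mem_coe.1 hp)
        refine mem_coe.2 (mem_labClass.2 ⟨b₁ p hp, ?_⟩)
        rw [lab, b₃ p hp, ← prof_eq_of_same hH (hψ p hp).2 (b₁ p hp) (b₂ p hp), ← hprof p hp, hl]
      · obtain ⟨hp, hl⟩ := mem_filter.1 (mem_coe.1 hp)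
        obtain ⟨hq, hl'⟩ := mem_filter.1 (mem_coe.1 hq)
        refine hrlt p hp q hq ((hsame p hp q hq).2
          ((b₂ p hp).trans hH (h ▸ (b₂ q hq).symm hH))) ?_
        exact congrArg Prod.snd (hl.trans hl'.symm)
  · intro p hp
    have hp := mem_coe.1 hp
    have hv := rrk_lt_n (a₁ p hp)
    rw [a₃ p hp] at hv
    refine mem_coe.2 (mem_product.2 ⟨mem_powerset.2 fun x hx => (mem_prof.1 hx).1, ?_⟩)
    exact mem_range.2 hv

end Gr

namespace Gr

/-! ### Sizes and types of cliques, candidates -/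

section defs

variable (G : Gr) (N K : ℕ)

/-- The size of the clique of `u`. -/
noncomputable def size (u : ℕ) : ℕ := cnt N fun v => G.same u v

/-- The position of `u` in its clique. -/
noncomputable def rk (u : ℕ) : ℕ := cnt N fun v => G.same u v ∧ v < u

/-- `u` is the least vertex of its clique. -/
def leader (u : ℕ) : Prop := G.same u u ∧ Ball N fun v => ¬ (G.same u v ∧ v < u)

/-- `u` and `v` have the same neighbors in the twin cover. -/
def sty (u v : ℕ) : Prop := Ball N fun s => G.S s → (G.E u s ↔ G.E v s)

/-- The order of the cliques by size, with ties broken by the vertices given. -/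
def before (u v : ℕ) : Prop := G.size N u < G.size N v ∨ (G.size N u = G.size N v ∧ u < v)

/-- Fewer than `K` cliques of the same type are larger. -/
def top (u : ℕ) : Prop :=
  G.leader N u ∧ cnt N (fun v => G.leader N v ∧ G.sty N u v ∧ G.size N u < G.size N v) < K

/-- The clique of `u` has size at least `θ`, and fewer than `K` such cliques of the same type come
before it. -/
def nearAbove (θ u : ℕ) : Prop :=
  θ ≤ G.size N u ∧
    cnt N (fun v => G.leader N v ∧ G.sty N u v ∧ θ ≤ G.size N v ∧ G.before N v u) < K

/-- The clique of `u` has size at most `θ`, and fewer than `K` such cliques of the same type come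
after it. -/
def nearBelow (θ u : ℕ) : Prop :=
  G.size N u ≤ θ ∧
    cnt N (fun v => G.leader N v ∧ G.sty N u v ∧ G.size N v ≤ θ ∧ G.before N u v) < K

/-- The size of the clique of `u` is one of the closest to the threshold `θ`. -/
def near (θ u : ℕ) : Prop := G.nearAbove N K θ u ∨ G.nearBelow N K θ u

/-- The cliques that are considered as images of vertices in the twin cover of the other graph
`H`. -/
def candLeader (H : Gr) (u : ℕ) : Prop :=
  G.leader N u ∧ (G.near N K N u ∨ (Bex N fun a => a < K ∧ G.near N K a u) ∨
    Bex N fun d => Bex N fun a => H.top N K d ∧ a < K ∧ G.near N K (H.size N d + a) u)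

/-- The vertices outside the twin cover that are considered as images of vertices in the twin
cover of the other graph `H`. -/
def cand (H : Gr) (v : ℕ) : Prop :=
  G.rk N v < K ∧ Bex N fun u => G.same u v ∧ G.candLeader N K H u

/-- The vertices considered as partners of vertices in the two twin covers. -/
def pool (H : Gr) (v : ℕ) : Prop := G.S v ∨ G.cand N K H v

end defs

variable {G H : Gr} {N K : ℕ} {I : Finset ℕ} {e f : ℕ → ℕ}

theorem leader.eq_of_same (hG : G.Valid) (hN : G.n ≤ N) {u v : ℕ} (hu : G.leader N u)
    (hv : G.leader N v) (h : G.same u v) : u = v := by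
  rcases lt_trichotomy u v with h' | h' | h'
  · exact absurd ⟨h.symm hG, h'⟩ (hv.2 u (h.1.trans_le hN))
  · exact h'
  · exact absurd ⟨h, h'⟩ (hu.2 v (h.2.1.trans_le hN))

theorem exists_leader (hG : G.Valid) {u : ℕ} (h : G.same u u) :
    ∃ v, G.leader N v ∧ G.same v u := by
  classical
  have hex : ∃ v, G.same v u := ⟨u, h⟩
  refine ⟨Nat.find hex, ⟨?_, fun w _ hw => ?_⟩, Nat.find_spec hex⟩
  · exact (Nat.find_spec hex).trans hG ((Nat.find_spec hex).symm hG)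
  · exact Nat.find_min hex hw.2 ((hw.1.symm hG).trans hG (Nat.find_spec hex))

theorem sty.iff {u v s : ℕ} (hG : G.Valid) (hN : G.n ≤ N) (h : G.sty N u v) (hs : G.S s) :
    G.E u s ↔ G.E v s := h s ((hG.S_lt hs).trans_le hN) hs

theorem sty.trans {u v w : ℕ} (h : G.sty N u v) (h' : G.sty N v w) : G.sty N u w :=
  fun s hs hS => (h s hs hS).trans (h' s hs hS)

theorem sty_refl (u : ℕ) : G.sty N u u := fun _ _ _ => Iff.rfl

theorem adj_S_iff_of_same (hG : G.Valid) {u v s : ℕ} (h : G.same u v) (hs : G.S s) :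
    G.E u s ↔ G.E v s :=
  h.adj_iff hG (fun h' => h.2.2.1 (h' ▸ hs)) fun h' => h.2.2.2.1 (h' ▸ hs)

/-- Every vertex taken out lies in at most one clique. -/
theorem cnt_touched_le (hG : G.Valid) (hN : G.n ≤ N) {P : ℕ → Prop}
    (hP : ∀ w, P w → G.leader N w ∧ ∃ x ∈ I, G.same w (e x)) : cnt N P ≤ #I := by
  classical
  have : ∀ w, P w → ∃ x ∈ I, G.same w (e x) := fun w hw => (hP w hw).2
  choose! m hm hs using this
  refine card_le_card_of_injOn m (fun w hw => ?_) fun w hw w' hw' h => ?_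
  · exact mem_coe.2 (hm w (mem_filter.1 (mem_coe.1 hw)).2)
  · have h₁ := (mem_filter.1 (mem_coe.1 hw)).2
    have h₂ := (mem_filter.1 (mem_coe.1 hw')).2
    exact (hP w h₁).1.eq_of_same hG hN (hP w' h₂).1
      ((hs w h₁).trans hG (h ▸ (hs w' h₂).symm hG))

-- A clique consists of its remaining part and of the vertices taken out of it; injectivity of `e`
-- lets the latter be counted by their indices.
open Classical in
theorem card_cl_add (hN : G.n ≤ N) (he : Set.InjOn e I) (u : ℕ) :
    #(G.cl I e u) + #{x ∈ I | G.same u (e x)} = G.size N u := by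
  rw [← card_image_of_injOn (f := e) (he.mono fun x hx => (mem_filter.1 (mem_coe.1 hx)).1),
    ← card_union_of_disjoint]
  · rw [size, cnt]
    congr 1
    ext v
    simp only [mem_union, mem_cl, mem_rem, mem_image, mem_filter, mem_range]
    constructor
    · rintro (⟨-, h⟩ | ⟨x, ⟨-, h⟩, rfl⟩)
      · exact ⟨h.2.1.trans_le hN, h⟩
      · exact ⟨h.2.1.trans_le hN, h⟩
    · rintro ⟨-, h⟩
      by_cases hx : ∃ x ∈ I, e x = v
      · obtain ⟨x, hx, rfl⟩ := hx
        exact .inr ⟨x, ⟨hx, h⟩, rfl⟩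
      · push Not at hx
        exact .inl ⟨⟨h.2.1, h.2.2.2.1, hx⟩, h⟩
  · refine disjoint_left.2 fun v hv hv' => ?_
    obtain ⟨x, hx, rfl⟩ := mem_image.1 hv'
    exact (mem_rem.1 (mem_cl.1 hv).1).2.2 x (mem_filter.1 hx).1 rfl

theorem size_le (hN : G.n ≤ N) (u : ℕ) : G.size N u ≤ G.n := by
  classical
  have := card_cl_add (I := ∅) (e := id) hN (by simp) u
  rw [← this]
  simpa using card_cl_le u

/-- Among the cliques of the type of `c` that are not touched, together with `c`, there is one
near the threshold on the same side as `c`. -/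
theorem exists_near (hG : G.Valid) (hN : G.n ≤ N) (hK : #I < K) {c : ℕ} (hc : G.leader N c)
    (θ : ℕ) : ∃ c', G.leader N c' ∧ G.sty N c c' ∧ (c' = c ∨ ∀ x ∈ I, ¬ G.same c' (e x)) ∧
      G.near N K θ c' ∧ (θ ≤ G.size N c' ∧ G.size N c' ≤ G.size N c ∨
        G.size N c ≤ G.size N c' ∧ G.size N c' ≤ θ) := by
  classical
  -- The admissible targets; `c` itself is always one, although it may be touched.
  let X : Finset ℕ := {v ∈ range N | G.leader N v ∧ G.sty N c v ∧
    (v = c ∨ ∀ x ∈ I, ¬ G.same v (e x))}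
  have hX : ∀ {v}, v ∈ X ↔ G.leader N v ∧ G.sty N c v ∧
      (v = c ∨ ∀ x ∈ I, ¬ G.same v (e x)) := by
    intro v
    simp only [X, mem_filter, mem_range, and_iff_right_iff_imp]
    exact fun h => h.1.1.1.trans_le hN
  let key : ℕ → ℕ ×ₗ ℕ := fun v => toLex (G.size N v, v)
  have hkey : ∀ u v, G.before N u v ↔ key u < key v := fun u v => by
    simp only [key, Prod.Lex.toLex_lt_toLex, before]
  have hle : ∀ u v, key u ≤ key v → G.size N u ≤ G.size N v := fun u v h => by
    rcases Prod.Lex.toLex_le_toLex.1 h with h | h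
    · exact h.le
    · exact h.1.le
  have htouch : ∀ w, G.leader N w → G.sty N c w → w ∉ X → ∃ x ∈ I, G.same w (e x) := by
    intro w hw hs hwX
    by_contra hcon
    push Not at hcon
    exact hwX (hX.2 ⟨hw, hs, .inr hcon⟩)
  have hcX : c ∈ X := hX.2 ⟨hc, sty_refl c, .inl rfl⟩
  rcases le_total θ (G.size N c) with hθ | hθ
  · obtain ⟨c', hc', hmin⟩ := exists_min_image {v ∈ X | θ ≤ G.size N v} key
      ⟨c, mem_filter.2 ⟨hcX, hθ⟩⟩
    obtain ⟨hc', hθ'⟩ := mem_filter.1 hc'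
    obtain ⟨h₁, h₂, h₃⟩ := hX.1 hc'
    refine ⟨c', h₁, h₂, h₃, .inl ⟨hθ', lt_of_le_of_lt ?_ hK⟩,
      .inl ⟨hθ', hle _ _ (hmin c (mem_filter.2 ⟨hcX, hθ⟩))⟩⟩
    -- By the extremal choice of `c'`, every clique between the threshold and `c'` is outside `X`,
    -- hence touched; there are at most `#I < K` of them.
    refine cnt_touched_le (e := e) hG hN fun w hw => ⟨hw.1, ?_⟩
    refine htouch w hw.1 (h₂.trans hw.2.1) fun hwX => ?_
    exact absurd ((hkey _ _).1 hw.2.2.2) (hmin w (mem_filter.2 ⟨hwX, hw.2.2.1⟩)).not_gt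
  · obtain ⟨c', hc', hmax⟩ := exists_max_image {v ∈ X | G.size N v ≤ θ} key
      ⟨c, mem_filter.2 ⟨hcX, hθ⟩⟩
    obtain ⟨hc', hθ'⟩ := mem_filter.1 hc'
    obtain ⟨h₁, h₂, h₃⟩ := hX.1 hc'
    refine ⟨c', h₁, h₂, h₃, .inr ⟨hθ', lt_of_le_of_lt ?_ hK⟩,
      .inr ⟨hle _ _ (hmax c (mem_filter.2 ⟨hcX, hθ⟩)), hθ'⟩⟩
    refine cnt_touched_le (e := e) hG hN fun w hw => ⟨hw.1, ?_⟩
    refine htouch w hw.1 (h₂.trans hw.2.1) fun hwX => ?_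
    exact absurd ((hkey _ _).1 hw.2.2.2) (hmax w (mem_filter.2 ⟨hwX, hw.2.2.1⟩)).not_gt

/-! ### Counting labels in a clique -/

open Classical in
/-- The vertices taken out that are in the twin cover and adjacent to `c`. -/
noncomputable def baseProf (G : Gr) (I : Finset ℕ) (e : ℕ → ℕ) (c : ℕ) : Finset ℕ :=
  {x ∈ I | G.S (e x) ∧ G.E c (e x)}

open Classical in
/-- The vertices taken out that are in the clique of `c`. -/
noncomputable def touch (G : Gr) (I : Finset ℕ) (e : ℕ → ℕ) (c : ℕ) : Finset ℕ :=
  {x ∈ I | G.same c (e x)}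

theorem mem_touch {c x : ℕ} : x ∈ G.touch I e c ↔ x ∈ I ∧ G.same c (e x) := by simp [touch]

theorem mem_baseProf {c x : ℕ} :
    x ∈ G.baseProf I e c ↔ x ∈ I ∧ G.S (e x) ∧ G.E c (e x) := by simp [baseProf]

/-- A vertex outside the cover has neighbors only in the cover and in its own clique. -/
theorem prof_of_mem_cl (hG : G.Valid) {c v : ℕ} (hv : v ∈ G.cl I e c) :
    G.prof I e v = G.baseProf I e c ∪ G.touch I e c := by
  obtain ⟨hr, hs⟩ := mem_cl.1 hv
  ext x
  simp only [mem_prof, mem_union, mem_baseProf, mem_touch]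
  rw [← and_or_left]
  refine and_congr_right fun hx => ?_
  by_cases hS : G.S (e x)
  · rw [← adj_S_iff_of_same hG hs hS]
    simp only [hS, true_and]
    exact ⟨.inl, fun h => h.resolve_right fun h => h.2.2.2.1 hS⟩
  · simp only [hS, false_and, false_or]
    have hne : v ≠ e x := fun h => (mem_rem.1 hr).2.2 x hx h.symm
    constructor
    · intro h
      exact hs.trans hG (same_of_adj hG h hs.2.2.2.1 hS)
    · intro h
      exact adj_of_same ((hs.symm hG).trans hG h) hne

-- Within one clique the profile is constant and the positions are `0, 1, ...` without repetition,
-- so a label occurs at most once.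
open Classical in
theorem card_labClass_same (hG : G.Valid) (c : ℕ) (l : Finset ℕ × ℕ) :
    #{v ∈ G.labClass I e l | G.same c v} =
      if l.1 = G.baseProf I e c ∪ G.touch I e c ∧ l.2 < #(G.cl I e c) then 1 else 0 := by
  split_ifs with h
  · obtain ⟨v, hv, hs, hr⟩ := exists_rrk_eq hG h.2
    rw [card_eq_one]
    refine ⟨v, ?_⟩
    ext w
    simp only [mem_filter, mem_labClass, mem_singleton]
    constructor
    · rintro ⟨⟨hw, hl⟩, hs'⟩
      refine rrk_inj hG hw hv ((hs'.symm hG).trans hG hs) ?_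
      rw [hr]
      exact congrArg Prod.snd hl
    · rintro rfl
      refine ⟨⟨hv, Prod.ext ?_ hr⟩, hs⟩
      rw [h.1]
      exact prof_of_mem_cl hG (mem_cl.2 ⟨hv, hs⟩)
  · rw [card_eq_zero, filter_eq_empty_iff]
    intro v hv hs
    obtain ⟨hr, rfl⟩ := mem_labClass.1 hv
    have hcl := mem_cl.2 ⟨hr, hs⟩
    refine h ⟨prof_of_mem_cl hG hcl, ?_⟩
    rw [cl_eq_of_same hG hs]
    exact rrk_lt hr

open Classical in
/-- The vertices with label `l` outside the cliques of `c` and `c'`. -/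
noncomputable def restClass (G : Gr) (I : Finset ℕ) (e : ℕ → ℕ) (c c' : ℕ)
    (l : Finset ℕ × ℕ) : Finset ℕ := {v ∈ G.labClass I e l | ¬ G.same c v ∧ ¬ G.same c' v}

-- The label class is split into the contributions of the two cliques and the rest; the test `c =
-- c'` avoids counting one clique twice.
open Classical in
theorem card_labClass_eq (hG : G.Valid) {c c' : ℕ} (hcc : G.same c c' → c = c')
    (l : Finset ℕ × ℕ) :
    #(G.labClass I e l) = #(G.restClass I e c c' l) +
      (if l.1 = G.baseProf I e c ∪ G.touch I e c ∧ l.2 < #(G.cl I e c) then 1 else 0) +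
      (if c = c' then 0 else
        if l.1 = G.baseProf I e c' ∪ G.touch I e c' ∧ l.2 < #(G.cl I e c') then 1 else 0) := by
  rw [← card_labClass_same hG c, ← card_labClass_same hG c']
  have h₁ := card_filter_add_card_filter_not (s := G.labClass I e l) (fun v => G.same c v)
  have h₂ := card_filter_add_card_filter_not
    (s := {v ∈ G.labClass I e l | ¬ G.same c v}) (fun v => G.same c' v)
  rw [filter_filter, filter_filter] at h₂
  have h₃ : #(G.restClass I e c c' l) =
      #{v ∈ G.labClass I e l | ¬ G.same c v ∧ ¬ G.same c' v} := rfl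
  have h₄ : #{v ∈ G.labClass I e l | ¬ G.same c v ∧ G.same c' v} =
      if c = c' then 0 else #{v ∈ G.labClass I e l | G.same c' v} := by
    split_ifs with h
    · subst h
      rw [card_eq_zero, filter_eq_empty_iff]
      exact fun v _ hv => hv.1 hv.2
    · congr 1
      ext v
      simp only [mem_filter]
      refine and_congr_right fun _ => ⟨And.right, fun hv => ⟨fun hv' => h (hcc ?_), hv⟩⟩
      exact hv'.trans hG (hv.symm hG)
  omega

end Gr

namespace Gr

/-! ### Moving the images of vertices to another clique -/

/-- `f'` arises from `f` by moving all images in the clique of `c` to the clique of `c'`, which is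
of the same type and contains no other images. -/
structure Move (H : Gr) (N : ℕ) (I : Finset ℕ) (f f' : ℕ → ℕ) (c c' : ℕ) : Prop where
  leader : H.leader N c
  leader' : H.leader N c'
  sty : H.sty N c c'
  untouched : c' = c ∨ ∀ x ∈ I, ¬ H.same c' (f x)
  eq : ∀ x ∈ I, ¬ H.same c (f x) → f' x = f x
  same' : ∀ x ∈ I, H.same c (f x) → H.same c' (f' x)

namespace Move

variable {G H : Gr} {N : ℕ} {I : Finset ℕ} {f f' : ℕ → ℕ} {c c' : ℕ}

theorem same_iff (h : Move H N I f f' c c') {x : ℕ} (hx : x ∈ I) :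
    H.same c' (f' x) ↔ H.same c (f x) := by
  refine ⟨fun hs => ?_, h.same' x hx⟩
  by_contra hn
  rw [h.eq x hx hn] at hs
  rcases h.untouched with rfl | hu
  · exact hn hs
  · exact hu x hx hs

theorem touch_eq (h : Move H N I f f' c c') : H.touch I f' c' = H.touch I f c := by
  ext x
  simp only [mem_touch]
  exact and_congr_right fun hx => h.same_iff hx

theorem touch_old (hH : H.Valid) (hN : H.n ≤ N) (h : Move H N I f f' c c') (hne : c ≠ c') :
    H.touch I f' c = ∅ := by
  refine eq_empty_of_forall_notMem fun x hx => ?_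
  obtain ⟨hx, hs⟩ := mem_touch.1 hx
  by_cases hf : H.same c (f x)
  · exact hne (h.leader.eq_of_same hH hN h.leader' (hs.trans hH ((h.same' x hx hf).symm hH)))
  · rw [h.eq x hx hf] at hs
    exact hf hs

theorem touch_new (h : Move H N I f f' c c') (hne : c ≠ c') : H.touch I f c' = ∅ := by
  refine eq_empty_of_forall_notMem fun x hx => ?_
  obtain ⟨hx, hs⟩ := mem_touch.1 hx
  exact h.untouched.resolve_left (fun h' => hne h'.symm) x hx hs

/-- The images that move are outside the cover before and after, so they never enter a base profile.
-/
theorem baseProf_eq (h : Move H N I f f' c c') (w : ℕ) :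
    H.baseProf I f' w = H.baseProf I f w := by
  ext x
  simp only [mem_baseProf]
  refine and_congr_right fun hx => ?_
  by_cases hs : H.same c (f x)
  · have h₁ := hs.2.2.2.1
    have h₂ := (h.same' x hx hs).2.2.2.1
    simp [h₁, h₂]
  · rw [h.eq x hx hs]

theorem baseProf_sty (hH : H.Valid) (hN : H.n ≤ N) (h : Move H N I f f' c c') :
    H.baseProf I f c' = H.baseProf I f c := by
  ext x
  simp only [mem_baseProf]
  refine and_congr_right fun hx => and_congr_right fun hS => ?_
  exact (h.sty.iff hH hN hS).symm

theorem mem_rem_iff (h : Move H N I f f' c c') {v : ℕ} (h₁ : ¬ H.same c v)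
    (h₂ : ¬ H.same c' v) : v ∈ H.rem I f' ↔ v ∈ H.rem I f := by
  simp only [mem_rem]
  refine and_congr_right fun _ => and_congr_right fun _ => forall₂_congr fun x hx => ?_
  by_cases hs : H.same c (f x)
  · refine iff_of_true ?_ ?_
    · rintro rfl
      exact h₂ (h.same' x hx hs)
    · rintro rfl
      exact h₁ hs
  · rw [h.eq x hx hs]

/-- A vertex in neither clique is nonadjacent to the moved images both before and after, and the
remaining part of its clique is unchanged; so its label is too. -/
theorem restClass_eq (hH : H.Valid) (h : Move H N I f f' c c') (l : Finset ℕ × ℕ) :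
    H.restClass I f' c c' l = H.restClass I f c c' l := by
  ext v
  simp only [restClass, mem_filter, mem_labClass, and_assoc]
  rw [← and_assoc, ← and_assoc (b := H.lab I f v = l)]
  rw [and_comm, and_comm (b := ¬ H.same c v ∧ ¬ H.same c' v)]
  refine and_congr_right fun ⟨h₁, h₂⟩ => ?_
  rw [h.mem_rem_iff h₁ h₂]
  refine and_congr_right fun hv => ?_
  have hS := (mem_rem.1 hv).2.1
  have hp : H.prof I f' v = H.prof I f v := by
    ext x
    simp only [mem_prof]
    refine and_congr_right fun hx => ?_
    by_cases hs : H.same c (f x)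
    · have hs' := h.same' x hx hs
      refine iff_of_false (fun hE => ?_) fun hE => ?_
      · exact h₂ (hs'.trans hH ((same_of_adj hH hE hS hs'.2.2.2.1).symm hH))
      · exact h₁ (hs.trans hH ((same_of_adj hH hE hS hs.2.2.2.1).symm hH))
    · rw [h.eq x hx hs]
  have hc : H.cl I f' v = H.cl I f v := by
    ext w
    simp only [mem_cl]
    rw [and_comm, and_comm (b := H.same v w)]
    refine and_congr_right fun hs => ?_
    refine h.mem_rem_iff (fun h' => h₁ ?_) fun h' => h₂ ?_
    · exact h'.trans hH (hs.symm hH)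
    · exact h'.trans hH (hs.symm hH)
  rw [lab, lab, rrk, rrk, hp, hc]

/-- Moving images keeps a partial isomorphism. -/
theorem isPI (hG : G.Valid) (hH : H.Valid) (hN : H.n ≤ N) (h : Move H N I f f' c c')
    (hinj : Set.InjOn f' (H.touch I f c)) (hI : IsPI G H (gph I f)) :
    IsPI G H (gph I f') := by
  have hpi : ∀ x ∈ I, ∀ y ∈ I, (x = y ↔ f x = f y) ∧ (G.E x y ↔ H.E (f x) (f y)) :=
    fun x hx y hy => hI.2 (x, f x) (mem_gph.2 ⟨hx, rfl⟩) (y, f y) (mem_gph.2 ⟨hy, rfl⟩)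
  have hmix : ∀ x ∈ I, ∀ y ∈ I, H.same c (f x) → ¬ H.same c (f y) →
      f' x ≠ f' y ∧ (H.E (f' x) (f' y) ↔ H.E (f x) (f y)) := by
    intro x hx y hy hs hn
    have hs' := h.same' x hx hs
    have hn' : ¬ H.same c' (f' y) := fun h' => hn ((h.same_iff hy).1 h')
    rw [h.eq y hy hn] at hn' ⊢
    refine ⟨fun he => hn' (he ▸ hs'), ?_⟩
    -- A fixed image in the cover sees both cliques alike because they have the same type. One
    -- outside the cover is in neither clique and is adjacent to none of the moved images.
    by_cases hS : H.S (f y)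
    · rw [← adj_S_iff_of_same hH hs' hS, ← adj_S_iff_of_same hH hs hS, h.sty.iff hH hN hS]
    · refine iff_of_false (fun hE => ?_) fun hE => ?_
      · exact hn' (hs'.trans hH (same_of_adj hH hE hs'.2.2.2.1 hS))
      · exact hn (hs.trans hH (same_of_adj hH hE hs.2.2.2.1 hS))
  have key : ∀ x ∈ I, ∀ y ∈ I, (x = y ↔ f' x = f' y) ∧ (G.E x y ↔ H.E (f' x) (f' y)) := by
    intro x hx y hy
    obtain ⟨p₁, p₂⟩ := hpi x hx y hy
    by_cases hsx : H.same c (f x) <;> by_cases hsy : H.same c (f y)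
    · have hi : x = y ↔ f' x = f' y :=
        ⟨congrArg f', fun he => hinj (mem_coe.2 (mem_touch.2 ⟨hx, hsx⟩))
          (mem_coe.2 (mem_touch.2 ⟨hy, hsy⟩)) he⟩
      refine ⟨hi, ?_⟩
      have hs' := ((h.same' x hx hsx).symm hH).trans hH (h.same' y hy hsy)
      have hs := (hsx.symm hH).trans hH hsy
      by_cases he : x = y
      · subst he
        exact iff_of_false (hG.irrefl _) (hH.irrefl _)
      · rw [p₂]
        exact iff_of_true (adj_of_same hs fun h' => he (p₁.2 h'))
          (adj_of_same hs' fun h' => he (hi.2 h'))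
    · obtain ⟨h₁, h₂⟩ := hmix x hx y hy hsx hsy
      refine ⟨iff_of_false ?_ h₁, p₂.trans h₂.symm⟩
      rintro rfl
      exact hsy hsx
    · obtain ⟨h₁, h₂⟩ := hmix y hy x hx hsy hsx
      refine ⟨iff_of_false ?_ h₁.symm, ?_⟩
      · rintro rfl
        exact hsx hsy
      · rw [p₂]
        exact ⟨fun h => hH.symm (h₂.2 (hH.symm h)), fun h => hH.symm (h₂.1 (hH.symm h))⟩
    · rw [h.eq x hx hsx, h.eq y hy hsy]
      exact ⟨p₁, p₂⟩
  refine ⟨fun p hp => ?_, fun p hp q hq => ?_⟩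
  · obtain ⟨hx, hy⟩ := mem_gph.1 hp
    have := hI.1 (p.1, f p.1) (mem_gph.2 ⟨hx, rfl⟩)
    refine ⟨this.1, ?_⟩
    rw [hy]
    by_cases hs : H.same c (f p.1)
    · exact (h.same' _ hx hs).2.1
    · rw [h.eq _ hx hs]
      exact this.2
  · obtain ⟨hx, hy⟩ := mem_gph.1 hp
    obtain ⟨hx', hy'⟩ := mem_gph.1 hq
    rw [hy, hy']
    exact key _ hx _ hx'

end Move

/-! ### Effect of a move on the value of the best extension -/

theorem sum_ite_lt_eq {n d : ℕ} (h : d ≤ n) : (∑ t ∈ range n, if t < d then 1 else 0) = d := by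
  rw [← card_filter]
  have : ({t ∈ range n | t < d} : Finset ℕ) = range d := by
    ext t
    simp only [mem_filter, mem_range]
    omega
  rw [this, card_range]

/-- The comparison of the two profiles that are affected by a move from a clique of size `c` to a
clique of size `c'`. -/
theorem move_sum_le {n a c c' d : ℕ} {p q r : ℕ → ℕ} (hp : ∀ t, p t = 0 ↔ d ≤ t) (hd : d ≤ n)
    (hac : a ≤ c) (hac' : a ≤ c')
    (h : d + a ≤ c' ∧ c' ≤ c ∨ c ≤ c' ∧ c' ≤ d + a ∨ c ≤ c' ∧ ∀ t, q t = 0) :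
    (∑ t ∈ range n, min (p t) (if t < c - a then 1 else 0)) +
        ∑ t ∈ range n, min (q t) (r t + if t < c' then 1 else 0) ≤
      (∑ t ∈ range n, min (p t) (if t < c' - a then 1 else 0)) +
        ∑ t ∈ range n, min (q t) (r t + if t < c then 1 else 0) := by
  rcases h with ⟨h₁, h₂⟩ | ⟨h₁, h₂⟩ | ⟨h₁, h₂⟩
  -- Both `c - a` and `c' - a` are at least `d`, where `p` is exhausted, so the first sum does not
  -- change; the second grows since `c' ≤ c`.
  · refine add_le_add (sum_le_sum fun t _ => ?_) (sum_le_sum fun t _ => ?_)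
    · have := hp t
      split_ifs <;> omega
    · split_ifs <;> omega
  -- Now `c - a` and `c' - a` are at most `d`, so the first sum has exactly these values and gains
  -- `c' - c`. The second loses at most one for each position in `[c, c')`.
  · have e : ∀ x ≤ d, (∑ t ∈ range n, min (p t) (if t < x then 1 else 0)) = x := by
      intro x hx
      refine Eq.trans (sum_congr rfl fun t _ => ?_) (sum_ite_lt_eq (hx.trans hd))
      have := hp t
      split_ifs <;> omega
    rw [e (c - a) (by omega), e (c' - a) (by omega)]
    have h₃ : ∑ t ∈ range n, min (q t) (r t + if t < c' then 1 else 0) ≤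
        ∑ t ∈ range n, (min (q t) (r t + if t < c then 1 else 0) +
          if t ∈ Ico c c' then 1 else 0) := by
      refine sum_le_sum fun t _ => ?_
      simp only [mem_Ico]
      split_ifs <;> omega
    rw [sum_add_distrib, ← card_filter (fun t => t ∈ Ico c c')] at h₃
    have h₄ : #{t ∈ range n | t ∈ Ico c c'} ≤ c' - c := by
      rw [← Nat.card_Ico]
      exact card_le_card fun t ht => (mem_filter.1 ht).2
    omega
  -- With no vertex of the second profile on the other side, the second sum vanishes and the first
  -- grows with the clique.
  · refine add_le_add (sum_le_sum fun t _ => ?_) (sum_le_sum fun t _ => ?_)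
    · have := hp t
      split_ifs <;> omega
    · have := h₂ t
      omega

theorem sum_le_sum_of_two {α : Type*} [DecidableEq α] {s : Finset α} {g g' : α → ℕ} {a b : α}
    (ha : a ∈ s) (hb : b ∈ s) (hab : a ≠ b) (h : g a + g b ≤ g' a + g' b)
    (ho : ∀ x, x ≠ a → x ≠ b → g x = g' x) : ∑ x ∈ s, g x ≤ ∑ x ∈ s, g' x := by
  have hb' : b ∈ s.erase a := mem_erase.2 ⟨hab.symm, hb⟩
  rw [← add_sum_erase s g ha, ← add_sum_erase s g' ha, ← add_sum_erase _ g hb',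
    ← add_sum_erase _ g' hb']
  have : ∑ x ∈ (s.erase a).erase b, g x = ∑ x ∈ (s.erase a).erase b, g' x :=
    sum_congr rfl fun x hx => ho x (mem_erase.1 (mem_erase.1 hx).2).1 (mem_erase.1 hx).1
  omega

variable {G H : Gr} {N : ℕ} {I : Finset ℕ} {f f' : ℕ → ℕ} {c c' : ℕ}

/-- Moving images to a clique whose size is suitable does not lower the value. -/
theorem Move.extVal_le (hH : H.Valid) (hN : H.n ≤ N) (h : Move H N I f f' c c')
    (hf : Set.InjOn f I) (hf' : Set.InjOn f' I) {d : ℕ} (hA : (H.touch I f c).Nonempty)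
    (hd : ∀ t, (G.labClass I id (H.baseProf I f c ∪ H.touch I f c, t)).Nonempty ↔ t < d)
    (hdn : d ≤ G.n) (hac' : #(H.touch I f c) ≤ H.size N c')
    (hc : d + #(H.touch I f c) ≤ H.size N c' ∧ H.size N c' ≤ H.size N c ∨
      H.size N c ≤ H.size N c' ∧ H.size N c' ≤ d + #(H.touch I f c) ∨
      H.size N c ≤ H.size N c' ∧ ∀ t, G.labClass I id (H.baseProf I f c, t) = ∅) :
    extVal G H I f ≤ extVal G H I f' := by
  classical
  set A := H.touch I f c with hAdef
  set p := H.baseProf I f c with hpdef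
  have s₁ : #(H.cl I f c) + #A = H.size N c := card_cl_add hN hf c
  have s₂ : #(H.cl I f' c') + #A = H.size N c' := by
    rw [← card_cl_add hN hf' c', hAdef, ← h.touch_eq]
    rfl
  have hcc : H.same c c' → c = c' := h.leader.eq_of_same hH hN h.leader'
  have b₁ : H.baseProf I f' c = p := h.baseProf_eq c
  have b₂ : H.baseProf I f c' = p := h.baseProf_sty hH hN
  have b₃ : H.baseProf I f' c' = p := (h.baseProf_eq c').trans b₂
  -- The images indexed by `A` are outside the cover, those indexed by `p` are in it.
  have hpA : p ∪ A ≠ p := by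
    obtain ⟨x, hx⟩ := hA
    intro he
    have hxp : x ∈ p := he ▸ mem_union_right p hx
    exact (mem_touch.1 hx).2.2.2.2.1 (mem_baseProf.1 hxp).2.1
  by_cases hne : c = c'
  · subst hne
    -- Images are only rearranged within their clique, and all label counts stay the same.
    refine sum_le_sum fun l _ => ?_
    rw [card_labClass_eq hH hcc l, card_labClass_eq (e := f') hH hcc l, h.restClass_eq hH,
      h.touch_eq, b₁, show #(H.cl I f' c) = #(H.cl I f c) by omega]
  · have t₁ : H.touch I f' c = ∅ := h.touch_old hH hN hne
    have t₂ : H.touch I f c' = ∅ := h.touch_new hne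
    have s₃ : #(H.cl I f c') = H.size N c' := by
      have := card_cl_add hN hf c'
      change #(H.cl I f c') + #(H.touch I f c') = _ at this
      rwa [t₂, card_empty, add_zero] at this
    have s₄ : #(H.cl I f' c) = H.size N c := by
      have := card_cl_add hN hf' c
      change #(H.cl I f' c) + #(H.touch I f' c) = _ at this
      rwa [t₁, card_empty, add_zero] at this
    have e₁ : ∀ l : Finset ℕ × ℕ, #(H.labClass I f l) = #(H.restClass I f c c' l) +
        (if l.1 = p ∪ A ∧ l.2 < H.size N c - #A then 1 else 0) +
        (if l.1 = p ∧ l.2 < H.size N c' then 1 else 0) := by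
      intro l
      rw [card_labClass_eq hH hcc l, if_neg hne, b₂, t₂, union_empty, s₃,
        show #(H.cl I f c) = H.size N c - #A by omega]
    have e₂ : ∀ l : Finset ℕ × ℕ, #(H.labClass I f' l) = #(H.restClass I f c c' l) +
        (if l.1 = p ∧ l.2 < H.size N c then 1 else 0) +
        (if l.1 = p ∪ A ∧ l.2 < H.size N c' - #A then 1 else 0) := by
      intro l
      rw [card_labClass_eq hH hcc l, if_neg hne, b₁, b₃, t₁, union_empty, s₄, h.restClass_eq hH,
        h.touch_eq, show #(H.cl I f' c') = H.size N c' - #A by omega]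
    -- A remaining vertex with this profile is adjacent to an image in the clique of `c`, so it
    -- belongs to that clique.
    have hrest : ∀ t, #(H.restClass I f c c' (p ∪ A, t)) = 0 := by
      intro t
      rw [card_eq_zero]
      refine eq_empty_of_forall_notMem fun v hv => ?_
      obtain ⟨hv, hn, -⟩ := mem_filter.1 hv
      obtain ⟨hr, hl⟩ := mem_labClass.1 hv
      obtain ⟨x, hx⟩ := hA
      have hxv : x ∈ H.prof I f v := by
        rw [show H.prof I f v = p ∪ A from congrArg Prod.fst hl]
        exact mem_union_right _ hx
      have hs := (mem_touch.1 hx).2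
      have := same_of_adj hH (mem_prof.1 hxv).2 (mem_rem.1 hr).2.1 hs.2.2.2.1
      exact hn (hs.trans hH (this.symm hH))
    have hpI : p ⊆ I := fun x hx => (mem_baseProf.1 hx).1
    have hAI : A ⊆ I := fun x hx => (mem_touch.1 hx).1
    rw [extVal, extVal, sum_product, sum_product]
    -- Only the profiles `p ∪ A` and `p` change; their sums over the positions are compared by
    -- `move_sum_le`.
    refine sum_le_sum_of_two (a := p ∪ A) (b := p) (mem_powerset.2 (union_subset hpI hAI))
      (mem_powerset.2 hpI) hpA ?_ ?_
    · simp only [e₁, e₂, hrest, hpA, hpA.symm, true_and, false_and, if_false, zero_add, add_zero]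
      refine move_sum_le (d := d) (fun t => ?_) hdn (by omega) hac' ?_
      · rw [card_eq_zero, ← not_nonempty_iff_eq_empty, hd t, not_lt]
      · simpa only [card_eq_zero] using hc
    · intro T h₁ h₂
      simp only [e₁, e₂, h₁, h₂, false_and, if_false]

end Gr

namespace Gr

/-! ### All special vertices can be taken from the pools -/

variable {G H : Gr} {N K : ℕ} {I : Finset ℕ} {f : ℕ → ℕ}

/-- The positions that occur with a given profile form an initial segment. -/
theorem exists_height (hG : G.Valid) (e : ℕ → ℕ) (T : Finset ℕ) :
    ∃ d ≤ G.n, ∀ t, (G.labClass I e (T, t)).Nonempty ↔ t < d := by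
  classical
  have hbd : ∀ t, (G.labClass I e (T, t)).Nonempty → t < G.n := by
    rintro t ⟨u, hu⟩
    obtain ⟨hu, hl⟩ := mem_labClass.1 hu
    have := rrk_lt_n hu
    rwa [show G.rrk I e u = t from congrArg Prod.snd hl] at this
  have hdown : ∀ s t, s ≤ t → (G.labClass I e (T, t)).Nonempty →
      (G.labClass I e (T, s)).Nonempty := by
    rintro s t hst ⟨u, hu⟩
    obtain ⟨hu, hl⟩ := mem_labClass.1 hu
    have h₁ := rrk_lt hu
    rw [show G.rrk I e u = t from congrArg Prod.snd hl] at h₁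
    obtain ⟨v, hv, hs, hr⟩ := exists_rrk_eq hG (hst.trans_lt h₁)
    refine ⟨v, mem_labClass.2 ⟨hv, Prod.ext ?_ hr⟩⟩
    exact (prof_eq_of_same hG hu hv hs).symm.trans (congrArg Prod.fst hl)
  have hex : ∃ t, ¬ (G.labClass I e (T, t)).Nonempty := ⟨G.n, fun h => (hbd _ h).false⟩
  refine ⟨Nat.find hex, Nat.find_min' hex fun h => (hbd _ h).false, fun t => ⟨fun h => ?_, ?_⟩⟩
  · by_contra hlt
    exact Nat.find_spec hex (hdown _ _ (not_lt.1 hlt) h)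
  · exact fun h => not_not.1 (Nat.find_min hex h)

open Classical in
theorem rk_eq_keyPos (hG : G.Valid) (hN : G.n ≤ N) {c v : ℕ} (hv : G.same c v) :
    G.rk N v = keyPos {w ∈ range G.n | G.same c w} id v := by
  rw [rk, cnt, keyPos, filter_filter]
  congr 1
  ext w
  simp only [mem_filter, mem_range, id]
  constructor
  · rintro ⟨-, h, hlt⟩
    exact ⟨h.2.1, hv.trans hG h, hlt⟩
  · rintro ⟨h, hs, hlt⟩
    exact ⟨h.trans_le hN, (hv.symm hG).trans hG hs, hlt⟩

open Classical in
theorem size_eq_card (hN : G.n ≤ N) (c : ℕ) : G.size N c = #{w ∈ range G.n | G.same c w} := by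
  rw [size, cnt]
  congr 1
  ext w
  simp only [mem_filter, mem_range]
  exact ⟨fun h => ⟨h.2.2.1, h.2⟩, fun h => ⟨h.1.trans_le hN, h.2⟩⟩

/-- A set can be mapped injectively to the first vertices of a clique. -/
theorem exists_first_vertices (hG : G.Valid) (hN : G.n ≤ N) {A : Finset ℕ} {c : ℕ}
    (h : #A ≤ G.size N c) :
    ∃ m : ℕ → ℕ, Set.InjOn m A ∧ ∀ x ∈ A, G.same c (m x) ∧ G.rk N (m x) < #A := by
  classical
  have key : ∀ x ∈ A, ∃ v ∈ ({w ∈ range G.n | G.same c w} : Finset ℕ),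
      keyPos {w ∈ range G.n | G.same c w} id v = keyPos A id x := by
    intro x hx
    refine exists_keyPos_eq Function.injective_id.injOn ((keyPos_lt_card hx).trans_le ?_)
    rwa [← size_eq_card hN]
  choose! m hm hk using key
  refine ⟨m, fun x hx y hy h => ?_, fun x hx => ?_⟩
  · refine keyPos_injOn (X := A) (key := id) Function.injective_id.injOn hx hy ?_
    rw [← hk x (mem_coe.1 hx), ← hk y (mem_coe.1 hy), h]
  · have hs := (mem_filter.1 (hm x hx)).2
    refine ⟨hs, ?_⟩
    rw [rk_eq_keyPos hG hN hs, hk x hx]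
    exact keyPos_lt_card hx

theorem injOn_of_isPI (hI : IsPI G H (gph I f)) : Set.InjOn f I := fun x hx y hy h =>
  (hI.2 (x, f x) (mem_gph.2 ⟨hx, rfl⟩) (y, f y) (mem_gph.2 ⟨hy, rfl⟩)).1.2 h

/-- A clique that is not touched has a profile determined by its type. -/
theorem prof_eq_of_sty (hG : G.Valid) (hN : G.n ≤ N) {u v : ℕ} (hu : u ∈ G.rem I id)
    (hv : v ∈ G.rem I id) (hsty : G.sty N u v) (htu : ∀ x ∈ I, ¬ G.same u x)
    (htv : ∀ x ∈ I, ¬ G.same v x) : G.prof I id u = G.prof I id v := by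
  ext x
  simp only [mem_prof, id]
  refine and_congr_right fun hx => ?_
  by_cases hS : G.S x
  · exact hsty.iff hG hN hS
  · exact iff_of_false (fun h => htu x hx (same_of_adj hG h (mem_rem.1 hu).2.1 hS))
      fun h => htv x hx (same_of_adj hG h (mem_rem.1 hv).2.1 hS)

/-- A largest clique with a given profile is one of the largest of its type, if no clique with this
profile is touched. -/
theorem exists_top (hG : G.Valid) (hN : G.n ≤ N) (hK : #I < K) {T : Finset ℕ} {d : ℕ}
    (hd : ∀ t, (G.labClass I id (T, t)).Nonempty ↔ t < d) (hpos : 0 < d)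
    (hun : ∀ u ∈ G.rem I id, G.prof I id u = T → ∀ x ∈ I, ¬ G.same u x) :
    ∃ w, G.top N K w ∧ G.size N w = d := by
  classical
  have hsize : ∀ w, (∀ x ∈ I, ¬ G.same w x) → #(G.cl I id w) = G.size N w := by
    intro w hw
    have := card_cl_add (e := id) hN (Function.injective_id.injOn (s := (I : Set ℕ))) w
    rwa [filter_false_of_mem (p := fun x => G.same w (id x)) (fun x hx => hw x hx), card_empty,
      add_zero] at this
  -- A vertex at the last occurring position lies in a clique whose remaining part has exactly `d`
  -- vertices; being untouched, the clique is of size `d`.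
  obtain ⟨u, hu⟩ := (hd (d - 1)).2 (by omega)
  obtain ⟨hu, hl⟩ := mem_labClass.1 hu
  have hpu : G.prof I id u = T := congrArg Prod.fst hl
  have hru : G.rrk I id u = d - 1 := congrArg Prod.snd hl
  have huu := hun u hu hpu
  have hcl : #(G.cl I id u) = d := by
    have h₁ := rrk_lt hu
    by_contra hne
    obtain ⟨v, hv, hs, hr⟩ := exists_rrk_eq hG (u := u) (I := I) (e := id) (t := d) (by omega)
    have : (G.labClass I id (T, d)).Nonempty :=
      ⟨v, mem_labClass.2 ⟨hv, Prod.ext ((prof_eq_of_same hG hu hv hs).symm.trans hpu) hr⟩⟩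
    exact absurd ((hd d).1 this) (lt_irrefl d)
  obtain ⟨w, hw, hwu⟩ := exists_leader (N := N) hG (same_self_of_mem_rem hu)
  have hww : ∀ x ∈ I, ¬ G.same w x := fun x hx h => huu x hx ((hwu.symm hG).trans hG h)
  have hsw : G.size N w = d := by rw [← hsize w hww, cl_eq_of_same hG hwu, hcl]
  refine ⟨w, ⟨hw, lt_of_le_of_lt ?_ hK⟩, hsw⟩
  -- An untouched larger clique of the same type would also have profile `T`, and so a vertex at
  -- position `d`, which does not occur. Hence all larger cliques of the type are touched.
  refine cnt_touched_le (e := id) hG hN fun w' hw' => ⟨hw'.1, ?_⟩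
  by_contra hcon
  push Not at hcon
  have h₂ := hw'.2.2
  rw [hsw, ← hsize w' hcon] at h₂
  obtain ⟨v, hv, hs, hr⟩ := exists_rrk_eq hG h₂
  have hvu : G.sty N u v := fun s _ hS => by
    rw [← adj_S_iff_of_same hG hwu hS, ← adj_S_iff_of_same hG hs hS, hw'.2.1.iff hG hN hS]
  have hpv : G.prof I id v = T := by
    rw [← prof_eq_of_sty hG hN hu hv hvu huu fun x hx h => hcon x hx (hs.trans hG h), hpu]
  exact absurd ((hd d).1 ⟨v, mem_labClass.2 ⟨hv, Prod.ext hpv hr⟩⟩) (lt_irrefl d)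

/-- An image outside the pool can be moved into the pool without lowering the value. -/
theorem exists_better (hG : G.Valid) (hH : H.Valid) (hGN : G.n < N) (hHN : H.n < N)
    (hK : #I < K) (hI : IsPI G H (gph I f)) (hsp : ∀ x ∈ I, G.S x ∨ H.S (f x)) {x₀ : ℕ}
    (hx₀ : x₀ ∈ I) (hbad : ¬ H.pool N K G (f x₀)) :
    ∃ f', IsPI G H (gph I f') ∧ (∀ x ∈ I, G.S x ∨ H.S (f' x)) ∧
      extVal G H I f ≤ extVal G H I f' ∧
      (∀ x ∈ I, H.pool N K G (f x) → H.pool N K G (f' x)) ∧ H.pool N K G (f' x₀) := by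
  classical
  have hS₀ : ¬ H.S (f x₀) := fun h => hbad (.inl h)
  obtain ⟨c, hc, hcx⟩ := exists_leader (N := N) hH
    (same_refl (hI.1 (x₀, f x₀) (mem_gph.2 ⟨hx₀, rfl⟩)).2 hS₀)
  have hx₀A : x₀ ∈ H.touch I f c := mem_touch.2 ⟨hx₀, hcx⟩
  -- Since all pairs are special, images outside the cover of `H` come from the cover of `G`.
  have hAS : ∀ x ∈ H.touch I f c, G.S x := fun x hx =>
    (hsp x (mem_touch.1 hx).1).resolve_right (mem_touch.1 hx).2.2.2.2.1
  have haI : #(H.touch I f c) ≤ #I := card_le_card fun x hx => (mem_touch.1 hx).1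
  have hfinj := injOn_of_isPI hI
  have hac : #(H.touch I f c) ≤ H.size N c := by
    have : #(H.cl I f c) + #(H.touch I f c) = _ := card_cl_add hHN.le hfinj c
    omega
  have hsc : ∀ w, H.size N w ≤ H.n := size_le hHN.le
  obtain ⟨d, hdn, hd⟩ :=
    exists_height (I := I) hG id (H.baseProf I f c ∪ H.touch I f c)
  have hthr : ∃ θ, (∀ c', H.leader N c' → H.near N K θ c' → H.candLeader N K G c') ∧
      (θ = d + #(H.touch I f c) ∨
        θ = N ∧ ∀ t, G.labClass I id (H.baseProf I f c, t) = ∅) := by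
    by_cases hB : ∃ u ∈ G.rem I id, G.prof I id u = H.baseProf I f c ∪ H.touch I f c ∧
        ∃ x ∈ I, G.same u x
    · obtain ⟨u, hu, hpu, x, hx, hux⟩ := hB
      -- Here a clique of `G` with profile `p ∪ A` is touched by some `x` outside the cover, and `x`
      -- must be in `p`. A vertex of `G` with profile `p` is then adjacent to `x`, so it is in the
      -- same clique and has profile `p ∪ A`, which contains `x₀`; but `x₀` is not in `p`. So
      -- profile `p` does not occur in `G`, and the threshold `N`, above all sizes, asks for a
      -- clique at least as large.
      refine ⟨N, fun c' h₁ h₂ => ⟨h₁, .inl h₂⟩, .inr ⟨rfl, fun t => ?_⟩⟩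
      have hSx : ¬ G.S x := hux.2.2.2.1
      have hux' : G.E u x := adj_of_same hux fun h => (mem_rem.1 hu).2.2 x hx h.symm
      have hxp : x ∈ H.baseProf I f c := by
        have : x ∈ G.prof I id u := mem_prof.2 ⟨hx, hux'⟩
        rw [hpu] at this
        exact (mem_union.1 this).resolve_right fun h => hSx (hAS x h)
      refine eq_empty_of_forall_notMem fun v hv => ?_
      obtain ⟨hv, hl⟩ := mem_labClass.1 hv
      have hpv : G.prof I id v = H.baseProf I f c := congrArg Prod.fst hl
      have hvx : G.E v x := (mem_prof.1 (hpv ▸ hxp)).2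
      have hvu : G.same v u :=
        (same_of_adj hG hvx (mem_rem.1 hv).2.1 hSx).trans hG (hux.symm hG)
      have : x₀ ∈ H.baseProf I f c := by
        rw [← hpv, prof_eq_of_same hG hv hu hvu, hpu]
        exact mem_union_right _ hx₀A
      exact hS₀ (mem_baseProf.1 this).2.1
    · push Not at hB
      -- No clique of `G` with profile `p ∪ A` is touched. Then `d` is zero or the size of a top
      -- clique, and the threshold is one of those listed in `candLeader`.
      refine ⟨d + #(H.touch I f c), fun c' h₁ h₂ => ⟨h₁, .inr ?_⟩, .inl rfl⟩
      have haN : #(H.touch I f c) < N := (hac.trans (hsc c)).trans_lt hHN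
      rcases Nat.eq_zero_or_pos d with h0 | hpos
      · rw [h0, zero_add] at h₂
        exact .inl ⟨_, haN, haI.trans_lt hK, h₂⟩
      · obtain ⟨w, hw, hsw⟩ := exists_top hG hGN.le hK hd hpos hB
        exact .inr ⟨w, hw.1.1.1.trans hGN, _, haN, hw, haI.trans_lt hK, hsw ▸ h₂⟩
  obtain ⟨θ, hcand, hθ⟩ := hthr
  obtain ⟨c', hc', hsty, hun, hnear, hside⟩ := exists_near (e := f) hH hHN.le hK hc θ
  have hcond : d + #(H.touch I f c) ≤ H.size N c' ∧ H.size N c' ≤ H.size N c ∨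
      H.size N c ≤ H.size N c' ∧ H.size N c' ≤ d + #(H.touch I f c) ∨
      H.size N c ≤ H.size N c' ∧ ∀ t, G.labClass I id (H.baseProf I f c, t) = ∅ := by
    rcases hθ with rfl | ⟨rfl, h0⟩
    · rcases hside with h | h
      · exact .inl h
      · exact .inr (.inl h)
    · have := hsc c'
      exact .inr (.inr ⟨by omega, h0⟩)
  have hac' : #(H.touch I f c) ≤ H.size N c' := by
    rcases hcond with h | h | h <;> omega
  -- The images go to the first vertices of `c'`, whose positions are below `K`, as the definition
  -- of `cand` requires.
  obtain ⟨m, hminj, hm⟩ := exists_first_vertices hH hHN.le hac'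
  let f' : ℕ → ℕ := fun x => if x ∈ H.touch I f c then m x else f x
  have hf'm : ∀ x ∈ H.touch I f c, f' x = m x := fun x hx => if_pos hx
  have hf'f : ∀ x ∉ H.touch I f c, f' x = f x := fun x hx => if_neg hx
  have hmove : Move H N I f f' c c' := by
    refine ⟨hc, hc', hsty, hun, fun x hx hn => ?_, fun x hx hs => ?_⟩
    · exact hf'f x fun h => hn (mem_touch.1 h).2
    · have := mem_touch.2 ⟨hx, hs⟩
      rw [hf'm x this]
      exact (hm x this).1
  have hpi' := hmove.isPI hG hH hHN.le (fun x hx y hy h => hminj hx hy (by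
    rwa [hf'm x (mem_coe.1 hx), hf'm y (mem_coe.1 hy)] at h)) hI
  have hpool : ∀ x ∈ H.touch I f c, H.pool N K G (f' x) := by
    intro x hx
    rw [hf'm x hx]
    obtain ⟨hs, hr⟩ := hm x hx
    exact .inr ⟨hr.trans (haI.trans_lt hK), c', hc'.1.1.trans hHN, hs, hcand c' hc' hnear⟩
  refine ⟨f', hpi', fun x hx => ?_, ?_, fun x hx h => ?_, hpool x₀ hx₀A⟩
  · by_cases hxA : x ∈ H.touch I f c
    · exact .inl (hAS x hxA)
    · rw [hf'f x hxA]
      exact hsp x hx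
  · exact hmove.extVal_le hH hHN.le hfinj (injOn_of_isPI hpi') ⟨x₀, hx₀A⟩ hd hdn hac' hcond
  · by_cases hxA : x ∈ H.touch I f c
    · exact hpool x hxA
    · rwa [hf'f x hxA]

/-- Repeat the exchange; the number of images outside the pool drops each time, since images already
in the pool stay in it. -/
theorem exists_all_pool (hG : G.Valid) (hH : H.Valid) (hGN : G.n < N) (hHN : H.n < N)
    (hK : #I < K) (hI : IsPI G H (gph I f)) (hsp : ∀ x ∈ I, G.S x ∨ H.S (f x)) :
    ∃ f', IsPI G H (gph I f') ∧ extVal G H I f ≤ extVal G H I f' ∧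
      ∀ x ∈ I, H.pool N K G (f' x) := by
  classical
  induction hn : #{x ∈ I | ¬ H.pool N K G (f x)} using Nat.strong_induction_on
    generalizing f with
  | _ n ih =>
    by_cases hall : ∀ x ∈ I, H.pool N K G (f x)
    · exact ⟨f, hI, le_rfl, hall⟩
    push Not at hall
    obtain ⟨x₀, hx₀, hbad⟩ := hall
    obtain ⟨f₁, hI₁, hsp₁, hle, hmono, hgood⟩ := exists_better hG hH hGN hHN hK hI hsp hx₀ hbad
    obtain ⟨f₂, hI₂, hle₂, hall₂⟩ := ih _ (by
      rw [← hn]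
      refine card_lt_card ⟨fun x hx => ?_, fun hsub => ?_⟩
      · obtain ⟨hx, hp⟩ := mem_filter.1 hx
        exact mem_filter.2 ⟨hx, fun h => hp (hmono x hx h)⟩
      · exact (mem_filter.1 (hsub (mem_filter.2 ⟨hx₀, hbad⟩))).2 hgood) hI₁ hsp₁ rfl
    exact ⟨f₂, hI₂, hle.trans hle₂, hall₂⟩

/-! ### Special pairs and restriction to the pools on both sides -/

/-- A pair with a vertex in one of the twin covers. -/
def Special (G H : Gr) (p : ℕ × ℕ) : Prop := G.S p.1 ∨ H.S p.2

theorem IsPI.injOn_fst {φ : Finset (ℕ × ℕ)} (h : IsPI G H φ) : Set.InjOn Prod.fst (φ : Set (ℕ × ℕ)) :=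
  fun p hp q hq e => Prod.ext e ((h.2 p hp q hq).1.1 e)

theorem IsPI.injOn_snd {φ : Finset (ℕ × ℕ)} (h : IsPI G H φ) : Set.InjOn Prod.snd (φ : Set (ℕ × ℕ)) :=
  fun p hp q hq e => Prod.ext ((h.2 p hp q hq).1.2 e) e

-- Either coordinate determines a pair, so each cover vertex accounts for at most one.
open Classical in
theorem IsPI.card_special_le {φ : Finset (ℕ × ℕ)} (h : IsPI G H φ) (hGN : G.n ≤ N)
    (hHN : H.n ≤ N) : #{p ∈ φ | Special G H p} ≤ cnt N G.S + cnt N H.S := by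
  have hsub : ({p ∈ φ | Special G H p} : Finset (ℕ × ℕ)) ⊆
      {p ∈ φ | G.S p.1} ∪ {p ∈ φ | H.S p.2} := by
    intro p hp
    obtain ⟨hp, hs⟩ := mem_filter.1 hp
    rcases hs with hs | hs
    · exact mem_union_left _ (mem_filter.2 ⟨hp, hs⟩)
    · exact mem_union_right _ (mem_filter.2 ⟨hp, hs⟩)
  refine (card_le_card hsub).trans ((card_union_le _ _).trans (add_le_add ?_ ?_))
  · refine card_le_card_of_injOn Prod.fst (fun p hp => ?_)
      (h.injOn_fst.mono fun p hp => (mem_filter.1 (mem_coe.1 hp)).1)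
    obtain ⟨hp, hs⟩ := mem_filter.1 (mem_coe.1 hp)
    exact mem_coe.2 (mem_filter.2 ⟨mem_range.2 ((h.1 p hp).1.trans_le hGN), hs⟩)
  · refine card_le_card_of_injOn Prod.snd (fun p hp => ?_)
      (h.injOn_snd.mono fun p hp => (mem_filter.1 (mem_coe.1 hp)).1)
    obtain ⟨hp, hs⟩ := mem_filter.1 (mem_coe.1 hp)
    exact mem_coe.2 (mem_filter.2 ⟨mem_range.2 ((h.1 p hp).2.trans_le hHN), hs⟩)

open Classical in
/-- The special pairs of a partial isomorphism are the graph of a partial function, and the other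
pairs are an extension by vertices outside the twin covers. -/
theorem IsPI.exists_special {φ : Finset (ℕ × ℕ)} (h : IsPI G H φ) :
    ∃ I f, gph I f = {p ∈ φ | Special G H p} ∧
      (∀ p ∈ ({p ∈ φ | ¬ Special G H p} : Finset (ℕ × ℕ)), p.1 ∈ G.rem I id ∧ p.2 ∈ H.rem I f) := by
  have key : ∀ x ∈ ({p ∈ φ | Special G H p} : Finset (ℕ × ℕ)).image Prod.fst,
      ∃ y, (x, y) ∈ φ ∧ Special G H (x, y) := by
    intro x hx
    obtain ⟨p, hp, rfl⟩ := mem_image.1 hx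
    exact ⟨p.2, (mem_filter.1 hp).1, (mem_filter.1 hp).2⟩
  choose! f hf hs using key
  have hmem : ∀ p, p ∈ gph (({p ∈ φ | Special G H p} : Finset (ℕ × ℕ)).image Prod.fst) f ↔
      p ∈ ({p ∈ φ | Special G H p} : Finset (ℕ × ℕ)) := by
    intro p
    rw [mem_gph]
    constructor
    · rintro ⟨h₁, h₂⟩
      have : p = (p.1, f p.1) := Prod.ext rfl h₂
      rw [this]
      exact mem_filter.2 ⟨hf _ h₁, hs _ h₁⟩
    · intro hp
      have h₁ := mem_image_of_mem Prod.fst hp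
      refine ⟨h₁, ?_⟩
      exact (h.2 p (mem_filter.1 hp).1 _ (hf _ h₁)).1.1 rfl
  refine ⟨_, f, ext hmem, fun p hp => ?_⟩
  obtain ⟨hp, hns⟩ := mem_filter.1 hp
  obtain ⟨h₁, h₂⟩ := not_or.1 hns
  refine ⟨mem_rem.2 ⟨(h.1 p hp).1, h₁, fun x hx he => ?_⟩,
    mem_rem.2 ⟨(h.1 p hp).2, h₂, fun x hx he => ?_⟩⟩
  · have : p = (x, f x) := h.injOn_fst hp (hf x hx) he.symm
    exact hns (this ▸ hs x hx)
  · have : p = (x, f x) := h.injOn_snd hp (hf x hx) he.symm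
    exact hns (this ▸ hs x hx)

/-- The special part is moved into the pool of `H` and then extended optimally, which adds no
special pairs. That the first coordinates come from special pairs of `φ` is recorded for the second
application with the graphs exchanged. -/
theorem exists_pool_right (hG : G.Valid) (hH : H.Valid) (hGN : G.n < N) (hHN : H.n < N)
    (hK : cnt N G.S + cnt N H.S < K) {φ : Finset (ℕ × ℕ)} (h : IsPI G H φ) :
    ∃ φ', IsPI G H φ' ∧ #φ ≤ #φ' ∧ ∀ p ∈ φ', Special G H p →
      H.pool N K G p.2 ∧ ∃ q ∈ φ, Special G H q ∧ q.1 = p.1 := by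
  classical
  obtain ⟨I, f, hgph, hrem⟩ := h.exists_special
  have hmem : ∀ x ∈ I, (x, f x) ∈ φ ∧ Special G H (x, f x) := fun x hx => by
    have : (x, f x) ∈ gph I f := mem_gph.2 ⟨hx, rfl⟩
    rw [hgph] at this
    exact mem_filter.1 this
  have hI : IsPI G H (gph I f) := by
    rw [hgph]
    exact ⟨fun p hp => h.1 p (mem_filter.1 hp).1,
      fun p hp q hq => h.2 p (mem_filter.1 hp).1 q (mem_filter.1 hq).1⟩
  have hIK : #I < K := by
    rw [← card_gph I f, hgph]
    exact (h.card_special_le hGN.le hHN.le).trans_lt hK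
  have hφ : φ = gph I f ∪ {p ∈ φ | ¬ Special G H p} := by
    rw [hgph, filter_union_filter_not_eq]
  have hle : #φ ≤ #I + extVal G H I f := by
    have h₁ := card_ext_le hG hH hrem (hφ ▸ h)
    have h₂ := card_union_le (gph I f) {p ∈ φ | ¬ Special G H p}
    rw [← hφ, card_gph] at h₂
    omega
  obtain ⟨f', hI', hle', hpool⟩ := exists_all_pool hG hH hGN hHN hIK hI fun x hx => (hmem x hx).2
  obtain ⟨ψ, hψ, hpi, hcard⟩ := exists_ext hG hH hI'
  refine ⟨_, hpi, by omega, fun p hp hs => ?_⟩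
  rcases mem_union.1 hp with hp | hp
  · obtain ⟨hx, hy⟩ := mem_gph.1 hp
    exact ⟨hy ▸ hpool _ hx, _, (hmem _ hx).1, (hmem _ hx).2, rfl⟩
  · obtain ⟨h₁, h₂⟩ := hψ p hp
    rcases hs with hs | hs
    · exact absurd hs (mem_rem.1 h₁).2.1
    · exact absurd hs (mem_rem.1 h₂).2.1

theorem IsPI.swap {φ : Finset (ℕ × ℕ)} (h : IsPI G H φ) :
    IsPI H G (φ.image Prod.swap) := by
  refine ⟨fun p hp => ?_, fun p hp q hq => ?_⟩
  · obtain ⟨p', hp', rfl⟩ := mem_image.1 hp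
    exact (h.1 p' hp').symm
  · obtain ⟨p', hp', rfl⟩ := mem_image.1 hp
    obtain ⟨q', hq', rfl⟩ := mem_image.1 hq
    exact ⟨(h.2 p' hp' q' hq').1.symm, (h.2 p' hp' q' hq').2.symm⟩

/-- Every partial isomorphism is at most as large as one that is given by a partial function
between the pools and its largest extension. -/
theorem exists_pool_map (hG : G.Valid) (hH : H.Valid) (hGN : G.n < N) (hHN : H.n < N)
    (hK : cnt N G.S + cnt N H.S < K) {φ : Finset (ℕ × ℕ)} (h : IsPI G H φ) :
    ∃ I f, IsPI G H (gph I f) ∧ (∀ x ∈ I, G.pool N K H x ∧ H.pool N K G (f x)) ∧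
      #φ ≤ #I + extVal G H I f := by
  classical
  obtain ⟨φ₁, h₁, c₁, p₁⟩ := exists_pool_right hG hH hGN hHN hK h
  -- The second pass changes only the vertices of `G`: the vertices of `H` in special pairs come
  -- from special pairs of `φ₁`, so they stay in their pool.
  obtain ⟨φ₂, h₂, c₂, p₂⟩ := exists_pool_right hH hG hHN hGN (K := K)
    (by rwa [add_comm]) h₁.swap
  rw [card_image_of_injective _ Prod.swap_injective] at c₂
  have h₃ := h₂.swap
  have c₃ : #(φ₂.image Prod.swap) = #φ₂ := card_image_of_injective _ Prod.swap_injective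
  have p₃ : ∀ p ∈ φ₂.image Prod.swap, Special G H p →
      G.pool N K H p.1 ∧ H.pool N K G p.2 := by
    intro p hp hs
    obtain ⟨q, hq, rfl⟩ := mem_image.1 hp
    obtain ⟨hq₁, r, hr, hrs, hrq⟩ := p₂ q hq hs.symm
    obtain ⟨r', hr', rfl⟩ := mem_image.1 hr
    refine ⟨hq₁, ?_⟩
    have := (p₁ r' hr' hrs.symm).1
    rwa [show r'.2 = q.swap.2 from hrq] at this
  generalize φ₂.image Prod.swap = φ₃ at h₃ c₃ p₃
  obtain ⟨I, f, hgph, hrem⟩ := h₃.exists_special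
  have hmem : ∀ x ∈ I, (x, f x) ∈ φ₃ ∧ Special G H (x, f x) := fun x hx => by
    have : (x, f x) ∈ gph I f := mem_gph.2 ⟨hx, rfl⟩
    rw [hgph] at this
    exact mem_filter.1 this
  have hφ : φ₃ = gph I f ∪ {p ∈ φ₃ | ¬ Special G H p} := by
    rw [hgph, filter_union_filter_not_eq]
  refine ⟨I, f, ?_, fun x hx => p₃ _ (hmem x hx).1 (hmem x hx).2, ?_⟩
  · rw [hgph]
    exact ⟨fun p hp => h₃.1 p (mem_filter.1 hp).1,
      fun p hp q hq => h₃.2 p (mem_filter.1 hp).1 q (mem_filter.1 hq).1⟩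
  · have h₄ := card_ext_le hG hH hrem (hφ ▸ h₃)
    have h₅ := card_union_le (gph I f) {p ∈ φ₃ | ¬ Special G H p}
    rw [← hφ, card_gph] at h₅
    omega

end Gr

namespace Gr

/-! ### The value in terms of bounded counting -/

section defs

variable (G H : Gr) (N : ℕ) (D : ℕ → Prop) (R : ℕ → ℕ → Prop)

/-- `u` is outside the twin cover and not taken out. -/
def remC (u : ℕ) : Prop := u < G.n ∧ ¬ G.S u ∧ ¬ D u

/-- The position in the remaining part of the clique. -/
noncomputable def rrkC (u : ℕ) : ℕ := cnt N fun v => (G.remC D v ∧ G.same u v) ∧ v < u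

/-- The domain of a relation. -/
def domC (x : ℕ) : Prop := Bex N fun y => R x y

/-- The range of a relation. -/
def ranC (y : ℕ) : Prop := Bex N fun x => R x y

/-- The relation is a partial isomorphism. -/
def piC : Prop := Ball N fun x => Ball N fun y => Ball N fun u => Ball N fun v =>
  R x y ∧ R u v → (x = u ↔ y = v) ∧ (G.E x u ↔ H.E y v)

/-- Two vertices of the first graph have the same label. -/
def labC (u v : ℕ) : Prop :=
  (Ball N fun x => domC N R x → (G.E u x ↔ G.E v x)) ∧
    G.rrkC N (domC N R) u = G.rrkC N (domC N R) v

/-- A vertex of the first graph and one of the second have the same label. -/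
def labC₂ (u v : ℕ) : Prop :=
  (Ball N fun x => Ball N fun y => R x y → (G.E u x ↔ H.E v y)) ∧
    G.rrkC N (domC N R) u = H.rrkC N (ranC N R) v

/-- The vertex `u` is matched in a largest extension, when the vertices with the same label are
matched in their order. -/
def hitC (u : ℕ) : Prop :=
  G.remC (domC N R) u ∧
    cnt N (fun v => (G.remC (domC N R) v ∧ G.labC N R v u) ∧ v < u) <
      cnt N fun v => H.remC (ranC N R) v ∧ labC₂ G H N R u v

/-- The size of a largest extension of the relation. -/
noncomputable def valC : ℕ := cnt N (domC N R) + cnt N (hitC G H N R)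

end defs

variable {G H : Gr} {N K : ℕ} {I : Finset ℕ} {e f : ℕ → ℕ} {D : ℕ → Prop} {R : ℕ → ℕ → Prop}

theorem remC_iff (hD : ∀ u < N, D u ↔ ∃ x ∈ I, e x = u) (hN : G.n ≤ N) {u : ℕ} :
    G.remC D u ↔ u ∈ G.rem I e := by
  rw [remC, mem_rem]
  refine and_congr_right fun h => and_congr_right fun _ => ?_
  rw [hD u (h.trans_le hN)]
  push Not
  rfl

theorem rrkC_eq (hD : ∀ u < N, D u ↔ ∃ x ∈ I, e x = u) (hN : G.n ≤ N) (u : ℕ) :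
    G.rrkC N D u = G.rrk I e u := by
  classical
  rw [rrkC, rrk, cnt, keyPos, cl, filter_filter]
  congr 1
  ext v
  simp only [mem_filter, mem_range, id, remC_iff hD hN]
  constructor
  · rintro ⟨-, ⟨h₁, h₂⟩, h₃⟩
    exact ⟨h₁, h₂, h₃⟩
  · rintro ⟨h₁, h₂, h₃⟩
    exact ⟨h₂.2.1.trans_le hN, ⟨h₁, h₂⟩, h₃⟩

/-- The minimum of two class sizes is the number of elements of the first class at a position below
the size of the second. Any order serves for this count, so the vertices are ordered by their
numbers instead of `clKey`. -/
theorem extVal_eq_card :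
    extVal G H I f = #{u ∈ G.rem I id | keyPos (G.labClass I id (G.lab I id u)) id u <
      #(H.labClass I f (G.lab I id u))} := by
  classical
  rw [extVal, card_eq_sum_card_fiberwise (f := G.lab I id) (t := I.powerset ×ˢ range G.n)
    fun u hu => mem_coe.2 (lab_mem (mem_filter.1 (mem_coe.1 hu)).1)]
  refine sum_congr rfl fun l _ => ?_
  rw [← card_keyPos_lt (X := G.labClass I id l) (key := id) Function.injective_id.injOn]
  congr 1
  ext u
  simp only [mem_filter, mem_labClass]
  constructor
  · rintro ⟨⟨h₁, rfl⟩, h₂⟩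
    exact ⟨⟨h₁, h₂⟩, rfl⟩
  · rintro ⟨⟨h₁, h₂⟩, rfl⟩
    exact ⟨⟨h₁, rfl⟩, h₂⟩

/-- The value computed by bounded counting is the maximum size of an extension. -/
theorem valC_eq (hGN : G.n ≤ N) (hHN : H.n ≤ N) (hR : ∀ x < N, ∀ y < N, R x y ↔ x ∈ I ∧ y = f x)
    (hI : ∀ x ∈ I, x < N ∧ f x < N) : valC G H N R = #I + extVal G H I f := by
  classical
  have hdom : ∀ x < N, domC N R x ↔ x ∈ I := fun x hx => by
    constructor
    · rintro ⟨y, hy, h⟩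
      exact ((hR x hx y hy).1 h).1
    · exact fun h => ⟨f x, (hI x h).2, (hR x hx _ (hI x h).2).2 ⟨h, rfl⟩⟩
  have hran : ∀ y < N, ranC N R y ↔ ∃ x ∈ I, f x = y := fun y hy => by
    constructor
    · rintro ⟨x, hx, h⟩
      exact ⟨x, ((hR x hx y hy).1 h).1, ((hR x hx y hy).1 h).2.symm⟩
    · rintro ⟨x, hx, rfl⟩
      exact ⟨x, (hI x hx).1, (hR x (hI x hx).1 _ hy).2 ⟨hx, rfl⟩⟩
  have hdom' : ∀ u < N, domC N R u ↔ ∃ x ∈ I, id x = u := fun u hu => by simp [hdom u hu]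
  have hlab : ∀ u v, G.labC N R v u ↔ G.lab I id v = G.lab I id u := by
    intro u v
    rw [labC, rrkC_eq hdom' hGN, rrkC_eq hdom' hGN, lab, lab, Prod.mk.injEq]
    refine and_congr_left fun _ => ?_
    rw [Finset.ext_iff]
    simp only [mem_prof, id]
    constructor
    · exact fun h x => and_congr_right fun hx => h x (hI x hx).1 ((hdom x (hI x hx).1).2 hx)
    · intro h x hx hd
      have := h x
      simpa [(hdom x hx).1 hd] using this
  have hlab₂ : ∀ u v, labC₂ G H N R u v ↔ H.lab I f v = G.lab I id u := by
    intro u v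
    rw [labC₂, rrkC_eq hdom' hGN, rrkC_eq hran hHN, eq_comm (a := H.lab I f v), lab, lab,
      Prod.mk.injEq]
    refine and_congr_left fun _ => ?_
    rw [Finset.ext_iff]
    simp only [mem_prof, id]
    constructor
    · exact fun h x => and_congr_right fun hx => h x (hI x hx).1 (f x) (hI x hx).2
        ((hR x (hI x hx).1 _ (hI x hx).2).2 ⟨hx, rfl⟩)
    · intro h x hx y hy hr
      obtain ⟨hxI, rfl⟩ := (hR x hx y hy).1 hr
      have := h x
      simpa [hxI] using this
  rw [valC, extVal_eq_card]
  congr 1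
  · rw [cnt]
    congr 1
    ext x
    simp only [mem_filter, mem_range]
    exact ⟨fun h => (hdom x h.1).1 h.2, fun h => ⟨(hI x h).1, (hdom x (hI x h).1).2 h⟩⟩
  · rw [cnt]
    congr 1
    ext u
    simp only [mem_filter, mem_range, hitC, remC_iff hdom' hGN]
    have h₁ : cnt N (fun v => (v ∈ G.rem I id ∧ G.labC N R v u) ∧ v < u) =
        keyPos (G.labClass I id (G.lab I id u)) id u := by
      rw [cnt, keyPos, labClass, filter_filter]
      congr 1
      ext v
      simp only [mem_filter, mem_range, id, hlab]
      constructor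
      · rintro ⟨-, ⟨h₁, h₂⟩, h₃⟩
        exact ⟨h₁, h₂, h₃⟩
      · rintro ⟨h₁, h₂, h₃⟩
        exact ⟨(mem_rem.1 h₁).1.trans_le hGN, ⟨h₁, h₂⟩, h₃⟩
    have h₂ : cnt N (fun v => H.remC (ranC N R) v ∧ labC₂ G H N R u v) =
        #(H.labClass I f (G.lab I id u)) := by
      rw [cnt]
      congr 1
      ext v
      simp only [mem_filter, mem_range, mem_labClass, remC_iff hran hHN, hlab₂]
      exact ⟨fun h => h.2, fun h => ⟨(mem_rem.1 h.1).1.trans_le hHN, h⟩⟩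
    rw [h₁, h₂]
    exact ⟨fun h => h.2, fun h => ⟨(mem_rem.1 h.1).1.trans_le hGN, h⟩⟩

/-- Soundness: the value of a relation is attained by a partial isomorphism. -/
theorem exists_isPI_of_piC (hG : G.Valid) (hH : H.Valid) (hGN : G.n ≤ N) (hHN : H.n ≤ N)
    (hlt : ∀ x y, R x y → x < G.n ∧ y < H.n) (hpi : piC G H N R) :
    ∃ φ, IsPI G H φ ∧ valC G H N R ≤ #φ := by
  classical
  have key : ∀ x, domC N R x → ∃ y < N, R x y := fun x h => h
  choose! f hfN hf using key
  have hI : ∀ x ∈ ({x ∈ range N | domC N R x} : Finset ℕ), x < N ∧ f x < N := fun x hx =>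
    ⟨mem_range.1 (mem_filter.1 hx).1, hfN x (mem_filter.1 hx).2⟩
  have hR : ∀ x < N, ∀ y < N,
      R x y ↔ x ∈ ({x ∈ range N | domC N R x} : Finset ℕ) ∧ y = f x := by
    intro x hx y hy
    constructor
    · intro h
      have hd : domC N R x := ⟨y, hy, h⟩
      refine ⟨mem_filter.2 ⟨mem_range.2 hx, hd⟩, ?_⟩
      -- The partial isomorphism condition for two pairs with the same first vertex says that the
      -- relation is single-valued.
      exact (hpi x hx y hy x hx (f x) (hfN x hd) ⟨h, hf x hd⟩).1.1 rfl
    · rintro ⟨h, rfl⟩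
      exact hf x (mem_filter.1 h).2
  obtain ⟨ψ, -, h, hc⟩ := exists_ext (f := f) (I := {x ∈ range N | domC N R x}) hG hH (by
    refine ⟨fun p hp => ?_, fun p hp q hq => ?_⟩
    · obtain ⟨hx, hy⟩ := mem_gph.1 hp
      rw [hy]
      exact hlt _ _ (hf _ (mem_filter.1 hx).2)
    · obtain ⟨hx, hy⟩ := mem_gph.1 hp
      obtain ⟨hx', hy'⟩ := mem_gph.1 hq
      rw [hy, hy']
      exact hpi _ (hI _ hx).1 _ (hI _ hx).2 _ (hI _ hx').1 _ (hI _ hx').2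
        ⟨hf _ (mem_filter.1 hx).2, hf _ (mem_filter.1 hx').2⟩)
  exact ⟨_, h, (valC_eq hGN hHN hR hI).trans_le hc⟩

theorem piC_of_isPI (hI : IsPI G H (gph I f))
    (hR : ∀ x < N, ∀ y < N, R x y ↔ x ∈ I ∧ y = f x) : piC G H N R := by
  rintro x hx y hy x' hx' y' hy' ⟨h, h'⟩
  exact hI.2 (x, y) (mem_gph.2 ((hR x hx y hy).1 h)) (x', y') (mem_gph.2 ((hR x' hx' y' hy').1 h'))

end Gr

namespace Gr

/-! ### The pools are small -/

/-- A bound for the number of cliques near a threshold on one side. -/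
def classBound (K : ℕ) : ℕ := 2 ^ K * K

/-- A bound for the number of thresholds. -/
def thrBound (K : ℕ) : ℕ := 1 + K + classBound K * K

/-- A bound for the sizes of the pools. -/
def poolBound (K : ℕ) : ℕ := K + thrBound K * (classBound K + classBound K) * K

/-- Type and counter `r` determine the value of `g`, and there are at most `#T * K` such
combinations. In the applications `r` counts the cliques of the same type that have priority. -/
theorem card_image_le_of_inj {τ : Type*} {X : Finset ℕ} {T : Finset τ} {K : ℕ} {g r : ℕ → ℕ}
    {ty : ℕ → τ} (hT : ∀ u ∈ X, ty u ∈ T) (hr : ∀ u ∈ X, r u < K)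
    (h : ∀ u ∈ X, ∀ v ∈ X, ty u = ty v → r u = r v → g u = g v) :
    #(X.image g) ≤ #T * K := by
  classical
  have key : ∀ s ∈ X.image g, ∃ u ∈ X, g u = s := fun s hs => by simpa using hs
  choose! m hm hg using key
  rw [← card_range K, ← card_product]
  refine card_le_card_of_injOn (fun s => (ty (m s), r (m s))) (fun s hs => ?_)
    fun s hs t ht he => ?_
  · have := hm s (mem_coe.1 hs)
    exact mem_coe.2 (mem_product.2 ⟨hT _ this, mem_range.2 (hr _ this)⟩)
  · rw [← hg s (mem_coe.1 hs), ← hg t (mem_coe.1 ht)]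
    exact h _ (hm s (mem_coe.1 hs)) _ (hm t (mem_coe.1 ht)) (congrArg Prod.fst he)
      (congrArg Prod.snd he)

theorem cnt_lt_cnt {N : ℕ} {P Q : ℕ → Prop} {w : ℕ} (hPQ : ∀ v, P v → Q v) (hw : w < N)
    (hQ : Q w) (hP : ¬ P w) : cnt N P < cnt N Q := by
  classical
  refine card_lt_card ⟨fun v hv => ?_, fun hsub => ?_⟩
  · obtain ⟨h₁, h₂⟩ := mem_filter.1 hv
    exact mem_filter.2 ⟨h₁, hPQ v h₂⟩
  · exact hP (mem_filter.1 (hsub (mem_filter.2 ⟨mem_range.2 hw, hQ⟩))).2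

variable {G H : Gr} {N K : ℕ}

open Classical in
/-- The neighbors in the twin cover. -/
noncomputable def ty (G : Gr) (N u : ℕ) : Finset ℕ := {s ∈ range N | G.S s ∧ G.E u s}

theorem sty_of_ty_eq {u v : ℕ} (h : G.ty N u = G.ty N v) : G.sty N u v := by
  intro s hs hS
  have := Finset.ext_iff.1 h s
  simpa [ty, hs, hS] using this

open Classical in
theorem ty_mem (u : ℕ) : G.ty N u ∈ ({s ∈ range N | G.S s} : Finset ℕ).powerset := by
  refine mem_powerset.2 fun s hs => ?_
  obtain ⟨h₁, h₂⟩ := mem_filter.1 hs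
  exact mem_filter.2 ⟨h₁, h₂.1⟩

theorem before_trans {u v w : ℕ} (h : G.before N u v) (h' : G.before N v w) :
    G.before N u w := by
  unfold before at *
  omega

theorem before_irrefl (u : ℕ) : ¬ G.before N u u := by
  unfold before
  omega

theorem before_total {u v : ℕ} (h : u ≠ v) : G.before N u v ∨ G.before N v u := by
  unfold before
  omega

theorem sty.symm {u v : ℕ} (h : G.sty N u v) : G.sty N v u := fun s hs hS => (h s hs hS).symm

theorem leader.lt (hN : G.n ≤ N) {u : ℕ} (h : G.leader N u) : u < N := h.1.1.trans_le hN

open Classical in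
theorem card_type_mul_le (hS : cnt N G.S ≤ K) :
    #({s ∈ range N | G.S s} : Finset ℕ).powerset * K ≤ classBound K := by
  rw [card_powerset]
  exact Nat.mul_le_mul_right _ (Nat.pow_le_pow_right (by omega) hS)

-- Along the order within one type the counter in `nearAbove` increases strictly, and it is below
-- `K`; so each type contributes at most `K` cliques.
open Classical in
theorem card_nearAbove_le (hN : G.n ≤ N) (hS : cnt N G.S ≤ K) (θ : ℕ) :
    #{u ∈ range N | G.leader N u ∧ G.nearAbove N K θ u} ≤ classBound K := by
  refine le_trans ?_ (card_type_mul_le hS)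
  rw [← image_id (s := {u ∈ range N | G.leader N u ∧ G.nearAbove N K θ u})]
  refine card_image_le_of_inj (ty := G.ty N) (r := fun u => cnt N (fun v => G.leader N v ∧
    G.sty N u v ∧ θ ≤ G.size N v ∧ G.before N v u)) (fun u _ => ty_mem u)
    (fun u hu => (mem_filter.1 hu).2.2.2) fun u hu w hw ht hr => ?_
  have H : ∀ u w, G.leader N u → θ ≤ G.size N u → G.sty N u w → G.before N u w →
      cnt N (fun v => G.leader N v ∧ G.sty N u v ∧ θ ≤ G.size N v ∧ G.before N v u) <
      cnt N (fun v => G.leader N v ∧ G.sty N w v ∧ θ ≤ G.size N v ∧ G.before N v w) := by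
    intro u w hu hθ hs hb
    refine cnt_lt_cnt (w := u) ?_ (hu.lt hN) ⟨hu, hs.symm, hθ, hb⟩
      fun h => before_irrefl u h.2.2.2
    exact fun v hv => ⟨hv.1, hs.symm.trans hv.2.1, hv.2.2.1, before_trans hv.2.2.2 hb⟩
  obtain ⟨-, hu₁, hu₂⟩ := mem_filter.1 hu
  obtain ⟨-, hw₁, hw₂⟩ := mem_filter.1 hw
  by_contra hne
  rcases before_total hne with hb | hb
  · exact absurd hr (H u w hu₁ hu₂.1 (sty_of_ty_eq ht) hb).ne
  · exact absurd hr (H w u hw₁ hw₂.1 (sty_of_ty_eq ht.symm) hb).ne'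

open Classical in
theorem card_nearBelow_le (hN : G.n ≤ N) (hS : cnt N G.S ≤ K) (θ : ℕ) :
    #{u ∈ range N | G.leader N u ∧ G.nearBelow N K θ u} ≤ classBound K := by
  refine le_trans ?_ (card_type_mul_le hS)
  rw [← image_id (s := {u ∈ range N | G.leader N u ∧ G.nearBelow N K θ u})]
  refine card_image_le_of_inj (ty := G.ty N) (r := fun u => cnt N (fun v => G.leader N v ∧
    G.sty N u v ∧ G.size N v ≤ θ ∧ G.before N u v)) (fun u _ => ty_mem u)
    (fun u hu => (mem_filter.1 hu).2.2.2) fun u hu w hw ht hr => ?_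
  have H : ∀ u w, G.leader N u → G.size N u ≤ θ → G.sty N u w → G.before N w u →
      cnt N (fun v => G.leader N v ∧ G.sty N u v ∧ G.size N v ≤ θ ∧ G.before N u v) <
      cnt N (fun v => G.leader N v ∧ G.sty N w v ∧ G.size N v ≤ θ ∧ G.before N w v) := by
    intro u w hu hθ hs hb
    refine cnt_lt_cnt (w := u) ?_ (hu.lt hN) ⟨hu, hs.symm, hθ, hb⟩
      fun h => before_irrefl u h.2.2.2
    exact fun v hv => ⟨hv.1, hs.symm.trans hv.2.1, hv.2.2.1, before_trans hb hv.2.2.2⟩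
  obtain ⟨-, hu₁, hu₂⟩ := mem_filter.1 hu
  obtain ⟨-, hw₁, hw₂⟩ := mem_filter.1 hw
  by_contra hne
  rcases before_total hne with hb | hb
  · exact absurd hr (H w u hw₁ hw₂.1 (sty_of_ty_eq ht.symm) hb).ne'
  · exact absurd hr (H u w hu₁ hu₂.1 (sty_of_ty_eq ht) hb).ne

-- Sizes are counted here, not cliques: arbitrarily many cliques of one type may tie in size and all
-- be top.
open Classical in
theorem card_top_size_le (hN : G.n ≤ N) (hS : cnt N G.S ≤ K) :
    #(({u ∈ range N | G.top N K u} : Finset ℕ).image (G.size N)) ≤ classBound K := by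
  refine le_trans ?_ (card_type_mul_le hS)
  refine card_image_le_of_inj (ty := G.ty N) (r := fun u => cnt N (fun v => G.leader N v ∧
    G.sty N u v ∧ G.size N u < G.size N v)) (fun u _ => ty_mem u)
    (fun u hu => (mem_filter.1 hu).2.2) fun u hu w hw ht hr => ?_
  have H : ∀ u w, G.leader N u → G.sty N u w → G.size N w < G.size N u →
      cnt N (fun v => G.leader N v ∧ G.sty N u v ∧ G.size N u < G.size N v) <
      cnt N (fun v => G.leader N v ∧ G.sty N w v ∧ G.size N w < G.size N v) := by
    intro u w hu hs hb
    refine cnt_lt_cnt (w := u) ?_ (hu.lt hN) ⟨hu, hs.symm, hb⟩ fun h => lt_irrefl _ h.2.2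
    exact fun v hv => ⟨hv.1, hs.symm.trans hv.2.1, hb.trans hv.2.2⟩
  have hu₁ := (mem_filter.1 hu).2.1
  have hw₁ := (mem_filter.1 hw).2.1
  rcases lt_trichotomy (G.size N u) (G.size N w) with hb | hb | hb
  · exact absurd hr (H w u hw₁ (sty_of_ty_eq ht.symm) hb).ne'
  · exact hb
  · exact absurd hr (H u w hu₁ (sty_of_ty_eq ht) hb).ne

open Classical in
/-- The thresholds. -/
noncomputable def thr (H : Gr) (N K : ℕ) : Finset ℕ :=
  ({N} ∪ range K) ∪ (({u ∈ range N | H.top N K u} : Finset ℕ).image (H.size N) ×ˢ range K).image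
    fun p => p.1 + p.2

theorem card_thr_le (hN : H.n ≤ N) (hS : cnt N H.S ≤ K) : #(H.thr N K) ≤ thrBound K := by
  classical
  refine (card_union_le _ _).trans (add_le_add ?_ ?_)
  · refine (card_union_le _ _).trans ?_
    simp
  · refine card_image_le.trans ?_
    rw [card_product, card_range]
    exact Nat.mul_le_mul_right _ (card_top_size_le hN hS)

theorem candLeader.exists_thr {u : ℕ} (h : G.candLeader N K H u) :
    ∃ θ ∈ H.thr N K, G.near N K θ u := by
  classical
  rcases h.2 with h | ⟨a, -, ha, h⟩ | ⟨d, hd, a, -, ht, ha, h⟩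
  · exact ⟨N, by simp [thr], h⟩
  · exact ⟨a, by simp [thr, ha], h⟩
  · refine ⟨_, mem_union_right _ (mem_image.2 ⟨(H.size N d, a), mem_product.2 ⟨?_, ?_⟩, rfl⟩), h⟩
    · exact mem_image_of_mem _ (mem_filter.2 ⟨mem_range.2 hd, ht⟩)
    · exact mem_range.2 ha

open Classical in
theorem card_candLeader_le (hGN : G.n ≤ N) (hHN : H.n ≤ N) (hG : cnt N G.S ≤ K)
    (hH : cnt N H.S ≤ K) :
    #{u ∈ range N | G.candLeader N K H u} ≤ thrBound K * (classBound K + classBound K) := by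
  have hsub : ({u ∈ range N | G.candLeader N K H u} : Finset ℕ) ⊆ (H.thr N K).biUnion fun θ =>
      {u ∈ range N | G.leader N u ∧ G.nearAbove N K θ u} ∪
        {u ∈ range N | G.leader N u ∧ G.nearBelow N K θ u} := by
    intro u hu
    obtain ⟨hu, hc⟩ := mem_filter.1 hu
    obtain ⟨θ, hθ, hn⟩ := hc.exists_thr
    refine mem_biUnion.2 ⟨θ, hθ, ?_⟩
    rcases hn with hn | hn
    · exact mem_union_left _ (mem_filter.2 ⟨hu, hc.1, hn⟩)
    · exact mem_union_right _ (mem_filter.2 ⟨hu, hc.1, hn⟩)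
  refine (card_le_card hsub).trans ((card_biUnion_le_card_mul _ _ _ fun θ _ =>
    (card_union_le _ _).trans (add_le_add (card_nearAbove_le hGN hG θ)
      (card_nearBelow_le hGN hG θ))).trans ?_)
  exact Nat.mul_le_mul_right _ (card_thr_le hHN hH)

/-- A candidate is determined by the leader of its clique and its position there, which is below
`K`. -/
theorem cnt_cand_le (hV : G.Valid) (hGN : G.n ≤ N) (hHN : H.n ≤ N) (hG : cnt N G.S ≤ K)
    (hH : cnt N H.S ≤ K) :
    cnt N (G.cand N K H) ≤ thrBound K * (classBound K + classBound K) * K := by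
  classical
  refine le_trans ?_ (Nat.mul_le_mul_right K (card_candLeader_le hGN hHN hG hH))
  rw [← card_range K, ← card_product, card_range K]
  have key : ∀ v, G.cand N K H v → ∃ u < N, G.same u v ∧ G.candLeader N K H u := fun v hv => hv.2
  choose! m h₁ h₂ h₃ using key
  refine card_le_card_of_injOn (fun v => (m v, G.rk N v)) (fun v hv => ?_)
    fun v hv w hw he => ?_
  · have hv := (mem_filter.1 (mem_coe.1 hv)).2
    refine mem_coe.2 (mem_product.2 ⟨mem_filter.2 ⟨mem_range.2 (h₁ v hv), h₃ v hv⟩, ?_⟩)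
    exact mem_range.2 hv.1
  · have hv := (mem_filter.1 (mem_coe.1 hv)).2
    have hw := (mem_filter.1 (mem_coe.1 hw)).2
    have hm : m v = m w := congrArg Prod.fst he
    have hr : G.rk N v = G.rk N w := congrArg Prod.snd he
    have hs := h₂ w hw
    rw [← hm] at hs
    rw [rk_eq_keyPos hV hGN (h₂ v hv), rk_eq_keyPos hV hGN hs] at hr
    refine keyPos_injOn Function.injective_id.injOn ?_ ?_ hr
    · exact mem_coe.2 (mem_filter.2 ⟨mem_range.2 (h₂ v hv).2.1, h₂ v hv⟩)
    · exact mem_coe.2 (mem_filter.2 ⟨mem_range.2 hs.2.1, hs⟩)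

theorem cnt_pool_le (hV : G.Valid) (hGN : G.n ≤ N) (hHN : H.n ≤ N) (hG : cnt N G.S ≤ K)
    (hH : cnt N H.S ≤ K) : cnt N (G.pool N K H) ≤ poolBound K := by
  classical
  have h : cnt N (G.pool N K H) ≤ cnt N G.S + cnt N (G.cand N K H) := by
    rw [cnt, cnt, cnt]
    refine (card_le_card ?_).trans (card_union_le _ _)
    intro v hv
    obtain ⟨h₁, h₂⟩ := mem_filter.1 hv
    rcases h₂ with h₂ | h₂
    · exact mem_union_left _ (mem_filter.2 ⟨h₁, h₂⟩)
    · exact mem_union_right _ (mem_filter.2 ⟨h₁, h₂⟩)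
  exact h.trans (add_le_add hG (cnt_cand_le hV hGN hHN hG hH))

theorem pool.lt (hV : G.Valid) {v : ℕ} (h : G.pool N K H v) : v < G.n := by
  rcases h with h | ⟨-, u, -, h, -⟩
  · exact hV.S_lt h
  · exact h.2.1

end Gr

/-! ### The graphs in memory

Array `0` is the input. The arrays `2` and `3` hold the matchings from which the twin covers are
obtained, the arrays `5` and `6` the pools, and array `4` the powers of the number of choices for
one vertex. -/

namespace MCIS

section defs

variable (A : Mem) (g : ℕ)

open Classical in
/-- The product, for `x` at most the loop bound. -/
noncomputable def bmul (A : Mem) (x y : ℕ) : ℕ := ∑ i ∈ range A.bd, if i < x then y else 0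

/-- The number of vertices of the graph `g`. -/
def vn : ℕ := A.cell 0 g

open Classical in
/-- The start of the adjacency matrix of the graph `g`. -/
noncomputable def off : ℕ := if g = 0 then 3 else 3 + bmul A (vn A 0) (vn A 0)

/-- The adjacency relation of the graph `g`. -/
def adj (u v : ℕ) : Prop :=
  (u < vn A g ∧ v < vn A g) ∧ A.cell 0 (off A g + bmul A u (vn A g) + v) = 1

/-- An edge between vertices that are not twins. -/
def nontwin (u v : ℕ) : Prop :=
  adj A g u v ∧ Bex A.bd fun w => (¬ w = u ∧ ¬ w = v) ∧ ¬ (adj A g u w ↔ adj A g v w)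

/-- `x` is covered by the edges of the matching chosen for vertices before `i`. -/
def marked (i x : ℕ) : Prop :=
  Bex A.bd fun u => (u < i ∧ ¬ A.cell (2 + g) u = 0) ∧ (x = u ∨ A.cell (2 + g) u = x + 1)

/-- The edge from `i` to `w` can be added to the matching. -/
def addable (i w : ℕ) : Prop := nontwin A g i w ∧ ¬ marked A g i i ∧ ¬ marked A g i w

open Classical in
/-- The successor of the first vertex that can be matched to `i`, or `0`. -/
noncomputable def partner (i : ℕ) : ℕ :=
  if Bex A.bd fun w => addable A g i w then
    (cnt A.bd fun w => Ball A.bd fun w' => w' ≤ w → ¬ addable A g i w') + 1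
  else 0

/-- The graph `g` with the twin cover obtained from the matching. -/
def gr : Gr where
  n := vn A g
  E := adj A g
  S := marked A g (vn A g)

/-- A strict upper bound for the number of vertices in the two twin covers. -/
noncomputable def sizeBound : ℕ := cnt A.bd (gr A 0).S + cnt A.bd (gr A 1).S + 1

open Classical in
/-- The indicator function of the pool of the graph `g`. -/
noncomputable def poolInd (v : ℕ) : ℕ :=
  if (gr A g).pool A.bd (sizeBound A) (gr A (1 - g)) v then 1 else 0

/-- `v` is in the pool of the graph `g`, as recorded in memory. -/
def inPool (v : ℕ) : Prop := A.cell (5 + g) v = 1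

/-- The index of `v` in the pool. -/
noncomputable def idx (v : ℕ) : ℕ := cnt A.bd fun w => inPool A g w ∧ w < v

open Classical in
/-- The next power of the number of choices for one vertex. -/
noncomputable def nextPow (i : ℕ) : ℕ :=
  if i = 0 then 1 else bmul A (cnt A.bd (inPool A 1) + 1) (A.cell 4 (i - 1))

/-- The relation between the two pools that is encoded by the number `c`: the digit of `c` at the
index of `x` is the successor of the index of `y`. -/
def rel (c x y : ℕ) : Prop :=
  (inPool A 0 x ∧ inPool A 1 y) ∧ Bex A.bd fun hi => Bex A.bd fun lo =>
    lo < A.cell 4 (idx A 0 x) ∧ c = bmul A hi (A.cell 4 (idx A 0 x + 1)) +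
      bmul A (idx A 1 y + 1) (A.cell 4 (idx A 0 x)) + lo

/-- Some relation between the pools is a partial isomorphism of the value required. -/
def accept : Prop := Bex A.bd fun c => Gr.piC (gr A 0) (gr A 1) A.bd (rel A c) ∧
  A.cell 0 2 ≤ Gr.valC (gr A 0) (gr A 1) A.bd (rel A c)

end defs

/-! ### Computability of the predicates on the memory -/

section computability

variable {Γ : Type} [Ctx Γ] {A : Γ → Mem} {u v c : Γ → ℕ} (g : ℕ)

@[fun_prop]
theorem cp_bmul (hA : Cp A) (hu : Cp u) (hv : Cp v) : Cp fun x => bmul (A x) (u x) (v x) := by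
  unfold bmul
  exact Cp.sum hA (by fun_prop)

@[fun_prop]
theorem cp_vn (hA : Cp A) : Cp fun x => vn (A x) g := by
  unfold vn
  fun_prop

@[fun_prop]
theorem cp_off (hA : Cp A) : Cp fun x => off (A x) g := by
  unfold off
  fun_prop

@[fun_prop]
theorem cp_adj (hA : Cp A) (hu : Cp u) (hv : Cp v) : Cp fun x => adj (A x) g (u x) (v x) := by
  unfold adj
  fun_prop

@[fun_prop]
theorem cp_nontwin (hA : Cp A) (hu : Cp u) (hv : Cp v) :
    Cp fun x => nontwin (A x) g (u x) (v x) := by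
  unfold nontwin
  fun_prop

@[fun_prop]
theorem cp_marked (hA : Cp A) (hu : Cp u) (hv : Cp v) :
    Cp fun x => marked (A x) g (u x) (v x) := by
  unfold marked
  fun_prop

@[fun_prop]
theorem cp_addable (hA : Cp A) (hu : Cp u) (hv : Cp v) :
    Cp fun x => addable (A x) g (u x) (v x) := by
  unfold addable
  fun_prop

@[fun_prop]
theorem cp_partner (hA : Cp A) (hu : Cp u) : Cp fun x => partner (A x) g (u x) := by
  unfold partner
  simp only [imp_iff_not_or]
  fun_prop

@[fun_prop]
theorem cp_same (hA : Cp A) (hu : Cp u) (hv : Cp v) :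
    Cp fun x => (gr (A x) g).same (u x) (v x) := by
  simp only [Gr.same, gr]
  fun_prop

@[fun_prop]
theorem cp_size (hA : Cp A) (hu : Cp u) : Cp fun x => (gr (A x) g).size (A x).bd (u x) := by
  unfold Gr.size
  fun_prop

@[fun_prop]
theorem cp_rk (hA : Cp A) (hu : Cp u) : Cp fun x => (gr (A x) g).rk (A x).bd (u x) := by
  unfold Gr.rk
  fun_prop

@[fun_prop]
theorem cp_leader (hA : Cp A) (hu : Cp u) : Cp fun x => (gr (A x) g).leader (A x).bd (u x) := by
  unfold Gr.leader
  fun_prop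

@[fun_prop]
theorem cp_sty (hA : Cp A) (hu : Cp u) (hv : Cp v) :
    Cp fun x => (gr (A x) g).sty (A x).bd (u x) (v x) := by
  simp only [Gr.sty, gr, imp_iff_not_or]
  fun_prop

@[fun_prop]
theorem cp_before (hA : Cp A) (hu : Cp u) (hv : Cp v) :
    Cp fun x => (gr (A x) g).before (A x).bd (u x) (v x) := by
  unfold Gr.before
  fun_prop

@[fun_prop]
theorem cp_top (hA : Cp A) (hu : Cp u) (hc : Cp c) :
    Cp fun x => (gr (A x) g).top (A x).bd (c x) (u x) := by
  unfold Gr.top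
  fun_prop

@[fun_prop]
theorem cp_near (hA : Cp A) (hu : Cp u) (hv : Cp v) (hc : Cp c) :
    Cp fun x => (gr (A x) g).near (A x).bd (c x) (v x) (u x) := by
  unfold Gr.near Gr.nearAbove Gr.nearBelow
  fun_prop

@[fun_prop]
theorem cp_candLeader (g' : ℕ) (hA : Cp A) (hu : Cp u) (hc : Cp c) :
    Cp fun x => (gr (A x) g).candLeader (A x).bd (c x) (gr (A x) g') (u x) := by
  unfold Gr.candLeader
  fun_prop

@[fun_prop]
theorem cp_cand (g' : ℕ) (hA : Cp A) (hu : Cp u) (hc : Cp c) :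
    Cp fun x => (gr (A x) g).cand (A x).bd (c x) (gr (A x) g') (u x) := by
  unfold Gr.cand
  fun_prop

@[fun_prop]
theorem cp_sizeBound (hA : Cp A) : Cp fun x => sizeBound (A x) := by
  simp only [sizeBound, gr]
  fun_prop

@[fun_prop]
theorem cp_poolInd (hA : Cp A) (hu : Cp u) : Cp fun x => poolInd (A x) g (u x) := by
  have h : Cp fun x => (gr (A x) g).S (u x) := by
    simp only [gr]
    fun_prop
  unfold poolInd Gr.pool
  fun_prop

@[fun_prop]
theorem cp_inPool (hA : Cp A) (hu : Cp u) : Cp fun x => inPool (A x) g (u x) := by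
  unfold inPool
  fun_prop

@[fun_prop]
theorem cp_idx (hA : Cp A) (hu : Cp u) : Cp fun x => idx (A x) g (u x) := by
  unfold idx
  fun_prop

@[fun_prop]
theorem cp_nextPow (hA : Cp A) (hu : Cp u) : Cp fun x => nextPow (A x) (u x) := by
  unfold nextPow
  fun_prop

@[fun_prop]
theorem cp_rel (hA : Cp A) (hu : Cp u) (hv : Cp v) (hc : Cp c) :
    Cp fun x => rel (A x) (c x) (u x) (v x) := by
  unfold rel
  fun_prop

@[fun_prop]
theorem cp_domC (hA : Cp A) (hu : Cp u) (hc : Cp c) :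
    Cp fun x => Gr.domC (A x).bd (rel (A x) (c x)) (u x) := by
  unfold Gr.domC
  fun_prop

@[fun_prop]
theorem cp_ranC (hA : Cp A) (hu : Cp u) (hc : Cp c) :
    Cp fun x => Gr.ranC (A x).bd (rel (A x) (c x)) (u x) := by
  unfold Gr.ranC
  fun_prop

theorem cp_accept : Cp accept := by
  unfold accept Gr.valC Gr.hitC Gr.labC Gr.labC₂ Gr.rrkC Gr.remC Gr.piC
  simp only [imp_iff_not_or]
  simp only [gr]
  fun_prop

end computability

end MCIS

/-! ### A maximal matching covers -/

namespace MCIS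

/-- `x` is covered by an edge of the matching `P` chosen for a vertex before `i`. Here `P u` is `0`
or the successor of the vertex matched to `u`. -/
def Covered (P : ℕ → ℕ) (i x : ℕ) : Prop := ∃ u < i, P u ≠ 0 ∧ (x = u ∨ P u = x + 1)

/-- `P` is a maximal matching of the relation `T`, chosen greedily. -/
structure Greedy (n : ℕ) (T : ℕ → ℕ → Prop) (P : ℕ → ℕ) : Prop where
  edge : ∀ i < n, P i ≠ 0 → ∃ w, P i = w + 1 ∧ T i w ∧ ¬ Covered P i i ∧ ¬ Covered P i w
  maximal : ∀ i < n, P i = 0 → ∀ w, T i w → Covered P i i ∨ Covered P i w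

theorem Covered.mono {P : ℕ → ℕ} {i j x : ℕ} (h : Covered P i x) (hij : i ≤ j) :
    Covered P j x := by
  obtain ⟨u, hu, h⟩ := h
  exact ⟨u, hu.trans_le hij, h⟩

variable {n : ℕ} {T : ℕ → ℕ → Prop} {P : ℕ → ℕ}

theorem Greedy.covers (h : Greedy n T P) {u w : ℕ} (hu : u < n) (hT : T u w) :
    Covered P n u ∨ Covered P n w := by
  by_cases h0 : P u = 0
  · exact (h.maximal u hu h0 w hT).imp (fun h => h.mono hu.le) fun h => h.mono hu.le
  · exact .inl ⟨u, hu, h0, .inl rfl⟩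

/-- Each chosen edge has an endpoint in `C` not covered by earlier edges. These endpoints are
distinct, so there are at most `#C` edges, with two endpoints each. -/
theorem Greedy.cnt_le (h : Greedy n T P) {C : Finset ℕ} (hC : ∀ u w, T u w → u ∈ C ∨ w ∈ C)
    (N : ℕ) : cnt N (Covered P n) ≤ 2 * #C := by
  classical
  have hM : #{u ∈ range n | P u ≠ 0} ≤ #C := by
    have key : ∀ u ∈ ({u ∈ range n | P u ≠ 0} : Finset ℕ), ∃ z ∈ C,
        (z = u ∨ P u = z + 1) ∧ ¬ Covered P u z := by
      intro u hu
      obtain ⟨hu, h0⟩ := mem_filter.1 hu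
      obtain ⟨w, hw, hT, h₁, h₂⟩ := h.edge u (mem_range.1 hu) h0
      rcases hC u w hT with hz | hz
      · exact ⟨u, hz, .inl rfl, h₁⟩
      · exact ⟨w, hz, .inr hw, h₂⟩
    choose! m hm hz hn using key
    refine card_le_card_of_injOn m (fun u hu => hm u hu) fun u hu v hv he => ?_
    have H : ∀ u ∈ ({u ∈ range n | P u ≠ 0} : Finset ℕ),
        ∀ v ∈ ({u ∈ range n | P u ≠ 0} : Finset ℕ), m u = m v → ¬ u < v := by
      intro u hu v hv he hlt
      exact hn v hv ⟨u, hlt, (mem_filter.1 hu).2, he ▸ hz u hu⟩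
    exact le_antisymm (not_lt.1 (H v hv u hu he.symm)) (not_lt.1 (H u hu v hv he))
  have hsub : ({x ∈ range N | Covered P n x} : Finset ℕ) ⊆
      {u ∈ range n | P u ≠ 0} ∪ ({u ∈ range n | P u ≠ 0} : Finset ℕ).image fun u => P u - 1 := by
    intro x hx
    obtain ⟨u, hu, h0, h' | h'⟩ := (mem_filter.1 hx).2
    · subst h'
      exact mem_union_left _ (mem_filter.2 ⟨mem_range.2 hu, h0⟩)
    · refine mem_union_right _ (mem_image.2 ⟨u, mem_filter.2 ⟨mem_range.2 hu, h0⟩, ?_⟩)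
      omega
  have h₁ : cnt N (Covered P n) ≤ _ := (card_le_card hsub).trans (card_union_le _ _)
  have h₂ := card_image_le (s := {u ∈ range n | P u ≠ 0}) (f := fun u => P u - 1)
  omega

/-! ### The graphs of an instance -/

/-- The adjacency relation on the natural numbers. -/
def natAdj {n : ℕ} (G : SimpleGraph (Fin n)) (u v : ℕ) : Prop :=
  ∃ (hu : u < n) (hv : v < n), G.Adj ⟨u, hu⟩ ⟨v, hv⟩

/-- An edge between vertices that are not twins. -/
def natNontwin {n : ℕ} (G : SimpleGraph (Fin n)) (u v : ℕ) : Prop :=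
  natAdj G u v ∧ ∃ w < n, (¬ w = u ∧ ¬ w = v) ∧ ¬ (natAdj G u w ↔ natAdj G v w)

theorem natAdj_symm {n : ℕ} {G : SimpleGraph (Fin n)} {u v : ℕ} (h : natAdj G u v) :
    natAdj G v u := by
  obtain ⟨hu, hv, h⟩ := h
  exact ⟨hv, hu, h.symm⟩

theorem natAdj_val {n : ℕ} {G : SimpleGraph (Fin n)} {u v : Fin n} :
    natAdj G u v ↔ G.Adj u v :=
  ⟨fun ⟨_, _, h⟩ => h, fun h => ⟨u.2, v.2, h⟩⟩

/-- The graph with the twin cover obtained from a matching. -/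
def natGr {n : ℕ} (G : SimpleGraph (Fin n)) (P : ℕ → ℕ) : Gr := ⟨n, natAdj G, Covered P n⟩

/-- An edge between non-twins with both ends uncovered would contradict the maximality of the
matching; so adjacent uncovered vertices are twins. -/
theorem natGr_valid {n : ℕ} {G : SimpleGraph (Fin n)} {P : ℕ → ℕ}
    (h : Greedy n (natNontwin G) P) : (natGr G P).Valid where
  symm := natAdj_symm
  irrefl := fun _ ⟨_, _, h⟩ => G.irrefl h
  lt := fun ⟨h, _⟩ => h
  S_lt := by
    rintro x ⟨u, hu, h0, rfl | hx⟩
    · exact hu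
    · obtain ⟨w, hw, ⟨⟨-, hwn, -⟩, -⟩, -⟩ := h.edge u hu h0
      change x < n
      omega
  twin := by
    intro u v w hu hv huv hwu hwv
    by_contra hcon
    have hw : w < n := by
      by_contra hw
      exact hcon (iff_of_false (fun h => hw h.2.1) fun h => hw h.2.1)
    rcases h.covers huv.1 (w := v) ⟨huv, w, hw, ⟨hwu, hwv⟩, hcon⟩ with h | h
    · exact hu h
    · exact hv h

theorem not_twins_of_natNontwin {n : ℕ} {G : SimpleGraph (Fin n)} {u v : Fin n}
    (h : natNontwin G u v) : G.Adj u v ∧ ¬ G.Twins u v := by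
  obtain ⟨h₁, w, hw, ⟨hwu, hwv⟩, h₂⟩ := h
  refine ⟨natAdj_val.1 h₁, fun ht => h₂ ?_⟩
  have := Set.ext_iff.1 ht ⟨w, hw⟩
  simp only [Set.mem_sdiff, SimpleGraph.mem_neighborSet, Set.mem_singleton_iff, Fin.ext_iff, hwu,
    hwv, not_false_eq_true, and_true] at this
  rwa [← natAdj_val, ← natAdj_val] at this

theorem cnt_covered_le {n : ℕ} {G : SimpleGraph (Fin n)} {P : ℕ → ℕ}
    (h : Greedy n (natNontwin G) P) (N : ℕ) :
    cnt N (Covered P n) ≤ 2 * G.twinCoverNumber := by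
  classical
  obtain ⟨S, hS, hc⟩ : G.twinCoverNumber ∈
      {k : ℕ | ∃ S : Finset (Fin n), G.IsTwinCover S ∧ S.card = k} :=
    Nat.sInf_mem ⟨_, univ, fun u _ _ _ => .inl (mem_univ u), rfl⟩
  rw [← hc, ← card_image_of_injective S Fin.val_injective]
  refine h.cnt_le (fun u w hT => ?_) N
  obtain ⟨⟨hu, hw, -⟩, -⟩ := id hT
  obtain ⟨h₁, h₂⟩ := not_twins_of_natNontwin (u := ⟨u, hu⟩) (v := ⟨w, hw⟩) hT
  exact (hS _ _ h₁ h₂).imp (fun h => mem_image_of_mem Fin.val h)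
    fun h => mem_image_of_mem Fin.val h

/-- Two embeddings of one graph are the same as a set of pairs that respects equality and adjacency.
The covers play no role, hence `P` and `Q` are arbitrary. -/
theorem isYes_iff (x : MCISInstance) (P Q : ℕ → ℕ) :
    x.IsYes ↔ ∃ φ, Gr.IsPI (natGr x.G₁ P) (natGr x.G₂ Q) φ ∧ x.h ≤ #φ := by
  classical
  constructor
  · rintro ⟨m, H, hm, ⟨e₁⟩, ⟨e₂⟩⟩
    have hinj : Function.Injective fun i : Fin m => (((e₁ i : Fin _) : ℕ), ((e₂ i : Fin _) : ℕ)) :=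
      fun i j h => e₁.injective (Fin.ext (congrArg Prod.fst h))
    refine ⟨univ.image fun i : Fin m => (((e₁ i : Fin _) : ℕ), ((e₂ i : Fin _) : ℕ)), ⟨?_, ?_⟩, ?_⟩
    · intro p hp
      obtain ⟨i, -, rfl⟩ := mem_image.1 hp
      exact ⟨(e₁ i).2, (e₂ i).2⟩
    · intro p hp q hq
      obtain ⟨i, -, rfl⟩ := mem_image.1 hp
      obtain ⟨j, -, rfl⟩ := mem_image.1 hq
      constructor
      · simp only [← Fin.ext_iff, e₁.injective.eq_iff, e₂.injective.eq_iff]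
      · simp only [natGr, natAdj_val, SimpleGraph.Embedding.map_adj_iff]
    · rw [card_image_of_injective _ hinj, card_univ, Fintype.card_fin]
      exact hm
  · rintro ⟨φ, ⟨h₁, h₂⟩, hc⟩
    let e := φ.equivFin
    let a : Fin #φ → Fin x.n₁ := fun i => ⟨(e.symm i).1.1, (h₁ _ (e.symm i).2).1⟩
    let b : Fin #φ → Fin x.n₂ := fun i => ⟨(e.symm i).1.2, (h₁ _ (e.symm i).2).2⟩
    have hab : ∀ i j, (a i = a j ↔ b i = b j) ∧ (x.G₁.Adj (a i) (a j) ↔ x.G₂.Adj (b i) (b j)) := by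
      intro i j
      have := h₂ _ (e.symm i).2 _ (e.symm j).2
      rw [Fin.ext_iff, Fin.ext_iff, ← natAdj_val, ← natAdj_val]
      exact this
    have ha : Function.Injective a := by
      intro i j h
      have h' := (hab i j).1.1 h
      refine e.symm.injective (Subtype.ext (Prod.ext ?_ ?_))
      · exact congrArg Fin.val h
      · exact congrArg Fin.val h'
    have hb : Function.Injective b := fun i j h => ha ((hab i j).1.2 h)
    -- The common graph is pulled back from the first graph along the enumeration of the pairs.
    refine ⟨#φ, x.G₁.comap a, hc, ⟨⟨⟨a, ha⟩, Iff.rfl⟩⟩, ⟨⟨⟨b, hb⟩, ?_⟩⟩⟩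
    intro i j
    exact (hab i j).2.symm

/-! ### The encoding of an instance -/

theorem getD_flatMap {α : Type*} {m : ℕ} (l : List α) (F : α → List ℕ)
    (hF : ∀ a, (F a).length = m) {i j : ℕ} (hi : i < l.length) (hj : j < m) (t : List ℕ) :
    (l.flatMap F ++ t).getD (i * m + j) 0 = (F l[i]).getD j 0 := by
  induction l generalizing i with
  | nil => simp at hi
  | cons a l ih =>
    rw [List.flatMap_cons, List.append_assoc]
    cases i with
    | zero =>
      rw [List.getD_append _ _ _ _ (by rw [hF]; omega)]
      simp
    | succ i =>
      rw [List.getD_append_right _ _ _ _ (by rw [hF]; nlinarith)]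
      rw [hF, show (i + 1) * m + j - m = i * m + j by rw [add_mul]; omega]
      exact ih (by simpa using hi)

theorem length_adjList {n : ℕ} (G : SimpleGraph (Fin n)) :
    (MCISInstance.adjList G).length = n * n := by
  simp [MCISInstance.adjList]

open Classical in
theorem getD_adjList {n : ℕ} (G : SimpleGraph (Fin n)) {u v : ℕ} (hu : u < n) (hv : v < n)
    (t : List ℕ) : (MCISInstance.adjList G ++ t).getD (u * n + v) 0 =
      if natAdj G u v then 1 else 0 := by
  rw [MCISInstance.adjList, getD_flatMap (m := n) _ _ (by simp) (by simpa using hu) hv]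
  simp [natAdj, hu, hv, List.getD_eq_getElem?_getD]

end MCIS

namespace MCIS

/-! ### The contents of the memory -/

theorem bmul_eq {A : Mem} {a : ℕ} (h : a ≤ A.bd) (b : ℕ) : bmul A a b = a * b := by
  rw [bmul, ← sum_filter, sum_const, smul_eq_mul]
  congr 1
  have : ({i ∈ range A.bd | i < a} : Finset ℕ) = range a := by
    ext i
    simp only [mem_filter, mem_range]
    omega
  rw [this, card_range]

/-- Array `0` holds the instance, and the loop bound is large enough for its vertices. -/
structure Good (x : MCISInstance) (A : Mem) : Prop where
  input : A.cell 0 = fun i => x.encode.getD i 0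
  lt₁ : x.n₁ < A.bd
  lt₂ : x.n₂ < A.bd

/-- The graph `g` in memory is `G`. -/
structure Holds {n : ℕ} (A : Mem) (g : ℕ) (G : SimpleGraph (Fin n)) : Prop where
  vn_eq : vn A g = n
  adj_eq : adj A g = natAdj G
  lt : n < A.bd

variable {x : MCISInstance} {A B : Mem}

theorem Good.vn_zero (h : Good x A) : vn A 0 = x.n₁ := by
  rw [vn, h.input]
  rfl

theorem Good.vn_one (h : Good x A) : vn A 1 = x.n₂ := by
  rw [vn, h.input]
  rfl

theorem Good.cell_two (h : Good x A) : A.cell 0 2 = x.h := by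
  rw [h.input]
  rfl

theorem getD_encode (x : MCISInstance) (i : ℕ) : x.encode.getD (3 + i) 0 =
    (MCISInstance.adjList x.G₁ ++ MCISInstance.adjList x.G₂).getD i 0 := by
  rw [MCISInstance.encode, List.append_assoc, List.getD_append_right _ _ _ _ (by simp)]
  simp

theorem Good.holds₁ (h : Good x A) : Holds A 0 x.G₁ := by
  refine ⟨h.vn_zero, ?_, h.lt₁⟩
  funext u v
  rw [adj, h.vn_zero]
  by_cases hu : u < x.n₁
  · by_cases hv : v < x.n₁
    · rw [bmul_eq (hu.trans h.lt₁).le, off, if_pos rfl, h.input, add_assoc]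
      simp only [getD_encode, getD_adjList x.G₁ hu hv]
      simp [hu, hv]
    · simp [natAdj, hv]
  · simp [natAdj, hu]

theorem Good.holds₂ (h : Good x A) : Holds A 1 x.G₂ := by
  refine ⟨h.vn_one, ?_, h.lt₂⟩
  funext u v
  rw [adj, h.vn_one]
  by_cases hu : u < x.n₂
  · by_cases hv : v < x.n₂
    · rw [bmul_eq (hu.trans h.lt₂).le, off, if_neg one_ne_zero, h.vn_zero, bmul_eq h.lt₁.le,
        h.input, add_assoc, add_assoc]
      simp only [getD_encode]
      rw [List.getD_append_right _ _ _ _ (by rw [length_adjList]; omega), length_adjList,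
        Nat.add_sub_cancel_left, ← List.append_nil (MCISInstance.adjList x.G₂),
        getD_adjList x.G₂ hu hv]
      simp [hu, hv]
    · simp [natAdj, hv]
  · simp [natAdj, hu]

theorem nontwin_iff {n g : ℕ} {G : SimpleGraph (Fin n)} (h : Holds A g G) (u v : ℕ) :
    nontwin A g u v ↔ natNontwin G u v := by
  rw [nontwin, natNontwin, h.adj_eq]
  refine and_congr_right fun _ => ⟨?_, ?_⟩
  · rintro ⟨w, -, hw, hn⟩
    refine ⟨w, ?_, hw, hn⟩
    by_contra hlt
    exact hn (iff_of_false (fun h => hlt h.2.1) fun h => hlt h.2.1)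
  · rintro ⟨w, hwn, hw⟩
    exact ⟨w, hwn.trans h.lt, hw⟩

theorem marked_iff {g i y : ℕ} (hi : i ≤ A.bd) :
    marked A g i y ↔ Covered (A.cell (2 + g)) i y := by
  constructor
  · rintro ⟨u, -, ⟨h₁, h₂⟩, h₃⟩
    exact ⟨u, h₁, h₂, h₃⟩
  · rintro ⟨u, h₁, h₂, h₃⟩
    exact ⟨u, h₁.trans_le hi, ⟨h₁, h₂⟩, h₃⟩

theorem gr_eq {n g : ℕ} {G : SimpleGraph (Fin n)} (h : Holds A g G) :
    gr A g = natGr G (A.cell (2 + g)) := by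
  have hS : marked A g (vn A g) = Covered (A.cell (2 + g)) n := by
    funext y
    rw [h.vn_eq]
    exact propext (marked_iff h.lt.le)
  rw [gr, natGr, hS, h.vn_eq, h.adj_eq]

theorem fill_cell_of_ne {a b : ℕ} (h : b ≠ a) (F : Mem × ℕ → ℕ) (A : Mem) :
    (fill a F A).cell b = A.cell b := funext fun j => fillTo_cell_of_ne h F A _ j

theorem fill_bd {a : ℕ} (ha : a ≠ 1) (F : Mem × ℕ → ℕ) (A : Mem) : (fill a F A).bd = A.bd :=
  fillTo_bd ha F A _

theorem Good.fillTo (h : Good x A) {a : ℕ} (h₀ : a ≠ 0) (h₁ : a ≠ 1) (F : Mem × ℕ → ℕ) (n : ℕ) :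
    Good x (fillTo a F A n) := by
  have hb := fillTo_bd h₁ F A n
  refine ⟨?_, by rw [hb]; exact h.lt₁, by rw [hb]; exact h.lt₂⟩
  rw [← h.input]
  exact funext fun j => fillTo_cell_of_ne h₀.symm F A n j

theorem Good.fill (h : Good x A) {a : ℕ} (h₀ : a ≠ 0) (h₁ : a ≠ 1) (F : Mem × ℕ → ℕ) :
    Good x (fill a F A) := h.fillTo h₀ h₁ F _

/-- Bounded minimization by counting: the least witness is the number of `w` up to which no witness
has appeared. -/
theorem cnt_eq_find {N : ℕ} {Q : ℕ → Prop} (h : ∃ w < N, Q w) :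
    ∃ w < N, Q w ∧ cnt N (fun w => Ball N fun w' => w' ≤ w → ¬ Q w') = w := by
  classical
  obtain ⟨h₁, h₂⟩ := Nat.find_spec h
  refine ⟨Nat.find h, h₁, h₂, ?_⟩
  rw [cnt]
  conv_rhs => rw [← card_range (Nat.find h)]
  congr 1
  ext w
  simp only [mem_filter, mem_range]
  constructor
  · rintro ⟨-, hw⟩
    by_contra hlt
    exact hw _ h₁ (not_lt.1 hlt) h₂
  · intro hw
    exact ⟨hw.trans h₁, fun w' hw' hle hQ => Nat.find_min h (hle.trans_lt hw) ⟨hw', hQ⟩⟩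

/-- After the array has been filled, it holds a maximal matching. -/
theorem greedy_fill {n g : ℕ} {G : SimpleGraph (Fin n)}
    (h : ∀ i, Holds (fillTo (2 + g) (fun p => partner p.1 g p.2) A i) g G) :
    Greedy n (natNontwin G) ((fill (2 + g) (fun p => partner p.1 g p.2) A).cell (2 + g)) := by
  set F : Mem × ℕ → ℕ := fun p => partner p.1 g p.2 with hF
  have hn : n < A.bd := (h 0).lt
  have hbd : ∀ i, (fillTo (2 + g) F A i).bd = A.bd := fillTo_bd (by omega) F A
  -- In round `i` only the cells below `i` are read, and they already have their final values.
  have hcov : ∀ i < n, ∀ y, marked (fillTo (2 + g) F A i) g i y ↔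
      Covered ((fill (2 + g) F A).cell (2 + g)) i y := by
    intro i hi y
    rw [marked_iff (by rw [hbd]; omega)]
    refine exists_congr fun u => and_congr_right fun hu => ?_
    rw [fill, fillTo_cell_stable (2 + g) F A hu (by omega : i ≤ A.bd)]
  have hadd : ∀ i < n, ∀ w, addable (fillTo (2 + g) F A i) g i w ↔ natNontwin G i w ∧
      ¬ Covered ((fill (2 + g) F A).cell (2 + g)) i i ∧
      ¬ Covered ((fill (2 + g) F A).cell (2 + g)) i w := by
    intro i hi w
    rw [addable, nontwin_iff (h i), hcov i hi, hcov i hi]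
  have hcell : ∀ i < n, (fill (2 + g) F A).cell (2 + g) i =
      partner (fillTo (2 + g) F A i) g i := fun i hi => fillTo_cell _ _ _ (hi.trans hn)
  constructor
  · intro i hi h0
    have hc := hcell i hi
    rw [partner] at hc
    split_ifs at hc with hex
    · obtain ⟨w, -, hw, hcnt⟩ := cnt_eq_find hex
      rw [hcnt] at hc
      exact ⟨w, hc, (hadd i hi w).1 hw⟩
    · exact absurd hc h0
  · intro i hi h0 w hT
    have hc := hcell i hi
    rw [h0, partner] at hc
    split_ifs at hc with hex
    · by_contra hcon
      rw [not_or] at hcon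
      have hw : w < (fillTo (2 + g) F A i).bd := by
        rw [hbd]
        exact hT.1.2.1.trans hn
      exact hex ⟨w, hw, (hadd i hi w).2 ⟨hT, hcon⟩⟩

/-! ### Encoding partial functions by numbers -/

/-- The number with base `m` digits `D`, built from the lowest digit upwards. -/
theorem exists_code {m : ℕ} (q : ℕ) (D : ℕ → ℕ) (hD : ∀ i < q, D i < m) :
    ∃ c < m ^ q, ∀ i < q, c / m ^ i % m = D i := by
  induction q generalizing D with
  | zero => exact ⟨0, by simp, fun i hi => absurd hi (by omega)⟩
  | succ q ih =>
    obtain ⟨c, hc, h⟩ := ih (fun i => D (i + 1)) fun i hi => hD (i + 1) (by omega)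
    have h0 := hD 0 (by omega)
    have hm : 0 < m := by omega
    refine ⟨D 0 + m * c, ?_, fun i hi => ?_⟩
    · rw [pow_succ]
      calc D 0 + m * c < m * (c + 1) := by rw [mul_add]; omega
        _ ≤ m * m ^ q := Nat.mul_le_mul_left m hc
        _ = m ^ q * m := mul_comm _ _
    · cases i with
      | zero => simp [Nat.add_mul_mod_self_left, Nat.mod_eq_of_lt h0]
      | succ i =>
        rw [pow_succ', ← Nat.div_div_eq_div_mul, Nat.add_mul_div_left _ _ hm,
          Nat.div_eq_of_lt h0, zero_add]
        exact h i (by omega)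

/-- A digit is recognized by searching for the part above it and the part below it, since the
machine has no division. Both parts are at most `c`, so the search is bounded. -/
theorem digit_iff {m i c d N : ℕ} (hd : d < m) (hc : c < N) :
    (∃ hi < N, ∃ lo < N, lo < m ^ i ∧ c = hi * m ^ (i + 1) + d * m ^ i + lo) ↔
      c / m ^ i % m = d := by
  have hm : 0 < m := by omega
  have hp : 0 < m ^ i := Nat.pow_pos hm
  constructor
  · rintro ⟨hi, -, lo, -, hlo, rfl⟩
    rw [show hi * m ^ (i + 1) + d * m ^ i + lo = lo + m ^ i * (d + m * hi) by ring,
      Nat.add_mul_div_left _ _ hp, Nat.div_eq_of_lt hlo, zero_add, Nat.add_mul_mod_self_left,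
      Nat.mod_eq_of_lt hd]
  · rintro rfl
    refine ⟨c / m ^ i / m, (Nat.div_le_self _ _).trans_lt ((Nat.div_le_self _ _).trans_lt hc),
      c % m ^ i, (Nat.mod_le _ _).trans_lt hc, Nat.mod_lt _ hp, ?_⟩
    have h₁ := Nat.div_add_mod c (m ^ i)
    have h₂ := Nat.div_add_mod (c / m ^ i) m
    calc c = m ^ i * (c / m ^ i) + c % m ^ i := h₁.symm
      _ = m ^ i * (m * (c / m ^ i / m) + c / m ^ i % m) + c % m ^ i := by rw [h₂]
      _ = _ := by ring

end MCIS

namespace MCIS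

/-! ### The algorithm -/

/-- Set the loop bound. -/
def setBound (A : Mem) : Mem := A.set 1 0 (A.bd + vn A 0 + vn A 1 + 3)

/-- Compute the twin covers, the pools, and the powers of the number of choices. -/
noncomputable def prepare (A : Mem) : Mem :=
  fill 4 (fun p => nextPow p.1 p.2) (fill 6 (fun p => poolInd p.1 1 p.2)
    (fill 5 (fun p => poolInd p.1 0 p.2) (fill (2 + 1) (fun p => partner p.1 1 p.2)
      (fill (2 + 0) (fun p => partner p.1 0 p.2) A))))

/-- Raise the loop bound by the number of maps between the pools. -/
noncomputable def raiseBound (A : Mem) : Mem :=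
  A.set 1 0 (A.bd + A.cell 4 (cnt A.bd (inPool A 0)))

theorem tr_algorithm : Tr fun A => raiseBound (prepare (setBound A)) := by
  refine Tr.comp (U := raiseBound) (T := fun A => prepare (setBound A)) ?_
    (Tr.comp (U := prepare) (T := setBound) ?_ ?_)
  · refine Tr.assign 1 0 (F := fun A => A.bd + A.cell 4 (cnt A.bd (inPool A 0))) (by fun_prop) ?_
    intro A
    change A.bd ≤ (A.set 1 0 _).cell 1 0
    rw [Mem.set_cell, if_pos ⟨rfl, rfl⟩]
    omega
  · unfold prepare
    refine (Tr.fill (by decide) (by fun_prop)).comp ((Tr.fill (by decide) (by fun_prop)).comp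
      ((Tr.fill (by decide) (by fun_prop)).comp ((Tr.fill (by decide) (by fun_prop)).comp
        (Tr.fill (by decide) (by fun_prop)))))
  · refine Tr.assign 1 0 (F := fun A => A.bd + vn A 0 + vn A 1 + 3) (by fun_prop) ?_
    intro A
    change A.bd ≤ (A.set 1 0 _).cell 1 0
    rw [Mem.set_cell, if_pos ⟨rfl, rfl⟩]
    omega

/-- The twin covers, the pools and the powers have been computed. -/
structure Ready (x : MCISInstance) (A : Mem) : Prop where
  good : Good x A
  greedy₁ : Greedy x.n₁ (natNontwin x.G₁) (A.cell 2)
  greedy₂ : Greedy x.n₂ (natNontwin x.G₂) (A.cell 3)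
  pool₁ : ∀ v, inPool A 0 v ↔ (gr A 0).pool A.bd (sizeBound A) (gr A 1) v
  pool₂ : ∀ v, inPool A 1 v ↔ (gr A 1).pool A.bd (sizeBound A) (gr A 0) v
  pow : ∀ i < A.bd, A.cell 4 i = (cnt A.bd (inPool A 1) + 1) ^ i

/-! ### Correctness of the prepared memory -/

variable {x : MCISInstance} {A B : Mem}

/-- The graph read from memory depends only on the input and on the matching. It survives the
filling of other arrays and a change of the loop bound. -/
theorem gr_congr₁ (hA : Good x A) (hB : Good x B) (h : A.cell 2 = B.cell 2) :
    gr A 0 = gr B 0 := by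
  rw [gr_eq hA.holds₁, gr_eq hB.holds₁, h]

theorem gr_congr₂ (hA : Good x A) (hB : Good x B) (h : A.cell 3 = B.cell 3) :
    gr A 1 = gr B 1 := by
  rw [gr_eq hA.holds₂, gr_eq hB.holds₂]
  exact congrArg _ h

theorem poolInd_congr {g : ℕ} (hg : g = 0 ∨ g = 1) (h₀ : gr A 0 = gr B 0) (h₁ : gr A 1 = gr B 1)
    (hb : A.bd = B.bd) (v : ℕ) : poolInd A g v = poolInd B g v := by
  have h : (gr A g).pool A.bd (sizeBound A) (gr A (1 - g)) v ↔
      (gr B g).pool B.bd (sizeBound B) (gr B (1 - g)) v := by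
    rcases hg with rfl | rfl
    · simp only [sizeBound, Nat.sub_zero, h₀, h₁, hb]
    · simp only [sizeBound, Nat.sub_self, h₀, h₁, hb]
  classical
  unfold poolInd
  exact if_congr h rfl rfl

/-- Filling an array with the indicator function of a pool records the pool. -/
theorem inPool_fill {g : ℕ} (hg : g = 0 ∨ g = 1) (hA : Good x A)
    (hz : ∀ v, A.cell (5 + g) v = 0) (hlt : ∀ v,
      (gr A g).pool A.bd (sizeBound A) (gr A (1 - g)) v → v < A.bd) (v : ℕ) :
    inPool (fill (5 + g) (fun p => poolInd p.1 g p.2) A) g v ↔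
      (gr A g).pool A.bd (sizeBound A) (gr A (1 - g)) v := by
  rw [inPool]
  by_cases hv : v < A.bd
  · rw [fill, fillTo_cell _ _ _ hv]
    set F : Mem × ℕ → ℕ := fun p => poolInd p.1 g p.2
    have hG : Good x (fillTo (5 + g) F A v) := hA.fillTo (by omega) (by omega) F v
    have h₀ : gr (fillTo (5 + g) F A v) 0 = gr A 0 :=
      gr_congr₁ hG hA (funext fun j => fillTo_cell_of_ne (by omega) F A v j)
    have h₁ : gr (fillTo (5 + g) F A v) 1 = gr A 1 :=
      gr_congr₂ hG hA (funext fun j => fillTo_cell_of_ne (by omega) F A v j)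
    change poolInd (fillTo (5 + g) F A v) g v = 1 ↔ _
    rw [poolInd_congr hg h₀ h₁ (fillTo_bd (by omega) F A v), poolInd]
    simp
  · rw [fill, fillTo_cell_of_le _ _ _ (not_lt.1 hv), hz]
    exact iff_of_false (by simp) fun h => hv (hlt v h)

/-- Each power is computed from the previous cell, already final. The hypothesis makes the base at
most the loop bound, so that `bmul` is the true product. -/
theorem fillTo_nextPow (hm : cnt A.bd (inPool A 1) < A.bd) (n : ℕ) :
    ∀ i < n, (fillTo 4 (fun p => nextPow p.1 p.2) A n).cell 4 i =
      (cnt A.bd (inPool A 1) + 1) ^ i := by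
  set F : Mem × ℕ → ℕ := fun p => nextPow p.1 p.2
  have key : ∀ i n, i < n → (fillTo 4 F A n).cell 4 i = (cnt A.bd (inPool A 1) + 1) ^ i := by
    intro i
    induction i with
    | zero =>
      intro n hn
      rw [fillTo_cell _ _ _ hn]
      simp [F, nextPow]
    | succ i ih =>
      intro n hn
      rw [fillTo_cell _ _ _ hn]
      have hb : (fillTo 4 F A (i + 1)).bd = A.bd := fillTo_bd (by decide) F A _
      have hp : inPool (fillTo 4 F A (i + 1)) 1 = inPool A 1 := by
        funext v
        rw [inPool, inPool, fillTo_cell_of_ne (by decide)]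
      change nextPow (fillTo 4 F A (i + 1)) (i + 1) = _
      rw [nextPow, if_neg (by omega), hb, hp, bmul_eq (by rw [hb]; omega), Nat.add_sub_cancel,
        ih (i + 1) (by omega), pow_succ']
  exact fun i hi => key i n hi

theorem cnt_le_of_lt {N n : ℕ} {P : ℕ → Prop} (h : ∀ v, P v → v < n) : cnt N P ≤ n := by
  classical
  conv_rhs => rw [← card_range n]
  exact card_le_card fun v hv => mem_range.2 (h v (mem_filter.1 hv).2)

/-- The arrays must start at zero because filling stops at the loop bound: cells beyond it then
record no pool vertex. Each array depends only on the input and on arrays filled before it. -/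
theorem ready_prepare (hA : Good x A) (hz : ∀ a, a ≠ 0 → a ≠ 1 → ∀ v, A.cell a v = 0) :
    Ready x (prepare A) ∧ (prepare A).bd = A.bd := by
  set A₁ := fill (2 + 0) (fun p => partner p.1 0 p.2) A with hA₁
  set A₂ := fill (2 + 1) (fun p => partner p.1 1 p.2) A₁ with hA₂
  set A₃ := fill 5 (fun p => poolInd p.1 0 p.2) A₂ with hA₃
  set A₄ := fill 6 (fun p => poolInd p.1 1 p.2) A₃ with hA₄
  set A₅ := fill 4 (fun p => nextPow p.1 p.2) A₄ with hA₅
  have h5 : prepare A = A₅ := rfl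
  rw [h5]
  have g₁ : Good x A₁ := hA.fill (by decide) (by decide) _
  have g₂ : Good x A₂ := g₁.fill (by decide) (by decide) _
  have g₃ : Good x A₃ := g₂.fill (by decide) (by decide) _
  have g₄ : Good x A₄ := g₃.fill (by decide) (by decide) _
  have g₅ : Good x A₅ := g₄.fill (by decide) (by decide) _
  have b₁ : A₁.bd = A.bd := fill_bd (by decide) _ _
  have b₂ : A₂.bd = A₁.bd := fill_bd (by decide) _ _
  have b₃ : A₃.bd = A₂.bd := fill_bd (by decide) _ _
  have b₄ : A₄.bd = A₃.bd := fill_bd (by decide) _ _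
  have b₅ : A₅.bd = A₄.bd := fill_bd (by decide) _ _
  have c₂ : ∀ a, a ≠ 3 → A₂.cell a = A₁.cell a := fun a h => fill_cell_of_ne h _ _
  have c₃ : ∀ a, a ≠ 5 → A₃.cell a = A₂.cell a := fun a h => fill_cell_of_ne h _ _
  have c₄ : ∀ a, a ≠ 6 → A₄.cell a = A₃.cell a := fun a h => fill_cell_of_ne h _ _
  have c₅ : ∀ a, a ≠ 4 → A₅.cell a = A₄.cell a := fun a h => fill_cell_of_ne h _ _
  have e₁ : Greedy x.n₁ (natNontwin x.G₁) (A₅.cell 2) := by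
    rw [c₅ 2 (by decide), c₄ 2 (by decide), c₃ 2 (by decide), c₂ 2 (by decide)]
    exact greedy_fill fun i => (hA.fillTo (by decide) (by decide) _ i).holds₁
  have e₂ : Greedy x.n₂ (natNontwin x.G₂) (A₅.cell 3) := by
    rw [c₅ 3 (by decide), c₄ 3 (by decide), c₃ 3 (by decide)]
    exact greedy_fill fun i => (g₁.fillTo (by decide) (by decide) _ i).holds₂
  have k₂ : gr A₂ 0 = gr A₅ 0 := gr_congr₁ g₂ g₅ (by
    rw [c₅ 2 (by decide), c₄ 2 (by decide), c₃ 2 (by decide)])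
  have l₂ : gr A₂ 1 = gr A₅ 1 := gr_congr₂ g₂ g₅ (by
    rw [c₅ 3 (by decide), c₄ 3 (by decide), c₃ 3 (by decide)])
  have k₃ : gr A₃ 0 = gr A₅ 0 := gr_congr₁ g₃ g₅ (by
    rw [c₅ 2 (by decide), c₄ 2 (by decide)])
  have l₃ : gr A₃ 1 = gr A₅ 1 := gr_congr₂ g₃ g₅ (by
    rw [c₅ 3 (by decide), c₄ 3 (by decide)])
  have v₁ : (gr A₅ 0).Valid := by
    rw [gr_eq g₅.holds₁]
    exact natGr_valid e₁
  have v₂ : (gr A₅ 1).Valid := by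
    rw [gr_eq g₅.holds₂]
    exact natGr_valid e₂
  have n₁ : (gr A₅ 0).n = x.n₁ := g₅.vn_zero
  have n₂ : (gr A₅ 1).n = x.n₂ := g₅.vn_one
  have s₂ : sizeBound A₂ = sizeBound A₅ := by simp only [sizeBound, k₂, l₂, b₅, b₄, b₃]
  have s₃ : sizeBound A₃ = sizeBound A₅ := by simp only [sizeBound, k₃, l₃, b₅, b₄]
  have p₁ : ∀ v, inPool A₅ 0 v ↔ (gr A₅ 0).pool A₅.bd (sizeBound A₅) (gr A₅ 1) v := by
    intro v
    have := inPool_fill (g := 0) (.inl rfl) g₂ (fun v => by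
      rw [c₂ 5 (by decide), hA₁, fill_cell_of_ne (by decide)]
      exact hz 5 (by decide) (by decide) v) (fun v hv => by
        rw [Nat.sub_zero, k₂, l₂] at hv
        have := hv.lt v₁
        rw [n₁] at this
        exact this.trans g₂.lt₁) v
    rw [Nat.sub_zero, k₂, l₂, s₂] at this
    rw [b₅, b₄, b₃, ← this, inPool, inPool, c₅ 5 (by decide), c₄ 5 (by decide)]
  have p₂ : ∀ v, inPool A₅ 1 v ↔ (gr A₅ 1).pool A₅.bd (sizeBound A₅) (gr A₅ 0) v := by
    intro v
    have := inPool_fill (g := 1) (.inr rfl) g₃ (fun v => by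
      rw [c₃ 6 (by decide), c₂ 6 (by decide), hA₁, fill_cell_of_ne (by decide)]
      exact hz 6 (by decide) (by decide) v) (fun v hv => by
        rw [Nat.sub_self, k₃, l₃] at hv
        have := hv.lt v₂
        rw [n₂] at this
        exact this.trans g₃.lt₂) v
    rw [Nat.sub_self, k₃, l₃, s₃] at this
    rw [b₅, b₄, ← this, inPool, inPool, c₅ 6 (by decide)]
  have q₂ : cnt A₄.bd (inPool A₄ 1) < A₄.bd := by
    refine lt_of_le_of_lt (cnt_le_of_lt (n := x.n₂) fun v hv => ?_) g₄.lt₂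
    have : inPool A₅ 1 v := by rwa [inPool, c₅ 6 (by decide)]
    have := ((p₂ v).1 this).lt v₂
    rwa [n₂] at this
  refine ⟨⟨g₅, e₁, e₂, p₁, p₂, fun i hi => ?_⟩, by rw [b₅, b₄, b₃, b₂, b₁]⟩
  have hp : inPool A₅ 1 = inPool A₄ 1 := by
    funext v
    rw [inPool, inPool, c₅ 6 (by decide)]
  rw [hp, b₅]
  rw [b₅] at hi
  exact fillTo_nextPow q₂ A₄.bd i hi

/-! ### Deciding the instance from the prepared memory -/

theorem Ready.valid₁ (h : Ready x A) : (gr A 0).Valid := by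
  rw [gr_eq h.good.holds₁]
  exact natGr_valid h.greedy₁

theorem Ready.valid₂ (h : Ready x A) : (gr A 1).Valid := by
  rw [gr_eq h.good.holds₂]
  exact natGr_valid h.greedy₂

theorem Ready.lt₁ (h : Ready x A) {v : ℕ} (hv : inPool A 0 v) : v < x.n₁ := by
  have := ((h.pool₁ v).1 hv).lt h.valid₁
  rwa [show (gr A 0).n = x.n₁ from h.good.vn_zero] at this

theorem Ready.lt₂ (h : Ready x A) {v : ℕ} (hv : inPool A 1 v) : v < x.n₂ := by
  have := ((h.pool₂ v).1 hv).lt h.valid₂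
  rwa [show (gr A 1).n = x.n₂ from h.good.vn_one] at this

theorem Ready.cnt_lt (h : Ready x A) : cnt A.bd (inPool A 0) < A.bd :=
  (cnt_le_of_lt fun _ hv => h.lt₁ hv).trans_lt h.good.lt₁

theorem Ready.raiseBound_bd (h : Ready x A) : (raiseBound A).bd =
    A.bd + (cnt A.bd (inPool A 1) + 1) ^ cnt A.bd (inPool A 0) := by
  change (A.set 1 0 _).cell 1 0 = _
  rw [Mem.set_cell, if_pos ⟨rfl, rfl⟩, h.pow _ h.cnt_lt]

theorem raiseBound_cell {a : ℕ} (ha : a ≠ 1) : (raiseBound A).cell a = A.cell a := by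
  funext j
  rw [raiseBound, Mem.set_cell, if_neg fun h => ha h.1]

theorem Ready.good_raiseBound (h : Ready x A) : Good x (raiseBound A) := by
  have hb := h.raiseBound_bd
  have h₁ := h.good.lt₁
  have h₂ := h.good.lt₂
  refine ⟨?_, by omega, by omega⟩
  rw [raiseBound_cell (by decide), h.good.input]

theorem inPool_raiseBound (g : ℕ) : inPool (raiseBound A) g = inPool A g := by
  funext v
  rw [inPool, inPool, raiseBound_cell (by omega)]

-- Pool indices do not depend on the loop bound, provided it exceeds all pool vertices; so they are
-- unaffected when the bound is raised.
open Classical in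
theorem idx_eq {g N : ℕ} (hN : ∀ v, inPool A g v → v < N) (hN' : ∀ v, inPool A g v → v < A.bd)
    (v : ℕ) : idx A g v = keyPos ({w ∈ range N | inPool A g w} : Finset ℕ) id v := by
  rw [idx, cnt, keyPos, filter_filter]
  congr 1
  ext w
  simp only [mem_filter, mem_range, id]
  exact ⟨fun h => ⟨hN w h.2.1, h.2⟩, fun h => ⟨hN' w h.2.1, h.2⟩⟩

/-- The final test decides the instance. -/
theorem Ready.accept_iff (h : Ready x A) : accept (raiseBound A) ↔ x.IsYes := by
  classical
  have hg := h.good_raiseBound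
  have hb := h.raiseBound_bd
  have e₀ : gr (raiseBound A) 0 = gr A 0 :=
    gr_congr₁ hg h.good (raiseBound_cell (by decide))
  have e₁ : gr (raiseBound A) 1 = gr A 1 :=
    gr_congr₂ hg h.good (raiseBound_cell (by decide))
  have n₁ : (gr A 0).n = x.n₁ := h.good.vn_zero
  have n₂ : (gr A 1).n = x.n₂ := h.good.vn_one
  have hyes : x.IsYes ↔ ∃ φ, Gr.IsPI (gr A 0) (gr A 1) φ ∧ x.h ≤ #φ := by
    rw [gr_eq h.good.holds₁, gr_eq h.good.holds₂]
    exact isYes_iff x _ _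
  rw [hyes, accept, e₀, e₁, hg.cell_two]
  constructor
  · rintro ⟨c, -, hpi, hval⟩
    obtain ⟨φ, hφ, hle⟩ := Gr.exists_isPI_of_piC h.valid₁ h.valid₂ (n₁.trans_lt hg.lt₁).le
      (n₂.trans_lt hg.lt₂).le (fun u v huv => by
        obtain ⟨⟨h₁, h₂⟩, -⟩ := huv
        rw [inPool_raiseBound] at h₁ h₂
        exact ⟨n₁ ▸ h.lt₁ h₁, n₂ ▸ h.lt₂ h₂⟩) hpi
    exact ⟨φ, hφ, hval.trans hle⟩
  · rintro ⟨φ, hφ, hle⟩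
    -- This is applied with `K = sizeBound A`, which is one more than the number of cover vertices.
    obtain ⟨I, f, hI, hpool, hval⟩ := Gr.exists_pool_map h.valid₁ h.valid₂
      (n₁.trans_lt h.good.lt₁) (n₂.trans_lt h.good.lt₂) (Nat.lt_succ_self _) hφ
    have hI₁ : ∀ u ∈ I, inPool A 0 u := fun u hu => (h.pool₁ u).2 (hpool u hu).1
    have hI₂ : ∀ u ∈ I, inPool A 1 (f u) := fun u hu => (h.pool₂ _).2 (hpool u hu).2
    set m := cnt A.bd (inPool A 1) + 1 with hm
    set q := cnt A.bd (inPool A 0) with hq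
    have i₁ : ∀ v, idx (raiseBound A) 0 v =
        keyPos ({w ∈ range A.bd | inPool A 0 w} : Finset ℕ) id v := by
      intro v
      have h₁ : ∀ v, inPool A 0 v → v < A.bd := fun v hv => (h.lt₁ hv).trans h.good.lt₁
      have := idx_eq (A := raiseBound A) (g := 0) (N := A.bd)
        (by rw [inPool_raiseBound]; exact h₁)
        (by rw [inPool_raiseBound]; exact fun v hv => (h.lt₁ hv).trans hg.lt₁) v
      rwa [inPool_raiseBound] at this
    have i₂ : ∀ v, idx (raiseBound A) 1 v =
        keyPos ({w ∈ range A.bd | inPool A 1 w} : Finset ℕ) id v := by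
      intro v
      have h₁ : ∀ v, inPool A 1 v → v < A.bd := fun v hv => (h.lt₂ hv).trans h.good.lt₂
      have := idx_eq (A := raiseBound A) (g := 1) (N := A.bd)
        (by rw [inPool_raiseBound]; exact h₁)
        (by rw [inPool_raiseBound]; exact fun v hv => (h.lt₂ hv).trans hg.lt₂) v
      rwa [inPool_raiseBound] at this
    have mem₁ : ∀ {v}, inPool A 0 v → v ∈ ({w ∈ range A.bd | inPool A 0 w} : Finset ℕ) :=
      fun {v} hv => mem_filter.2 ⟨mem_range.2 ((h.lt₁ hv).trans h.good.lt₁), hv⟩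
    have mem₂ : ∀ {v}, inPool A 1 v → v ∈ ({w ∈ range A.bd | inPool A 1 w} : Finset ℕ) :=
      fun {v} hv => mem_filter.2 ⟨mem_range.2 ((h.lt₂ hv).trans h.good.lt₂), hv⟩
    have lt₁ : ∀ {v}, inPool A 0 v → idx (raiseBound A) 0 v < q := fun {v} hv => by
      rw [i₁]
      exact keyPos_lt_card (mem₁ hv)
    have lt₂ : ∀ {v}, inPool A 1 v → idx (raiseBound A) 1 v + 1 < m := fun {v} hv => by
      rw [i₂]
      exact Nat.add_lt_add_right (keyPos_lt_card (mem₂ hv)) 1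
    have inj₁ : ∀ {u v}, inPool A 0 u → inPool A 0 v →
        idx (raiseBound A) 0 u = idx (raiseBound A) 0 v → u = v := fun {u v} hu hv he => by
      rw [i₁, i₁] at he
      exact keyPos_injOn Function.injective_id.injOn (mem₁ hu) (mem₁ hv) he
    have inj₂ : ∀ {u v}, inPool A 1 u → inPool A 1 v →
        idx (raiseBound A) 1 u = idx (raiseBound A) 1 v → u = v := fun {u v} hu hv he => by
      rw [i₂, i₂] at he
      exact keyPos_injOn Function.injective_id.injOn (mem₂ hu) (mem₂ hv) he
    -- The digit at the index of `u ∈ I` is the index of `f u` plus one; the digit `0` means that no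
    -- image is given.
    obtain ⟨c, hc, hdig⟩ := exists_code (m := m) q (fun i =>
      if hex : ∃ u ∈ I, idx (raiseBound A) 0 u = i then idx (raiseBound A) 1 (f hex.choose) + 1
      else 0) (fun i _ => by
        split_ifs with hex
        · exact lt₂ (hI₂ _ hex.choose_spec.1)
        · omega)
    -- The code is below `m ^ q`, which is exactly the amount added to the loop bound.
    have hcb : c < (raiseBound A).bd := by omega
    have hrel : ∀ u < (raiseBound A).bd, ∀ v < (raiseBound A).bd,
        rel (raiseBound A) c u v ↔ u ∈ I ∧ v = f u := by
      intro u _ v _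
      have hdI : u ∈ I → c / m ^ idx (raiseBound A) 0 u % m =
          idx (raiseBound A) 1 (f u) + 1 := fun hu => by
        have hex : ∃ w ∈ I, idx (raiseBound A) 0 w = idx (raiseBound A) 0 u := ⟨u, hu, rfl⟩
        rw [hdig _ (lt₁ (hI₁ u hu)), dif_pos hex]
        rw [inj₁ (hI₁ _ hex.choose_spec.1) (hI₁ u hu) hex.choose_spec.2]
      have hmain : inPool A 0 u → inPool A 1 v → ((Bex (raiseBound A).bd fun hi =>
          Bex (raiseBound A).bd fun lo => lo < (raiseBound A).cell 4 (idx (raiseBound A) 0 u) ∧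
          c = bmul (raiseBound A) hi ((raiseBound A).cell 4 (idx (raiseBound A) 0 u + 1)) +
          bmul (raiseBound A) (idx (raiseBound A) 1 v + 1)
            ((raiseBound A).cell 4 (idx (raiseBound A) 0 u)) + lo) ↔
          c / m ^ idx (raiseBound A) 0 u % m = idx (raiseBound A) 1 v + 1) := by
        intro hu hv
        have hq' := lt₁ hu
        have hqb := h.cnt_lt
        have hm' := lt₂ hv
        have hvb : idx (raiseBound A) 1 v + 1 ≤ (raiseBound A).bd := by
          have h₁ : cnt A.bd (inPool A 1) ≤ x.n₂ := cnt_le_of_lt fun _ hv => h.lt₂ hv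
          have := hg.lt₂
          omega
        rw [← digit_iff hm' hcb]
        refine exists_congr fun hi => and_congr_right fun hhi => exists_congr fun lo =>
          and_congr_right fun _ => ?_
        rw [raiseBound_cell (by decide), h.pow _ (by omega), h.pow _ (by omega),
          bmul_eq hhi.le, bmul_eq hvb]
      rw [rel, inPool_raiseBound, inPool_raiseBound]
      constructor
      · rintro ⟨⟨hu, hv⟩, hex⟩
        have hd := (hmain hu hv).1 hex
        -- The digit is a successor, so it is not the default `0`, and the index belongs to a vertex
        -- of `I`.
        have huI : u ∈ I := by
          rw [hdig _ (lt₁ hu)] at hd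
          split_ifs at hd with hex'
          obtain ⟨w, hw, he⟩ := hex'
          rwa [← inj₁ (hI₁ w hw) hu he]
        refine ⟨huI, ?_⟩
        rw [hdI huI] at hd
        exact (inj₂ (hI₂ u huI) hv (Nat.succ_injective hd)).symm
      · rintro ⟨hu, rfl⟩
        exact ⟨⟨hI₁ u hu, hI₂ u hu⟩, (hmain (hI₁ u hu) (hI₂ u hu)).2 (hdI hu)⟩
    refine ⟨c, hcb, Gr.piC_of_isPI hI hrel, ?_⟩
    rw [Gr.valC_eq (n₁.trans_lt hg.lt₁).le (n₂.trans_lt hg.lt₂).le hrel fun u hu =>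
      ⟨(h.lt₁ (hI₁ u hu)).trans hg.lt₁, (h.lt₂ (hI₂ u hu)).trans hg.lt₂⟩]
    exact hle.trans hval

/-! ### The running time -/

/-- A bound for the number of maps between the pools. -/
def mapBound (t : ℕ) : ℕ := (Gr.poolBound (2 * t + 1) + 1) ^ Gr.poolBound (2 * t + 1)

theorem poolBound_mono : Monotone Gr.poolBound := by
  intro a b h
  unfold Gr.poolBound Gr.thrBound Gr.classBound
  gcongr <;> omega

/-- The matchings cover at most twice the twin cover numbers, so `K` is at most `2 * tcSum + 1`, and
the pools are bounded in terms of `K`. -/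
theorem Ready.pow_le (h : Ready x A) :
    (cnt A.bd (inPool A 1) + 1) ^ cnt A.bd (inPool A 0) ≤ mapBound x.tcSum := by
  have hS : cnt A.bd (gr A 0).S ≤ 2 * x.G₁.twinCoverNumber := by
    rw [gr_eq h.good.holds₁]
    exact cnt_covered_le h.greedy₁ _
  have hS' : cnt A.bd (gr A 1).S ≤ 2 * x.G₂.twinCoverNumber := by
    rw [gr_eq h.good.holds₂]
    exact cnt_covered_le h.greedy₂ _
  have hK : sizeBound A ≤ 2 * x.tcSum + 1 := by
    rw [sizeBound, MCISInstance.tcSum]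
    omega
  have n₁ : (gr A 0).n ≤ A.bd := h.good.vn_zero.trans_le h.good.lt₁.le
  have n₂ : (gr A 1).n ≤ A.bd := h.good.vn_one.trans_le h.good.lt₂.le
  have s₁ : cnt A.bd (gr A 0).S ≤ sizeBound A := by
    rw [sizeBound]
    omega
  have s₂ : cnt A.bd (gr A 1).S ≤ sizeBound A := by
    rw [sizeBound]
    omega
  have p₁ : cnt A.bd (inPool A 0) ≤ Gr.poolBound (2 * x.tcSum + 1) := by
    rw [show inPool A 0 = _ from funext fun v => propext (h.pool₁ v)]
    exact (Gr.cnt_pool_le h.valid₁ n₁ n₂ s₁ s₂).trans (poolBound_mono hK)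
  have p₂ : cnt A.bd (inPool A 1) ≤ Gr.poolBound (2 * x.tcSum + 1) := by
    rw [show inPool A 1 = _ from funext fun v => propext (h.pool₂ v)]
    exact (Gr.cnt_pool_le h.valid₂ n₂ n₁ s₂ s₁).trans (poolBound_mono hK)
  exact (Nat.pow_le_pow_left (by omega) _).trans (Nat.pow_le_pow_right (by omega) p₁)

/-- The memory at the start. -/
noncomputable def initMem (x : MCISInstance) : Mem := ⟨(initState x.encode).arr⟩

theorem initMem_input (x : MCISInstance) :
    (initMem x).cell 0 = fun i => x.encode.getD i 0 := by
  funext i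
  simp [initMem, initState]

theorem setBound_cell {a : ℕ} (h : a ≠ 1) : (setBound A).cell a = A.cell a := by
  funext j
  rw [setBound, Mem.set_cell, if_neg fun h' => h h'.1]

theorem setBound_bd (x : MCISInstance) : (setBound (initMem x)).bd = x.n₁ + x.n₂ + 3 := by
  have h₀ : (initMem x).bd = 0 := by simp [Mem.bd, initMem, initState]
  have h₁ : vn (initMem x) 0 = x.n₁ := by
    rw [vn, initMem_input]
    rfl
  have h₂ : vn (initMem x) 1 = x.n₂ := by
    rw [vn, initMem_input]
    rfl
  change ((initMem x).set 1 0 _).cell 1 0 = _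
  rw [Mem.set_cell, if_pos ⟨rfl, rfl⟩, h₀, h₁, h₂, zero_add]

theorem ready_algorithm (x : MCISInstance) : Ready x (prepare (setBound (initMem x))) ∧
    (prepare (setBound (initMem x))).bd = x.n₁ + x.n₂ + 3 := by
  have hb := setBound_bd x
  have hg : Good x (setBound (initMem x)) :=
    ⟨by rw [setBound_cell (by decide), initMem_input], by omega, by omega⟩
  obtain ⟨h₁, h₂⟩ := ready_prepare hg fun a h₀ h₁ v => by
    rw [setBound_cell h₁]
    simp [initMem, initState, h₀]
  exact ⟨h₁, h₂.trans hb⟩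

theorem length_encode (x : MCISInstance) :
    x.encode.length = 3 + x.n₁ * x.n₁ + x.n₂ * x.n₂ := by
  simp [MCISInstance.encode, length_adjList]
  omega

/-- The final bound is `n₁ + n₂ + 3` plus the number of maps. As `n ≤ n * n`, the first part is at
most the input length; the factor `4` is generous. -/
theorem bound_le (x : MCISInstance) :
    (raiseBound (prepare (setBound (initMem x)))).bd + 1 ≤
      4 * mapBound x.tcSum * x.encode.length := by
  obtain ⟨h, hb⟩ := ready_algorithm x
  rw [h.raiseBound_bd, hb, length_encode]
  have hM := h.pow_le
  rw [hb] at hM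
  have h1 : 1 ≤ mapBound x.tcSum := Nat.one_le_pow _ _ (by omega)
  set M := mapBound x.tcSum
  set L := 3 + x.n₁ * x.n₁ + x.n₂ * x.n₂ with hL
  have a₁ : x.n₁ ≤ x.n₁ * x.n₁ := Nat.le_mul_self _
  have a₂ : x.n₂ ≤ x.n₂ * x.n₂ := Nat.le_mul_self _
  have a₃ : L ≤ M * L := Nat.le_mul_of_pos_left _ h1
  have a₄ : M ≤ M * L := Nat.le_mul_of_pos_right _ (by omega)
  have a₅ : 4 * M * L = 4 * (M * L) := by ring
  omega

theorem computable_bound (C k : ℕ) : Computable fun t => C * (4 * mapBound t) ^ k := by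
  have hpow : Primrec₂ ((· ^ ·) : ℕ → ℕ → ℕ) := Primrec₂.unpaired'.1 Nat.Primrec.pow
  have hadd := Primrec.nat_add
  have hmul := Primrec.nat_mul
  have hclass : Primrec Gr.classBound :=
    hmul.comp (hpow.comp (Primrec.const 2) Primrec.id) Primrec.id
  have hthr : Primrec Gr.thrBound :=
    hadd.comp (hadd.comp (Primrec.const 1) Primrec.id) (hmul.comp hclass Primrec.id)
  have hpool : Primrec Gr.poolBound := hadd.comp Primrec.id
    (hmul.comp (hmul.comp hthr (hadd.comp hclass hclass)) Primrec.id)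
  have harg : Primrec fun t : ℕ => Gr.poolBound (2 * t + 1) := hpool.comp
    (hadd.comp (hmul.comp (Primrec.const 2) Primrec.id) (Primrec.const 1))
  have hmap : Primrec mapBound := hpow.comp (hadd.comp harg (Primrec.const 1)) harg
  exact (hmul.comp (Primrec.const C)
    (hpow.comp (hmul.comp (Primrec.const 4) hmap) (Primrec.const k))).to_comp

end MCIS

/-- Maximum Common Induced Subgraph is fixed-parameter tractable parameterized by
`tc(G₁) + tc(G₂)`. -/
theorem mainTheorem1 :
    IsFPT MCISInstance.encode MCISInstance.tcSum MCISInstance.IsYes := by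
  obtain ⟨C, k, p, hp⟩ := MCIS.tr_algorithm.decide MCIS.cp_accept
  refine ⟨p, fun t => C * (4 * MCIS.mapBound t) ^ k, k, MCIS.computable_bound C k, fun x => ?_⟩
  obtain ⟨s, ⟨t, ht, he⟩, hyes, hno⟩ := hp (initState x.encode)
  have hacc := (MCIS.ready_algorithm x).1.accept_iff
  refine ⟨t, s, he, ht.trans ?_, fun h => hyes (hacc.2 h), fun h => hno fun h' => h (hacc.1 h')⟩
  -- The factor `(4 * mapBound t) ^ k` depends on the parameter only, leaving the input length to
  -- the same power `k`.
  rw [mul_assoc, ← mul_pow]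
  exact Nat.mul_le_mul_left C (Nat.pow_le_pow_left (MCIS.bound_le x) k)
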